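/- Let $X\in\{B,D\}$. Use the alphabets $\mathcal A_m^B=\{\overline m<\dots<\overline 1<0<1<\dots<m\}$ and $\mathcal A_m^D=\mathcal A_m^B\setminus\{0\}$ ($m\ge 2$ in type $D$), and regard words $x_1\cdots x_l$ on them as the vertices $x_1\otimes\cdots\otimes x_l$ of the crystal of the tensor powers of the vector representation of type $X_m$; write $w\sim_m w'$ if an isomorphism of crystals between the connected components of $w$ and $w'$ sends $w$ to $w'$. Let $\mathbf T$ be the set of Kashiwara–Nakashima tableaux of type $X$, of any rank $m$ and of any shape with integer parts, i.e. the fillings $T$ of a Young diagram whose column reading $\mathrm w(T)$ (columns from right to left, each from top to bottom) is a vertex of the corresponding crystal $B(\lambda)$. For a word $w$, let $P(w)$ be the tableau obtained from $w$ by column insertion without contraction: $P(w)=T$ if, for some $m$ such that $w$ is a word on $\mathcal A_m^X$, $T$ is a tableau of rank $m$ with $\mathrm w(T)\sim_m w$ having as many boxes as $w$ has letters. A tableau has weight $0$ if for every $i\ge 1$ it contains as many letters $\overline i$ as letters $i$; let $\mathbf T[0]$ be the set of tableaux of weight $0$. For $T\in\mathbf T[0]$ with more than one column, let $x$ be the rightmost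 letter of its longest row, write $\mathrm w(T)=xu$, and set $U(T)=P(ux)$ (the cocyclage of $T$; there is no cocyclage operation on columns). The cyclage graph on $\mathbf T[0]$ has an arrow $T\to T'$ if and only if $T$ has more than one column and $T'=U(T)$. **Proposition.** Let $T_0\in\mathbf T[0]$ be nonempty, and let $T_{k+1}=U(T_k)$ as long as $T_k$ has more than one column. Then this sequence is well defined, with all its terms in $\mathbf T[0]$, it is finite and without repetition, and it ends at a column of weight $0$: there is an integer $e\ge 0$ such that $T_0\to T_1\to\dots\to T_e$ is a path in the cyclage graph, $T_0,\dots,T_e$ are pairwise distinct, and $T_e\in\mathbf T[0]$ has exactly one column. -/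

import Mathlib

/-!  Kashiwara-Nakashima tableaux of types `B` and `D`, defined through crystals of words,
and the cocyclage operation on them.

Letters are integers: the barred letter `k̄` is the integer `-k`, so that the infinite alphabet of
type `B` is `ℤ` and the one of type `D` is `ℤ` without `0`.  Words are lists of integers, the word
`x₁ x₂ ⋯ x_l` standing for the vertex `x₁ ⊗ x₂ ⊗ ⋯ ⊗ x_l` of the crystal. -/

namespace OrthogonalTableaux

/-- The two families of orthogonal root systems: `B_m` and `D_m`. -/
inductive OType
  | B
  | D

/-- The ranks `m` for which the root system is considered: every `m` in type `B`
(only the letter `0` and no operator for `m = 0`), and `m ≥ 2` in type `D`. -/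
def ValidRank : OType → ℕ → Prop
  | OType.B, _ => True
  | OType.D, m => 2 ≤ m

/-- `x` belongs to the alphabet of rank `m`:
`{m̄, …, 1̄, 0, 1, …, m}` in type `B`, `{m̄, …, 1̄, 1, …, m}` in type `D`. -/
def InAlphabet : OType → ℕ → ℤ → Prop
  | OType.B, m, x => |x| ≤ (m : ℤ)
  | OType.D, m, x => |x| ≤ (m : ℤ) ∧ x ≠ 0

/-! ### Crystals of words -/

/-- The operator `f_i` on the vector representation. For `i ≥ 1` the arrows of colour `i` are
`(i+1)̄ → ī` and `i → i+1`; those of colour `0` are `1̄ → 0 → 1` in type `B`, and `2̄ → 1`, `1̄ → 2`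
in type `D`. -/
def letterF : OType → ℕ → ℤ → Option ℤ
  | OType.B, 0, x => if x = -1 then some 0 else if x = 0 then some 1 else none
  | OType.D, 0, x => if x = -2 then some 1 else if x = -1 then some 2 else none
  | _, (i + 1), x =>
      if x = -((i : ℤ) + 2) ∨ x = (i : ℤ) + 1 then some (x + 1) else none

/-- `φ_i` of a letter: how many times `f_i` can be applied to it. -/
def letterPhi (X : OType) (i : ℕ) (x : ℤ) : ℕ :=
  match letterF X i x with
  | none => 0
  | some y => if (letterF X i y).isSome then 2 else 1

/-- `ε_i` of a letter: the length of the `i`-string arriving at it. The vector representation is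
self-dual, `x ↦ x̄` reversing the arrows without changing their colours, so `ε_i(x) = φ_i(x̄)`. -/
def letterEps (X : OType) (i : ℕ) (x : ℤ) : ℕ := letterPhi X i (-x)

/-- The pair `(ε_i(w), φ_i(w))` of a word, where `ε_i(w)` (resp. `φ_i(w)`) is the largest number of
times that `e_i` (resp. `f_i`) can be applied to `w`. By the tensor product rule it is given by
`ε_i(u ⊗ v) = ε_i(u) + max(0, ε_i(v) - φ_i(u))` and `φ_i(u ⊗ v) = φ_i(v) + max(0, φ_i(u) - ε_i(v))`
(truncated subtraction of natural numbers is meant here). -/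
def epsPhi (X : OType) (i : ℕ) : List ℤ → ℕ × ℕ
  | [] => (0, 0)
  | x :: w =>
      (letterEps X i x + ((epsPhi X i w).1 - letterPhi X i x),
        (epsPhi X i w).2 + (letterPhi X i x - (epsPhi X i w).1))

/-- The crystal operator `f_i` on words (`none` stands for `0`), by the tensor product rule:
`f_i(u ⊗ v)` is `f_i(u) ⊗ v` if `φ_i(u) > ε_i(v)` and `u ⊗ f_i(v)` otherwise. -/
def wordF (X : OType) (i : ℕ) : List ℤ → Option (List ℤ)
  | [] => none
  | x :: w =>
      if (epsPhi X i w).1 < letterPhi X i x then (letterF X i x).map (fun y => y :: w)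
      else (wordF X i w).map (fun v => x :: v)

/-- The arrows of the crystal graph of rank `m`: its colours are `0, …, m - 1`. -/
def Arrow (X : OType) (m : ℕ) (u v : List ℤ) : Prop :=
  ∃ i < m, wordF X i u = some v

/-- `u` and `v` lie in the same connected component of the crystal graph of rank `m`. -/
def Connected (X : OType) (m : ℕ) (u v : List ℤ) : Prop :=
  Relation.EqvGen (Arrow X m) u v

/-- The connected component of `w` in the crystal graph of rank `m`. -/
abbrev Component (X : OType) (m : ℕ) (w : List ℤ) : Type :=
  {u : List ℤ // Connected X m w u}

/-- The relation `u ∼_m v`: the words `u` and `v` occur at the same place in two isomorphic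
connected components, i.e. some isomorphism of oriented coloured graphs between their
connected components sends `u` to `v`. -/
def Equivalent (X : OType) (m : ℕ) (u v : List ℤ) : Prop :=
  ∃ φ : Component X m u ≃ Component X m v,
    (φ ⟨u, Relation.EqvGen.refl u⟩ : List ℤ) = v ∧
    ∀ i < m, ∀ a b : Component X m u,
      wordF X i a.1 = some b.1 ↔ wordF X i (φ a).1 = some (φ b).1

/-! ### Kashiwara-Nakashima tableaux -/

/-- A filling, given by its columns `C₁ ⋯ C_r` from left to right, each of them being read
from top to bottom. -/
abbrev Filling : Type := List (List ℤ)

/-- The column reading: columns from right to left, each of them from top to bottom. -/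
def reading (T : Filling) : List ℤ := T.reverse.flatten

/-- The columns are nonempty and their heights weakly decrease from left to right, i.e. `T` is a
filling of a Young diagram. -/
def HasYoungShape (T : Filling) : Prop :=
  (∀ C ∈ T, C ≠ []) ∧ (T.map List.length).Pairwise (· ≥ ·)

/-- The filling of the same shape as `T` whose `k`-th row contains only the barred letter of index
`m - k + 1`, that is the integer `-(m - k + 1)`; rows are counted from `j = k - 1 = 0`. -/
def highestFilling (m : ℕ) (T : Filling) : Filling :=
  T.map (fun C => (List.range C.length).map (fun j => (j : ℤ) - (m : ℤ)))

/-- The same filling with the letters `1̄` changed into `1`. It gives the highest weight vertex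
in type `D` for the weights whose last coordinate is negative. -/
def highestFillingNeg (m : ℕ) (T : Filling) : Filling :=
  (highestFilling m T).map (fun C => C.map (fun x => if x = -1 then 1 else x))

/-- `T` is a Kashiwara-Nakashima tableau of rank `m` (with integral shape): a filling of a
Young diagram with at most `m` rows whose column reading is a vertex of the crystal `B(λ)`, the
connected component of the reading of the highest weight filling. -/
def IsTableauOfRank (X : OType) (m : ℕ) (T : Filling) : Prop :=
  ValidRank X m ∧ HasYoungShape T ∧ (∀ C ∈ T, C.length ≤ m) ∧
    (Connected X m (reading (highestFilling m T)) (reading T) ∨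
      (X = OType.D ∧ Connected X m (reading (highestFillingNeg m T)) (reading T)))

/-- The set `𝐓` of (partition shaped) tableaux of type `B` or `D`, of any rank. -/
def IsTableau (X : OType) (T : Filling) : Prop := ∃ m, IsTableauOfRank X m T

/-- The coordinate `d_{ī}` of the weight of a word: its number of letters `ī` minus its number of
letters `i`. -/
def weightCoord (w : List ℤ) (i : ℕ) : ℤ := (w.count (-(i : ℤ)) : ℤ) - (w.count (i : ℤ) : ℤ)

/-- The set `𝐓[μ]` of tableaux of weight `μ = (μ_{n̄}, …, μ_{1̄})`, where `μ j` stands for the part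
of index `j + 1` barred. -/
def tableauxOfWeight (X : OType) {n : ℕ} (μ : Fin n → ℕ) : Set Filling :=
  {T | IsTableau X T ∧ (∀ j : Fin n, weightCoord (reading T) (j + 1) = μ j) ∧
    ∀ i, n < i → weightCoord (reading T) i = 0}

/-! ### The symbol `P(w)` and the cocyclage operation -/

/-- `T = P(w)`. For a word `w` on the alphabet of rank `m`, the symbol `P_m(w)` is the tableau
`T` of rank `m` with `w ∼_m reading T`. Contraction relations are the only plactic relations that
change the length, and they shorten the word, so that `P_m(w)` is obtained without contraction
exactly when it has as many boxes as `w` has letters; then `P(w) = P_m(w)`. -/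
def IsPSymbol (X : OType) (w : List ℤ) (T : Filling) : Prop :=
  ∃ m, (∀ x ∈ w, InAlphabet X m x) ∧ IsTableauOfRank X m T ∧
    Equivalent X m w (reading T) ∧ (reading T).length = w.length

/-- The condition under which the cocyclage is authorized: some column contains the letter `n` or
does not contain the letter `n̄`. -/
def Authorized (n : ℕ) (T : Filling) : Prop :=
  ∃ C ∈ T, (n : ℤ) ∈ C ∨ -(n : ℤ) ∉ C

/-- `T' = U(T)`: the tableau `T` has more than one column, the cocyclage is authorized for it (with
respect to weights with `n` parts), and `T' = P(u x)` where `x` is the rightmost letter of the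
first row of `T` (it is the first letter of the reading) and `x u` is the reading of `T`. -/
def IsCocyclage (X : OType) (n : ℕ) (T T' : Filling) : Prop :=
  IsTableau X T ∧ 1 < T.length ∧ Authorized n T ∧
    ∃ (x : ℤ) (u : List ℤ), reading T = x :: u ∧ IsPSymbol X (u ++ [x]) T'

/-- The cyclage graph on `𝐓[μ]`: there is an arrow `T → T'` if and only if `T' = U(T)`. -/
def cyclageGraph (X : OType) {n : ℕ} (μ : Fin n → ℕ) : Digraph (tableauxOfWeight X μ) where
  Adj T T' := IsCocyclage X n T.1 T'.1

/-- A tableau with exactly one column. -/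
def IsColumn (T : Filling) : Prop := T.length = 1

end OrthogonalTableaux

/-! ### Signature rule, duality and weights of words -/

namespace OrthogonalTableaux

/-! ### Operators of one colour on words -/

/-! Combinatorial core. Let `x` be the first letter of the reading of `T`. Taking `x` out shortens
the last column only, and inserting it back runs through the columns from the left: at a column `D`,
either `D ++ [x]` is again a column and the insertion stops, or `D ++ [x]` is equivalent to `z ::
D'` with `D'` of the same height, and `z` goes on to the next column. Two facts about such a slide
matter: the sum of the letters is conserved, being a linear function of the weight, and `x ≤ z`,
with equality only if `D` contains `x` exactly once more often than `-x` (`Slide.le_and_excess`).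

Finiteness (`exists_column`). If no column were ever reached, the height of the first column would
never decrease, hence would stabilise. From then on `x` slides through the first column, so it is
bounded by its letters, and all letters stay bounded by a constant independent of time
(`Ins.columnBound`). Let `s ≥ 2` be the lower limit of the number of columns and `W` an integer
above all letters. The sum of `W * |C| - ∑ C` over the first `s - 1` columns is nondecreasing and
bounded, hence eventually constant. Constancy forces `x` to cross these columns unchanged, so each
of them has excess one in `x`. At a time with exactly `s` columns, the last column begins with `x`
and has excess at least `0`; the total excess is then positive, which contradicts weight `0`. The
operation being single valued, a repetition before the first column would make the sequence
periodic, and no column would be reached.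

Crystal background. All this requires that a component of the word crystal be determined by its
highest weight: a component has at most one source (`source_unique`), and sources of equal weight
have isomorphic components (`sim_of_sources`). In type `D` this follows from Stembridge's local
relations, checked on words by induction on the first letter. Type `B_m` is folded into `D_{m+1}` by
doubling letters. Isomorphism of components is handled as the bisimilarity `Sim`, which is visibly
compatible with concatenation.

The rank is free: the symbol is unchanged when the rank grows (`IsPSymbol.spec`), and in large rank
every word has a source made of barred letters (`full_of_inAlphabet`), which means that no
contraction occurs. The insertion is then computed on highest weight tableaux, where it is trivial,
and transported by the lowering operators (`Ins.lower`). -/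

theorem letterF_succ (X : OType) (i : ℕ) (x : ℤ) :
    letterF X (i + 1) x =
      if x = -((i : ℤ) + 2) ∨ x = (i : ℤ) + 1 then some (x + 1) else none := by
  cases X <;> rfl

theorem letterF_B_zero (x : ℤ) :
    letterF OType.B 0 x = if x = -1 then some 0 else if x = 0 then some 1 else none := rfl

theorem letterF_D_zero (x : ℤ) :
    letterF OType.D 0 x = if x = -2 then some 1 else if x = -1 then some 2 else none := rfl

theorem letterPhi_succ (X : OType) (i : ℕ) (x : ℤ) :
    letterPhi X (i + 1) x = if x = -((i : ℤ) + 2) ∨ x = (i : ℤ) + 1 then 1 else 0 := by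
  unfold letterPhi
  rw [letterF_succ]
  by_cases h : x = -((i : ℤ) + 2) ∨ x = (i : ℤ) + 1
  · simp only [h, if_true, letterF_succ]
    rw [if_neg]
    simp only [Option.isSome_ite]
    omega
  · rw [if_neg h, if_neg h]

theorem letterPhi_B_zero (x : ℤ) :
    letterPhi OType.B 0 x = if x = -1 then 2 else if x = 0 then 1 else 0 := by
  unfold letterPhi
  rw [letterF_B_zero]
  split_ifs <;> simp [letterF_B_zero]

theorem letterPhi_D_zero (x : ℤ) :
    letterPhi OType.D 0 x = if x = -2 ∨ x = -1 then 1 else 0 := by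
  unfold letterPhi
  rw [letterF_D_zero]
  split_ifs <;> simp_all [letterF_D_zero]

theorem letterEps_succ (X : OType) (i : ℕ) (x : ℤ) :
    letterEps X (i + 1) x = if x = (i : ℤ) + 2 ∨ x = -((i : ℤ) + 1) then 1 else 0 := by
  unfold letterEps
  rw [letterPhi_succ]
  congr 1
  apply propext
  omega

theorem letterEps_B_zero (x : ℤ) :
    letterEps OType.B 0 x = if x = 1 then 2 else if x = 0 then 1 else 0 := by
  unfold letterEps
  rw [letterPhi_B_zero]
  simp only [neg_eq_zero, neg_inj]

theorem letterEps_D_zero (x : ℤ) :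
    letterEps OType.D 0 x = if x = 2 ∨ x = 1 then 1 else 0 := by
  unfold letterEps
  rw [letterPhi_D_zero]
  simp only [neg_inj]

theorem letterF_some (X : OType) {i : ℕ} {x y : ℤ} (h : letterF X i x = some y) :
    letterPhi X i x = letterPhi X i y + 1 ∧ letterEps X i y = letterEps X i x + 1 := by
  rcases i with _ | i
  · cases X
    · rw [letterF_B_zero] at h
      simp only [letterPhi_B_zero, letterEps_B_zero]
      split_ifs at h <;> simp_all <;> subst h <;> norm_num
    · rw [letterF_D_zero] at h
      simp only [letterPhi_D_zero, letterEps_D_zero]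
      split_ifs at h <;> simp_all <;> subst h <;> norm_num
  · rw [letterF_succ] at h
    simp only [letterPhi_succ, letterEps_succ]
    split_ifs at h with hx
    simp only [Option.some.injEq] at h
    subst h
    split_ifs <;> omega

theorem exists_letterF (X : OType) {i : ℕ} {x : ℤ} (h : 0 < letterPhi X i x) :
    ∃ y, letterF X i x = some y := by
  unfold letterPhi at h
  cases h' : letterF X i x with
  | none => simp [h'] at h
  | some y => exact ⟨y, rfl⟩

theorem letterF_neg (X : OType) {i : ℕ} {x y : ℤ} (h : letterF X i x = some y) :
    letterF X i (-y) = some (-x) := by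
  rcases i with _ | i
  · cases X
    · rw [letterF_B_zero] at h ⊢
      split_ifs at h <;> simp_all <;> subst h <;> norm_num
    · rw [letterF_D_zero] at h ⊢
      split_ifs at h <;> simp_all <;> subst h <;> norm_num
  · rw [letterF_succ] at h ⊢
    split_ifs at h with hx
    simp only [Option.some.injEq] at h
    subst h
    rw [if_pos (by omega)]
    congr 1; ring

theorem exists_letterF_eq (X : OType) {i : ℕ} {y : ℤ} (h : 0 < letterEps X i y) :
    ∃ x, letterF X i x = some y := by
  obtain ⟨z, hz⟩ := exists_letterF X (x := -y) h
  exact ⟨-z, by simpa using letterF_neg X hz⟩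

/-- `ε_i` of a word. -/
def eps (X : OType) (i : ℕ) (w : List ℤ) : ℕ := (epsPhi X i w).1

/-- `φ_i` of a word. -/
def phi (X : OType) (i : ℕ) (w : List ℤ) : ℕ := (epsPhi X i w).2

variable {X : OType} {i : ℕ}

@[simp] theorem eps_nil : eps X i [] = 0 := rfl
@[simp] theorem phi_nil : phi X i [] = 0 := rfl

theorem eps_cons (x : ℤ) (w : List ℤ) :
    eps X i (x :: w) = letterEps X i x + (eps X i w - letterPhi X i x) := rfl

theorem phi_cons (x : ℤ) (w : List ℤ) :
    phi X i (x :: w) = phi X i w + (letterPhi X i x - eps X i w) := rfl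

@[simp] theorem eps_singleton (x : ℤ) : eps X i [x] = letterEps X i x := by simp [eps_cons]
@[simp] theorem phi_singleton (x : ℤ) : phi X i [x] = letterPhi X i x := by simp [phi_cons]

theorem wordF_cons (x : ℤ) (w : List ℤ) :
    wordF X i (x :: w) =
      if eps X i w < letterPhi X i x then (letterF X i x).map (fun y => y :: w)
      else (wordF X i w).map (fun v => x :: v) := rfl

theorem wordF_cons_some {x : ℤ} {w v : List ℤ} :
    wordF X i (x :: w) = some v ↔
      (eps X i w < letterPhi X i x ∧ ∃ y, letterF X i x = some y ∧ v = y :: w) ∨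
      (letterPhi X i x ≤ eps X i w ∧ ∃ u, wordF X i w = some u ∧ v = x :: u) := by
  rw [wordF_cons]
  split_ifs with h
  · simp only [Option.map_eq_some_iff, h, true_and, not_le.mpr h, false_and, or_false]
    constructor <;> rintro ⟨y, h1, h2⟩ <;> exact ⟨y, h1, h2.symm⟩
  · simp only [Option.map_eq_some_iff, h, not_lt.mp h, true_and, false_and, false_or]
    constructor <;> rintro ⟨y, h1, h2⟩ <;> exact ⟨y, h1, h2.symm⟩

theorem wordF_spec {w v : List ℤ} (h : wordF X i w = some v) :
    phi X i w = phi X i v + 1 ∧ eps X i v = eps X i w + 1 := by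
  induction w generalizing v with
  | nil => simp [wordF] at h
  | cons x w ih =>
    rcases wordF_cons_some.mp h with ⟨h1, y, hy, rfl⟩ | ⟨h1, u, hu, rfl⟩
    · have := letterF_some X hy
      simp only [phi_cons, eps_cons]
      omega
    · have := ih hu
      simp only [phi_cons, eps_cons]
      omega

theorem exists_wordF {w : List ℤ} (h : 0 < phi X i w) : ∃ v, wordF X i w = some v := by
  induction w with
  | nil => simp at h
  | cons x w ih =>
    rw [phi_cons] at h
    by_cases h1 : eps X i w < letterPhi X i x
    · obtain ⟨y, hy⟩ := exists_letterF X (show 0 < letterPhi X i x by omega)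
      exact ⟨y :: w, wordF_cons_some.mpr (Or.inl ⟨h1, y, hy, rfl⟩)⟩
    · obtain ⟨v, hv⟩ := ih (by omega)
      exact ⟨x :: v, wordF_cons_some.mpr (Or.inr ⟨by omega, v, hv, rfl⟩)⟩

theorem phi_pos_of_wordF {w v : List ℤ} (h : wordF X i w = some v) : 0 < phi X i w := by
  have := wordF_spec h; omega

theorem eps_append (u v : List ℤ) :
    eps X i (u ++ v) = eps X i u + (eps X i v - phi X i u) := by
  induction u with
  | nil => simp
  | cons x u ih =>
    simp only [List.cons_append, eps_cons, phi_cons, ih]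
    omega

theorem phi_append (u v : List ℤ) :
    phi X i (u ++ v) = phi X i v + (phi X i u - eps X i v) := by
  induction u with
  | nil => simp
  | cons x u ih =>
    simp only [List.cons_append, eps_append, phi_cons, ih]
    omega

theorem wordF_append (u v w : List ℤ) :
    wordF X i (u ++ v) = some w ↔
      (eps X i v < phi X i u ∧ ∃ u', wordF X i u = some u' ∧ w = u' ++ v) ∨
      (phi X i u ≤ eps X i v ∧ ∃ v', wordF X i v = some v' ∧ w = u ++ v') := by
  induction u generalizing w with
  | nil => simp [wordF]
  | cons x u ih =>
    simp only [List.cons_append, wordF_cons_some, phi_cons, eps_append]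
    constructor
    · rintro (⟨h1, y, hy, rfl⟩ | ⟨h1, t, ht, rfl⟩)
      · exact Or.inl ⟨by omega, y :: u, Or.inl ⟨by omega, y, hy, rfl⟩, rfl⟩
      · rcases (ih t).mp ht with ⟨h2, u', hu', rfl⟩ | ⟨h2, v', hv', rfl⟩
        · exact Or.inl ⟨by omega, x :: u', Or.inr ⟨by omega, u', hu', rfl⟩, rfl⟩
        · exact Or.inr ⟨by omega, v', hv', rfl⟩
    · rintro (⟨h1, t, ⟨h2, y, hy, rfl⟩ | ⟨h2, u', hu', rfl⟩, rfl⟩ | ⟨h1, v', hv', rfl⟩)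
      · exact Or.inl ⟨by omega, y, hy, rfl⟩
      · exact Or.inr ⟨by omega, u' ++ v, (ih _).mpr (Or.inl ⟨by omega, u', hu', rfl⟩), rfl⟩
      · exact Or.inr ⟨by omega, u ++ v', (ih _).mpr (Or.inr ⟨by omega, v', hv', rfl⟩), rfl⟩

/-- The dual word, for which the arrows are reversed. -/
def dual (w : List ℤ) : List ℤ := (w.map (fun x => -x)).reverse

@[simp] theorem dual_dual (w : List ℤ) : dual (dual w) = w := by
  simp [dual, List.map_reverse, Function.comp_def]

theorem dual_cons (x : ℤ) (w : List ℤ) : dual (x :: w) = dual w ++ [-x] := by simp [dual]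

theorem letterEps_neg (x : ℤ) : letterEps X i (-x) = letterPhi X i x := by simp [letterEps]
theorem letterPhi_neg (x : ℤ) : letterPhi X i (-x) = letterEps X i x := rfl

theorem eps_phi_dual (w : List ℤ) :
    eps X i (dual w) = phi X i w ∧ phi X i (dual w) = eps X i w := by
  induction w with
  | nil => simp [dual]
  | cons x w ih =>
    rw [dual_cons, eps_append, phi_append, ih.1, ih.2]
    simp [letterEps_neg, letterPhi_neg, eps_cons, phi_cons]

theorem phi_dual (w : List ℤ) : phi X i (dual w) = eps X i w := (eps_phi_dual w).2

/-- Negating the letters and reversing the word exchanges `ε` with `φ` and reverses the arrows,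
because the tensor product rule is symmetric under this operation. Injectivity of `f_i`, the
existence of raising operators and the relations above a word are all deduced from this duality. -/
theorem wordF_dual {w v : List ℤ} (h : wordF X i w = some v) :
    wordF X i (dual v) = some (dual w) := by
  induction w generalizing v with
  | nil => simp [wordF] at h
  | cons x w ih =>
    rcases wordF_cons_some.mp h with ⟨h1, y, hy, rfl⟩ | ⟨h1, u, hu, rfl⟩
    · rw [dual_cons, dual_cons, wordF_append]
      have := letterF_some X hy
      refine Or.inr ⟨?_, [-x], ?_, rfl⟩
      · simp only [phi_dual, eps_singleton, letterEps_neg]; omega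
      · rw [wordF_cons_some]
        refine Or.inl ⟨?_, -x, letterF_neg X hy, rfl⟩
        simp only [eps_nil, letterPhi_neg]; omega
    · rw [dual_cons, dual_cons, wordF_append]
      refine Or.inl ⟨?_, dual w, ih hu, rfl⟩
      have := wordF_spec hu
      simp only [phi_dual, eps_singleton, letterEps_neg]; omega

theorem wordF_inj {w w' v : List ℤ} (h : wordF X i w = some v) (h' : wordF X i w' = some v) :
    w = w' := by
  have := (wordF_dual h).symm.trans (wordF_dual h')
  rw [← dual_dual w, ← dual_dual w', Option.some.inj this]

theorem exists_wordF_eq {v : List ℤ} (h : 0 < eps X i v) : ∃ w, wordF X i w = some v := by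
  obtain ⟨u, hu⟩ := exists_wordF (X := X) (i := i) (w := dual v) (by rwa [phi_dual])
  exact ⟨dual u, by simpa using wordF_dual hu⟩

theorem eps_pos_of_wordF {w v : List ℤ} (h : wordF X i w = some v) : 0 < eps X i v := by
  have := wordF_spec h; omega

theorem wordF_length {w v : List ℤ} (h : wordF X i w = some v) : v.length = w.length := by
  induction w generalizing v with
  | nil => simp [wordF] at h
  | cons x w ih =>
    rcases wordF_cons_some.mp h with ⟨h1, y, hy, rfl⟩ | ⟨h1, u, hu, rfl⟩
    · simp
    · simp [ih hu]

/-- The rule of the tensor product for the raising operators. -/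
theorem wordF_eq_append {u v w : List ℤ} :
    wordF X i w = some (u ++ v) ↔
      (eps X i v ≤ phi X i u ∧ ∃ u', wordF X i u' = some u ∧ w = u' ++ v) ∨
      (phi X i u < eps X i v ∧ ∃ v', wordF X i v' = some v ∧ w = u ++ v') := by
  constructor
  · intro h
    have hp := eps_pos_of_wordF h
    rw [eps_append] at hp
    by_cases hc : eps X i v ≤ phi X i u
    · obtain ⟨u', hu'⟩ := exists_wordF_eq (X := X) (i := i) (v := u) (by omega)
      refine Or.inl ⟨hc, u', hu', wordF_inj h ((wordF_append _ _ _).mpr (Or.inl ⟨?_, u, hu', rfl⟩))⟩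
      have := wordF_spec hu'; omega
    · obtain ⟨v', hv'⟩ := exists_wordF_eq (X := X) (i := i) (v := v) (by omega)
      refine Or.inr ⟨by omega, v', hv',
        wordF_inj h ((wordF_append _ _ _).mpr (Or.inr ⟨?_, v, hv', rfl⟩))⟩
      have := wordF_spec hv'; omega
  · rintro (⟨hc, u', hu', rfl⟩ | ⟨hc, v', hv', rfl⟩)
    · have := wordF_spec hu'
      exact (wordF_append _ _ _).mpr (Or.inl ⟨by omega, u, hu', rfl⟩)
    · have := wordF_spec hv'
      exact (wordF_append _ _ _).mpr (Or.inr ⟨by omega, v, hv', rfl⟩)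

/-! ### Weights -/

theorem weightCoord_cons (x : ℤ) (w : List ℤ) (k : ℕ) :
    weightCoord (x :: w) k = weightCoord w k + weightCoord [x] k := by
  simp only [weightCoord, List.count_cons, List.count_nil]
  push_cast
  ring

theorem weightCoord_append (u v : List ℤ) (k : ℕ) :
    weightCoord (u ++ v) k = weightCoord u k + weightCoord v k := by
  simp only [weightCoord, List.count_append]
  push_cast
  ring

theorem weightCoord_singleton (x : ℤ) (k : ℕ) :
    weightCoord [x] k = (if x = -(k : ℤ) then 1 else 0) - (if x = (k : ℤ) then 1 else 0) := by
  simp [weightCoord, List.count_singleton]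

theorem phi_sub_eps_cons (x : ℤ) (w : List ℤ) :
    (phi X i (x :: w) : ℤ) - eps X i (x :: w) =
      ((letterPhi X i x : ℤ) - letterEps X i x) + ((phi X i w : ℤ) - eps X i w) := by
  simp only [phi_cons, eps_cons]
  omega

theorem phi_sub_eps_succ (X : OType) (i : ℕ) (w : List ℤ) :
    (phi X (i + 1) w : ℤ) - eps X (i + 1) w = weightCoord w (i + 2) - weightCoord w (i + 1) := by
  induction w with
  | nil => simp [weightCoord]
  | cons x w ih =>
    rw [phi_sub_eps_cons, ih, weightCoord_cons x w, weightCoord_cons x w (i + 1),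
      weightCoord_singleton, weightCoord_singleton, letterPhi_succ, letterEps_succ]
    push_cast
    split_ifs <;> omega

theorem phi_sub_eps_B_zero (w : List ℤ) :
    (phi OType.B 0 w : ℤ) - eps OType.B 0 w = 2 * weightCoord w 1 := by
  induction w with
  | nil => simp [weightCoord]
  | cons x w ih =>
    rw [phi_sub_eps_cons, ih, weightCoord_cons x w,
      weightCoord_singleton, letterPhi_B_zero, letterEps_B_zero]
    push_cast
    split_ifs <;> omega

theorem phi_sub_eps_D_zero (w : List ℤ) :
    (phi OType.D 0 w : ℤ) - eps OType.D 0 w = weightCoord w 2 + weightCoord w 1 := by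
  induction w with
  | nil => simp [weightCoord]
  | cons x w ih =>
    rw [phi_sub_eps_cons, ih, weightCoord_cons x w, weightCoord_cons x w 1,
      weightCoord_singleton, weightCoord_singleton, letterPhi_D_zero, letterEps_D_zero]
    push_cast
    split_ifs <;> omega

/-- Lowering a word by `f_i` changes one letter. -/
theorem wordF_change {w v : List ℤ} (h : wordF X i w = some v) :
    ∃ a b x y, w = a ++ x :: b ∧ v = a ++ y :: b ∧ letterF X i x = some y := by
  induction w generalizing v with
  | nil => simp [wordF] at h
  | cons x w ih =>
    rcases wordF_cons_some.mp h with ⟨h1, y, hy, rfl⟩ | ⟨h1, u, hu, rfl⟩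
    · exact ⟨[], w, x, y, rfl, rfl, hy⟩
    · obtain ⟨a, b, x', y, rfl, rfl, hl⟩ := ih hu
      exact ⟨x :: a, b, x', y, rfl, rfl, hl⟩

/-- The coordinates of the simple roots. -/
def rootCoord : OType → ℕ → ℕ → ℤ
  | OType.B, 0, k => if k = 1 then 1 else 0
  | OType.D, 0, k => if k = 1 ∨ k = 2 then 1 else 0
  | _, (i + 1), k => (if k = i + 2 then 1 else 0) - (if k = i + 1 then 1 else 0)

theorem rootCoord_succ (X : OType) (i k : ℕ) :
    rootCoord X (i + 1) k = (if k = i + 2 then 1 else 0) - (if k = i + 1 then 1 else 0) := by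
  cases X <;> rfl

theorem letterF_weight {x y : ℤ} (h : letterF X i x = some y) {k : ℕ} (hk : 0 < k) :
    weightCoord [y] k = weightCoord [x] k - rootCoord X i k := by
  simp only [weightCoord_singleton]
  rcases i with _ | i
  · cases X
    · rw [letterF_B_zero] at h
      simp only [rootCoord]
      split_ifs at h <;> simp only [Option.some.injEq, reduceCtorEq] at h <;> subst h <;>
        split_ifs <;> omega
    · rw [letterF_D_zero] at h
      simp only [rootCoord]
      split_ifs at h <;> simp only [Option.some.injEq, reduceCtorEq] at h <;> subst h <;>
        split_ifs <;> omega
  · rw [letterF_succ] at h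
    rw [rootCoord_succ]
    split_ifs at h with hx
    simp only [Option.some.injEq] at h
    subst h
    split_ifs <;> omega

theorem wordF_weight {w v : List ℤ} (h : wordF X i w = some v) {k : ℕ} (hk : 0 < k) :
    weightCoord v k = weightCoord w k - rootCoord X i k := by
  obtain ⟨a, b, x, y, rfl, rfl, hl⟩ := wordF_change h
  rw [weightCoord_append, weightCoord_append, weightCoord_cons y, weightCoord_cons x,
    letterF_weight hl hk]
  ring

end OrthogonalTableaux

/-! ### Rank two: local relations between two colours on words -/

namespace OrthogonalTableaux

/-! ### Two commuting colours -/

section Commuting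

variable {X : OType} {i j : ℕ}

/-- The operators of colours `i` and `j` on letters do not interact. -/
def CommutingColours (X : OType) (i j : ℕ) : Prop :=
  ∀ x y, letterF X i x = some y → letterPhi X j y = letterPhi X j x ∧
    letterEps X j y = letterEps X j x ∧
    ∀ z, letterF X j x = some z → ∃ t, letterF X j y = some t ∧ letterF X i z = some t

theorem CommutingColours.eps_eq (h : CommutingColours X i j) {w b : List ℤ}
    (hb : wordF X i w = some b) : eps X j b = eps X j w ∧ phi X j b = phi X j w := by
  induction w generalizing b with
  | nil => simp [wordF] at hb
  | cons x w ih =>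
    rcases wordF_cons_some.mp hb with ⟨h1, y, hy, rfl⟩ | ⟨h1, u, hu, rfl⟩
    · obtain ⟨h2, h3, -⟩ := h x y hy
      simp only [eps_cons, phi_cons, h2, h3, and_self]
    · obtain ⟨h2, h3⟩ := ih hu
      simp only [eps_cons, phi_cons, h2, h3, and_self]

theorem CommutingColours.square (h : CommutingColours X i j) (h' : CommutingColours X j i)
    {w a b : List ℤ} (hb : wordF X i w = some b) (ha : wordF X j w = some a) :
    ∃ s, wordF X j b = some s ∧ wordF X i a = some s := by
  induction w generalizing a b with
  | nil => simp [wordF] at hb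
  | cons x w ih =>
    rcases wordF_cons_some.mp hb with ⟨h1, y, hy, rfl⟩ | ⟨h1, u, hu, rfl⟩ <;>
    rcases wordF_cons_some.mp ha with ⟨k1, z, hz, rfl⟩ | ⟨k1, v, hv, rfl⟩
    · obtain ⟨h2, h3, h4⟩ := h x y hy
      obtain ⟨k2, k3, -⟩ := h' x z hz
      obtain ⟨t, ht, ht'⟩ := h4 z hz
      exact ⟨t :: w, wordF_cons_some.mpr (Or.inl ⟨by omega, t, ht, rfl⟩),
        wordF_cons_some.mpr (Or.inl ⟨by omega, t, ht', rfl⟩)⟩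
    · obtain ⟨h2, h3, h4⟩ := h x y hy
      have := h'.eps_eq hv
      exact ⟨y :: v, wordF_cons_some.mpr (Or.inr ⟨by omega, v, hv, rfl⟩),
        wordF_cons_some.mpr (Or.inl ⟨by omega, y, hy, rfl⟩)⟩
    · obtain ⟨h2, h3, h4⟩ := h' x z hz
      have := h.eps_eq hu
      exact ⟨z :: u, wordF_cons_some.mpr (Or.inl ⟨by omega, z, hz, rfl⟩),
        wordF_cons_some.mpr (Or.inr ⟨by omega, u, hu, rfl⟩)⟩
    · have := h.eps_eq hu
      have := h'.eps_eq hv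
      obtain ⟨s, hs, hs'⟩ := ih hu hv
      exact ⟨x :: s, wordF_cons_some.mpr (Or.inr ⟨by omega, s, hs, rfl⟩),
        wordF_cons_some.mpr (Or.inr ⟨by omega, s, hs', rfl⟩)⟩

end Commuting

/-! ### Two colours generating a root system of type `A₂` -/

section AdjacentColours

/-- The values of `ε_i`, `φ_i`, `ε_j`, `φ_j` on a letter. -/
def LetterState (X : OType) (i j : ℕ) (x : ℤ) (a b c d : ℕ) : Prop :=
  letterEps X i x = a ∧ letterPhi X i x = b ∧ letterEps X j x = c ∧ letterPhi X j x = d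

/-- For the colours `i` and `j`, every letter belongs to the trivial crystal, to the vector
representation of type `A₂` or to its dual. -/
def AdjacentColours (X : OType) (i j : ℕ) : Prop :=
  ∀ x, LetterState X i j x 0 0 0 0 ∨
    (LetterState X i j x 0 1 0 0 ∧ ∃ y, letterF X i x = some y ∧ LetterState X i j y 1 0 0 1) ∨
    (LetterState X i j x 1 0 0 1 ∧ ∃ y, letterF X j x = some y ∧ LetterState X i j y 0 0 1 0) ∨
    LetterState X i j x 0 0 1 0 ∨
    (LetterState X i j x 0 0 0 1 ∧ ∃ y, letterF X j x = some y ∧ LetterState X i j y 0 1 1 0) ∨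
    (LetterState X i j x 0 1 1 0 ∧ ∃ y, letterF X i x = some y ∧ LetterState X i j y 1 0 0 0) ∨
    LetterState X i j x 1 0 0 0

variable {X : OType} {i j : ℕ}

theorem LetterState.swap {x : ℤ} {a b c d : ℕ} (h : LetterState X i j x a b c d) :
    LetterState X j i x c d a b := ⟨h.2.2.1, h.2.2.2, h.1, h.2.1⟩

theorem AdjacentColours.symm (h : AdjacentColours X i j) : AdjacentColours X j i := by
  intro x
  rcases h x with h | ⟨h, y, hy, h'⟩ | ⟨h, y, hy, h'⟩ | h | ⟨h, y, hy, h'⟩ | ⟨h, y, hy, h'⟩ | h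
  · exact Or.inl h.swap
  · exact Or.inr (Or.inr (Or.inr (Or.inr (Or.inl ⟨h.swap, y, hy, h'.swap⟩))))
  · exact Or.inr (Or.inr (Or.inr (Or.inr (Or.inr (Or.inl ⟨h.swap, y, hy, h'.swap⟩)))))
  · exact Or.inr (Or.inr (Or.inr (Or.inr (Or.inr (Or.inr h.swap)))))
  · exact Or.inr (Or.inl ⟨h.swap, y, hy, h'.swap⟩)
  · exact Or.inr (Or.inr (Or.inl ⟨h.swap, y, hy, h'.swap⟩))
  · exact Or.inr (Or.inr (Or.inr (Or.inl h.swap)))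

/-- The value of `ε_j` after `f_i` has been applied as often as possible. -/
def residue (X : OType) (i j : ℕ) : List ℤ → ℕ
  | [] => 0
  | x :: w =>
      if eps X i w < letterPhi X i x then
        letterEps X j ((letterF X i x).getD 0) +
          (residue X i j w - letterPhi X j ((letterF X i x).getD 0))
      else letterEps X j x + (residue X i j w - letterPhi X j x)

theorem residue_cons_lt {x y : ℤ} {w : List ℤ} (h : eps X i w < letterPhi X i x)
    (hy : letterF X i x = some y) :
    residue X i j (x :: w) = letterEps X j y + (residue X i j w - letterPhi X j y) := by
  simp [residue, h, hy]

theorem residue_cons_le {x : ℤ} {w : List ℤ} (h : letterPhi X i x ≤ eps X i w) :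
    residue X i j (x :: w) = letterEps X j x + (residue X i j w - letterPhi X j x) := by
  simp [residue, not_lt.mpr h]

theorem AdjacentColours.letterF_some (hA : AdjacentColours X i j) {x y : ℤ}
    (hy : letterF X i x = some y) :
    (LetterState X i j x 0 1 0 0 ∧ LetterState X i j y 1 0 0 1) ∨
      (LetterState X i j x 0 1 1 0 ∧ LetterState X i j y 1 0 0 0) := by
  have hp := OrthogonalTableaux.letterF_some X hy
  rcases hA x with h | ⟨h, z, hz, h'⟩ | ⟨h, z, hz, h'⟩ | h | ⟨h, z, hz, h'⟩ | ⟨h, z, hz, h'⟩ | h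
  · have := h.2.1; omega
  · obtain rfl := Option.some.inj (hz.symm.trans hy)
    exact Or.inl ⟨h, h'⟩
  · have := h.2.1; omega
  · have := h.2.1; omega
  · have := h.2.1; omega
  · obtain rfl := Option.some.inj (hz.symm.trans hy)
    exact Or.inr ⟨h, h'⟩
  · have := h.2.1; omega

/-- The value of `residue` on a word with a first letter, by cases. -/
theorem AdjacentColours.residue_cons (hA : AdjacentColours X i j) (x : ℤ) (w : List ℤ) :
    (letterPhi X i x ≤ eps X i w ∧
      residue X i j (x :: w) = letterEps X j x + (residue X i j w - letterPhi X j x)) ∨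
    (eps X i w = 0 ∧ LetterState X i j x 0 1 0 0 ∧
      residue X i j (x :: w) = residue X i j w - 1) ∨
    (eps X i w = 0 ∧ LetterState X i j x 0 1 1 0 ∧
      residue X i j (x :: w) = residue X i j w) := by
  by_cases h : eps X i w < letterPhi X i x
  · obtain ⟨y, hy⟩ := exists_letterF X (show 0 < letterPhi X i x by omega)
    rw [residue_cons_lt h hy]
    rcases hA.letterF_some hy with ⟨h1, h2⟩ | ⟨h1, h2⟩
    · refine Or.inr (Or.inl ⟨?_, h1, ?_⟩)
      · have := h1.2.1; omega
      · rw [h2.2.2.1, h2.2.2.2]; omega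
    · refine Or.inr (Or.inr ⟨?_, h1, ?_⟩)
      · have := h1.2.1; omega
      · rw [h2.2.2.1, h2.2.2.2]; omega
  · exact Or.inl ⟨by omega, residue_cons_le (by omega)⟩

/-- The possible values of the statistics on a letter. -/
theorem AdjacentColours.state (hA : AdjacentColours X i j) (x : ℤ) :
    LetterState X i j x 0 0 0 0 ∨ LetterState X i j x 0 1 0 0 ∨ LetterState X i j x 1 0 0 1 ∨
    LetterState X i j x 0 0 1 0 ∨ LetterState X i j x 0 0 0 1 ∨ LetterState X i j x 0 1 1 0 ∨
    LetterState X i j x 1 0 0 0 := by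
  have := hA x
  tauto

theorem AdjacentColours.residue_le (hA : AdjacentColours X i j) (w : List ℤ) :
    residue X i j w ≤ eps X j w := by
  induction w with
  | nil => simp [residue]
  | cons x w ih =>
    rw [eps_cons]
    rcases hA.residue_cons x w with ⟨-, h⟩ | ⟨-, h', h⟩ | ⟨-, h', h⟩ <;> rw [h]
    · omega
    · have := h'.2.2; omega
    · have := h'.2.2; omega

/-- Going down an `i`-string, `ε_j` drops by one at each step until it reaches its final value
`residue`, and is constant afterwards. Comparing `ε_j` with `residue` therefore tells whether the
next `f_i` lowers `ε_j`, which is the alternative in Stembridge's axioms. -/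
theorem AdjacentColours.eps_wordF (hA : AdjacentColours X i j) {w b : List ℤ}
    (hb : wordF X i w = some b) :
    eps X j b = max (eps X j w - 1) (residue X i j w) ∧ residue X i j b = residue X i j w := by
  induction w generalizing b with
  | nil => simp [wordF] at hb
  | cons x w ih =>
    have hr := hA.residue_le w
    rcases wordF_cons_some.mp hb with ⟨h1, y, hy, rfl⟩ | ⟨h1, u, hu, rfl⟩
    · rw [residue_cons_lt h1 hy, eps_cons, eps_cons]
      rcases hA.letterF_some hy with ⟨⟨a1, a2, a3, a4⟩, ⟨b1, b2, b3, b4⟩⟩ |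
        ⟨⟨a1, a2, a3, a4⟩, ⟨b1, b2, b3, b4⟩⟩ <;>
        rw [residue_cons_le (by omega)] <;> omega
    · obtain ⟨e1, e2⟩ := ih hu
      have e3 := wordF_spec hu
      rw [residue_cons_le h1, residue_cons_le (by omega), eps_cons, eps_cons]
      rcases hA.state x with h | h | h | h | h | h | h <;> obtain ⟨a1, a2, a3, a4⟩ := h <;> omega

/-- Excludes the configuration in which `f_i` would lower `ε_j` while `f_j` lowers `ε_i`. -/
theorem AdjacentColours.eps_eq_residue (hA : AdjacentColours X i j) (w : List ℤ) :
    eps X j w = residue X i j w ∨ eps X i w = residue X j i w := by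
  induction w with
  | nil => simp [residue]
  | cons x w ih =>
    have hr := hA.residue_le w
    have hr' := hA.symm.residue_le w
    rw [eps_cons, eps_cons]
    rcases hA.residue_cons x w with ⟨c1, c2⟩ | ⟨c1, ⟨d1, d2, d3, d4⟩, c2⟩ |
      ⟨c1, ⟨d1, d2, d3, d4⟩, c2⟩ <;>
    rcases hA.symm.residue_cons x w with ⟨c3, c4⟩ | ⟨c3, ⟨d1', d2', d3', d4'⟩, c4⟩ |
      ⟨c3, ⟨d1', d2', d3', d4'⟩, c4⟩ <;> rw [c2, c4] <;>
    rcases hA.state x with h | h | h | h | h | h | h <;> obtain ⟨a1, a2, a3, a4⟩ := h <;> omega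

/-- The condition in the correction term says that `f_j` lowers `ε_i`; only then does the increase
of `ε_j` survive to the end of the `i`-string. -/
theorem AdjacentColours.residue_wordF (hA : AdjacentColours X i j) {w a : List ℤ}
    (ha : wordF X j w = some a) :
    residue X i j a = residue X i j w + if residue X j i w < eps X i w then 1 else 0 := by
  induction w generalizing a with
  | nil => simp [wordF] at ha
  | cons x w ih =>
    have hr := hA.residue_le w
    have hr' := hA.symm.residue_le w
    rcases wordF_cons_some.mp ha with ⟨h1, y, hy, rfl⟩ | ⟨h1, u, hu, rfl⟩
    · rw [residue_cons_lt h1 hy, eps_cons]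
      rcases hA.symm.letterF_some hy with ⟨h2, h3⟩ | ⟨h2, h3⟩
      · obtain ⟨a1, a2, a3, a4⟩ := h2
        have h3' := h3
        obtain ⟨b1, b2, b3, b4⟩ := h3'
        rw [residue_cons_le (x := x) (by omega)]
        rcases hA.residue_cons y w with ⟨c1, c2⟩ | ⟨c1, ⟨d1, d2, d3, d4⟩, c2⟩ | ⟨c1, -, c2⟩ <;>
          rw [c2] <;> split_ifs <;> omega
      · obtain ⟨a1, a2, a3, a4⟩ := h2
        obtain ⟨b1, b2, b3, b4⟩ := h3
        rw [residue_cons_le (x := x) (by omega), residue_cons_le (x := y) (by omega)]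
        split_ifs <;> omega
    · have e1 := ih hu
      have e2 := hA.symm.eps_wordF hu
      have e3 := wordF_spec hu
      have e4 := hA.eps_eq_residue w
      rw [residue_cons_le (j := i) h1, eps_cons]
      rcases hA.residue_cons x w with ⟨c1, c2⟩ | ⟨c1, ⟨d1, d2, d3, d4⟩, c2⟩ |
        ⟨c1, ⟨d1, d2, d3, d4⟩, c2⟩ <;>
      rcases hA.residue_cons x u with ⟨c3, c4⟩ | ⟨c3, ⟨d1', d2', d3', d4'⟩, c4⟩ |
        ⟨c3, ⟨d1', d2', d3', d4'⟩, c4⟩ <;> rw [c2, c4] <;>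
      rcases hA.state x with h | h | h | h | h | h | h <;> obtain ⟨a1, a2, a3, a4⟩ := h <;>
        split_ifs at e1 ⊢ <;> omega

theorem AdjacentColours.phi_wordF (hA : AdjacentColours X i j) {w b : List ℤ}
    (hb : wordF X i w = some b) :
    (phi X j b : ℤ) - eps X j b = phi X j w - eps X j w + 1 := by
  induction w generalizing b with
  | nil => simp [wordF] at hb
  | cons x w ih =>
    rcases wordF_cons_some.mp hb with ⟨h1, y, hy, rfl⟩ | ⟨h1, u, hu, rfl⟩
    · rw [phi_sub_eps_cons, phi_sub_eps_cons]
      rcases hA.letterF_some hy with ⟨⟨a1, a2, a3, a4⟩, ⟨b1, b2, b3, b4⟩⟩ |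
        ⟨⟨a1, a2, a3, a4⟩, ⟨b1, b2, b3, b4⟩⟩ <;> omega
    · rw [phi_sub_eps_cons, phi_sub_eps_cons, ih hu]
      ring

/-- The relations between the operators of two adjacent colours, below a word on which both of them
are defined. -/
def LocalRelations (X : OType) (i j : ℕ) (w a b : List ℤ) : Prop :=
  (residue X i j w < eps X j w ∨ residue X j i w < eps X i w →
    ∃ s, wordF X j b = some s ∧ wordF X i a = some s) ∧
  (residue X i j w = eps X j w → residue X j i w = eps X i w →
    ∃ b₁ b₂ a₁ a₂ s, wordF X j b = some b₁ ∧ wordF X j b₁ = some b₂ ∧ wordF X i b₂ = some s ∧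
      wordF X i a = some a₁ ∧ wordF X i a₁ = some a₂ ∧ wordF X j a₂ = some s)

theorem LocalRelations.symm {w a b : List ℤ} (h : LocalRelations X i j w a b) :
    LocalRelations X j i w b a := by
  refine ⟨fun h' => ?_, fun h1 h2 => ?_⟩
  · obtain ⟨s, h1, h2⟩ := h.1 h'.symm
    exact ⟨s, h2, h1⟩
  · obtain ⟨b₁, b₂, a₁, a₂, s, k⟩ := h.2 h2 h1
    exact ⟨a₁, a₂, b₁, b₂, s, k.2.2.2.1, k.2.2.2.2.1, k.2.2.2.2.2, k.1, k.2.1, k.2.2.1⟩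

theorem wordF_letter {x y : ℤ} {w : List ℤ} (h : eps X i w < letterPhi X i x)
    (hy : letterF X i x = some y) : wordF X i (x :: w) = some (y :: w) :=
  wordF_cons_some.mpr (Or.inl ⟨h, y, hy, rfl⟩)

theorem wordF_tail {x : ℤ} {w v : List ℤ} (h : letterPhi X i x ≤ eps X i w)
    (hv : wordF X i w = some v) : wordF X i (x :: w) = some (x :: v) :=
  wordF_cons_some.mpr (Or.inr ⟨h, v, hv, rfl⟩)

/-- The local relations when `f_i` acts on the first letter and `f_j` on the remaining ones. -/
theorem AdjacentColours.localRelations_letter_tail (hA : AdjacentColours X i j) {x y : ℤ}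
    {w v : List ℤ} (h : eps X i w < letterPhi X i x) (hy : letterF X i x = some y)
    (hv : wordF X j w = some v) : LocalRelations X i j (x :: w) (x :: v) (y :: w) := by
  have hr := hA.residue_le w
  have hr' := hA.symm.residue_le w
  obtain ⟨e1, e1'⟩ := hA.symm.eps_wordF hv
  have e2 := hA.residue_wordF hv
  have e3 := hA.symm.phi_wordF hv
  have e4 := wordF_spec hv
  rcases hA.letterF_some hy with ⟨⟨a1, a2, a3, a4⟩, ⟨b1, b2, b3, b4⟩⟩ |
        ⟨⟨a1, a2, a3, a4⟩, ⟨b1, b2, b3, b4⟩⟩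
  -- Here `y = f_i x` has `φ_j = 1`. After `f_i`, the operator `f_j` still acts on the tail if `1 ≤
  -- ε_j w`, and the square closes; otherwise it acts on `y`, and the degree-four relation appears.
  · by_cases hw : 1 ≤ eps X j w
    · refine ⟨fun _ => ⟨y :: v, wordF_tail (by omega) hv, wordF_letter (by omega) hy⟩, ?_⟩
      intro h1 _
      rw [residue_cons_lt h hy, eps_cons] at h1
      omega
    · refine ⟨fun h1 => ?_, fun _ _ => ?_⟩
      · rw [residue_cons_lt h hy, residue_cons_le (by omega), eps_cons, eps_cons] at h1
        omega
      · obtain ⟨z, hz⟩ := exists_letterF X (show 0 < letterPhi X j y by omega)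
        obtain ⟨c, hc⟩ := exists_wordF (X := X) (i := i) (w := v) (by omega)
        have hc1 := (hA.eps_wordF hc).1
        have hc2 : eps X j c = 0 := by
          rw [hc1, e2, if_neg (by omega)]
          omega
        rcases hA.symm.letterF_some hz with ⟨⟨c1, c2, c3, c4⟩, ⟨d1, d2, d3, d4⟩⟩ |
          ⟨⟨c1, c2, c3, c4⟩, ⟨d1, d2, d3, d4⟩⟩
        · omega
        · exact ⟨z :: w, z :: v, y :: v, y :: c, z :: c, wordF_letter (by omega) hz,
            wordF_tail (by omega) hv, wordF_tail (by omega) hc, wordF_letter (by omega) hy,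
            wordF_tail (by omega) hc, wordF_letter (by omega) hz⟩
  · refine ⟨fun _ => ⟨y :: v, wordF_tail (by omega) hv, wordF_letter (by omega) hy⟩, ?_⟩
    intro h1 _
    rw [residue_cons_lt h hy, eps_cons] at h1
    omega

/-- The local relations when `f_i` and `f_j` do not act on the first letter. -/
theorem AdjacentColours.localRelations_tail (hA : AdjacentColours X i j) {x : ℤ}
    {w a b : List ℤ} (hb : wordF X i w = some b) (ha : wordF X j w = some a)
    (hi : letterPhi X i x ≤ eps X i w) (hj : letterPhi X j x = 0)
    (h : LocalRelations X i j w a b) : LocalRelations X i j (x :: w) (x :: a) (x :: b) := by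
  have hr := hA.residue_le w
  have hr' := hA.symm.residue_le w
  obtain ⟨p1, p2⟩ := hA.symm.eps_wordF ha
  obtain ⟨q1, q2⟩ := hA.eps_wordF hb
  have p3 := hA.residue_wordF ha
  have q3 := hA.symm.residue_wordF hb
  have p4 := hA.symm.phi_wordF ha
  have q4 := hA.phi_wordF hb
  have p5 := wordF_spec ha
  have q5 := wordF_spec hb
  have hI := hA.eps_eq_residue w
  have hx1 : residue X i j (x :: w) = letterEps X j x + residue X i j w := by
    rw [residue_cons_le hi, hj]; omega
  have hx2 : residue X j i (x :: w) = letterEps X i x + (residue X j i w - letterPhi X i x) := by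
    rw [residue_cons_le (by omega)]
  have hx3 : eps X j (x :: w) = letterEps X j x + eps X j w := by rw [eps_cons, hj]; omega
  have hx4 : eps X i (x :: w) = letterEps X i x + (eps X i w - letterPhi X i x) := eps_cons _ _
  unfold LocalRelations
  rw [hx1, hx2, hx3, hx4]
  by_cases hs : residue X i j w < eps X j w ∨ residue X j i w < eps X i w
  · obtain ⟨s, hs1, hs2⟩ := h.1 hs
    by_cases hia : letterPhi X i x ≤ eps X i a
    · refine ⟨fun _ => ⟨x :: s, wordF_tail (by omega) hs1, wordF_tail hia hs2⟩, ?_⟩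
      intro h1 h2
      omega
    -- The square closes on the tail, but `f_j` has brought `ε_i` of the tail below `φ_i x`, so that
    -- `f_i` now acts on `x`: adding `x` turns the square into a degree-four relation.
    · have hstate : letterPhi X i x = 1 := by
        rcases hA.state x with h | h | h | h | h | h | h <;>
          obtain ⟨a1, a2, a3, a4⟩ := h <;> omega
      have hia0 : eps X i a = 0 := by omega
      refine ⟨fun h1 => by omega, fun _ _ => ?_⟩
      obtain ⟨y, hy⟩ := exists_letterF X (show 0 < letterPhi X i x by omega)
      obtain ⟨s1, hs1'⟩ := exists_wordF (X := X) (i := j) (w := s) (by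
        have := wordF_spec hs1
        omega)
      have u1 := (hA.eps_wordF hs2).1
      have u2 := (hA.symm.eps_wordF hs1).1
      have u3 := (hA.symm.eps_wordF hs1).2
      have u4 := (hA.symm.eps_wordF hs1').1
      have hst : residue X j i w < eps X i w := by omega
      rw [if_pos hst] at p3
      rw [if_neg (by omega)] at q3
      have v1 := wordF_spec hs1
      have v2 := wordF_spec hs2
      rcases hA.letterF_some hy with ⟨⟨a1, a2, a3, a4⟩, ⟨b1, b2, b3, b4⟩⟩ |
        ⟨⟨a1, a2, a3, a4⟩, ⟨b1, b2, b3, b4⟩⟩ <;>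
      exact ⟨x :: s, x :: s1, y :: a, y :: s, y :: s1, wordF_tail (by omega) hs1,
        wordF_tail (by omega) hs1', wordF_letter (by omega) hy, wordF_letter (by omega) hy,
        wordF_tail (by omega) hs2, wordF_tail (by omega) hs1'⟩
  · have e1 : residue X i j w = eps X j w := by omega
    have e2 : residue X j i w = eps X i w := by omega
    refine ⟨fun h1 => by omega, fun _ _ => ?_⟩
    obtain ⟨b1, b2, a1, a2, s, k1, k2, k3, k4, k5, k6⟩ := h.2 e1 e2
    have u1 := hA.symm.eps_wordF k1
    have u2 := hA.symm.eps_wordF k2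
    have u3 := wordF_spec k4
    rw [if_neg (by omega)] at q3
    exact ⟨x :: b1, x :: b2, x :: a1, x :: a2, x :: s, wordF_tail (by omega) k1,
      wordF_tail (by omega) k2, wordF_tail (by omega) k3, wordF_tail (by omega) k4,
      wordF_tail (by omega) k5, wordF_tail (by omega) k6⟩

/-- Stembridge's axioms for words, by induction on the first letter. The two operators cannot both
act on that letter, since no letter has `φ_i` and `φ_j` both positive. -/
theorem AdjacentColours.localRelations (hA : AdjacentColours X i j) {w a b : List ℤ}
    (hb : wordF X i w = some b) (ha : wordF X j w = some a) : LocalRelations X i j w a b := by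
  induction w generalizing a b with
  | nil => simp [wordF] at hb
  | cons x w ih =>
    rcases wordF_cons_some.mp hb with ⟨h1, y, hy, rfl⟩ | ⟨h1, u, hu, rfl⟩ <;>
    rcases wordF_cons_some.mp ha with ⟨k1, z, hz, rfl⟩ | ⟨k1, v, hv, rfl⟩
    · rcases hA.state x with h | h | h | h | h | h | h <;>
        obtain ⟨a1, a2, a3, a4⟩ := h <;> omega
    · exact hA.localRelations_letter_tail h1 hy hv
    · exact (hA.symm.localRelations_letter_tail k1 hz hu).symm
    · have : letterPhi X j x = 0 ∨ letterPhi X i x = 0 := by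
        rcases hA.state x with h | h | h | h | h | h | h <;>
          obtain ⟨a1, a2, a3, a4⟩ := h <;> omega
      rcases this with h | h
      · exact hA.localRelations_tail hu hv h1 h (ih hu hv)
      · exact (hA.symm.localRelations_tail hv hu k1 h (ih hu hv).symm).symm

end AdjacentColours
end OrthogonalTableaux

/-! ### Components are determined by their highest weight: the simply laced case -/

namespace OrthogonalTableaux

section AdjacentUp
variable {X : OType} {i j : ℕ}

theorem AdjacentColours.eps_lt_iff (hA : AdjacentColours X i j) {w b : List ℤ}
    (hb : wordF X i w = some b) : residue X i j w < eps X j w ↔ eps X j b < eps X j w := by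
  have := hA.eps_wordF hb
  omega

/-- The two alternatives of the local relations are exclusive, which allows the type of a
configuration to be recognised from its top as well as from its bottom. -/
theorem AdjacentColours.not_square (hA : AdjacentColours X i j) {w a b s : List ℤ}
    (hb : wordF X i w = some b) (ha : wordF X j w = some a)
    (h1 : residue X i j w = eps X j w) (h2 : residue X j i w = eps X i w)
    (hs : wordF X j b = some s) (hs' : wordF X i a = some s) : False := by
  have e1 := hA.symm.eps_wordF hs
  have e2 := hA.symm.residue_wordF hb
  rw [if_neg (by omega)] at e2
  have e3 := hA.symm.eps_wordF ha
  have e4 := wordF_spec hs'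
  have e5 := wordF_spec hb
  omega

/-- The local relations above a word that is reached by arrows of two adjacent colours. -/
theorem AdjacentColours.relations_above (hA : AdjacentColours X i j) {u p q : List ℤ}
    (hp : wordF X i p = some u) (hq : wordF X j q = some u) :
    (∃ r, wordF X j r = some p ∧ wordF X i r = some q ∧
      (residue X i j r < eps X j r ∨ residue X j i r < eps X i r)) ∨
    (∃ r b b₁ a a₁, wordF X i r = some b ∧ wordF X j b = some b₁ ∧ wordF X j b₁ = some p ∧
      wordF X j r = some a ∧ wordF X i a = some a₁ ∧ wordF X i a₁ = some q ∧
      residue X i j r = eps X j r ∧ residue X j i r = eps X i r) := by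
  have hp' := wordF_dual hp
  have hq' := wordF_dual hq
  have hL := hA.localRelations hp' hq'
  have r1 := hA.residue_le (dual u)
  have r2 := hA.symm.residue_le (dual u)
  by_cases hs : residue X i j (dual u) < eps X j (dual u) ∨ residue X j i (dual u) < eps X i (dual u)
  · obtain ⟨s, hs1, hs2⟩ := hL.1 hs
    have k1 := wordF_dual hs1
    have k2 := wordF_dual hs2
    rw [dual_dual] at k1 k2
    refine Or.inl ⟨dual s, k1, k2, ?_⟩
    -- The dual of a square is a square, and at its top `dual s` the degree-four alternative is
    -- ruled out by `not_square`.
    by_contra hc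
    have r3 := hA.residue_le (dual s)
    have r4 := hA.symm.residue_le (dual s)
    exact hA.not_square k2 k1 (by omega) (by omega) hq hp
  · obtain ⟨b₁, b₂, a₁, a₂, s, h1, h2, h3, h4, h5, h6⟩ := hL.2 (by omega) (by omega)
    have k1 := wordF_dual h1
    have k4 := wordF_dual h4
    rw [dual_dual] at k1 k4
    refine Or.inr ⟨dual s, dual b₂, dual b₁, dual a₂, dual a₁, wordF_dual h3, wordF_dual h2, k1,
      wordF_dual h6, wordF_dual h5, k4, ?_⟩
    have r3 := hA.residue_le (dual s)
    have r4 := hA.symm.residue_le (dual s)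
    by_contra hc
    obtain ⟨t, ht1, ht2⟩ := (hA.localRelations (wordF_dual h3) (wordF_dual h6)).1 (by omega)
    have e1 := Option.some.inj (ht1.symm.trans (wordF_dual h2))
    have e2 := Option.some.inj (ht2.symm.trans (wordF_dual h5))
    subst e1
    rw [← e2] at k4
    have l1 := wordF_dual k1
    have l4 := wordF_dual k4
    exact hA.not_square hp' hq' (by omega) (by omega) l1 l4

theorem CommutingColours.square_above (h : CommutingColours X i j) (h' : CommutingColours X j i)
    {u p q : List ℤ} (hp : wordF X i p = some u) (hq : wordF X j q = some u) :
    ∃ r, wordF X j r = some p ∧ wordF X i r = some q := by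
  obtain ⟨s, h1, h2⟩ := h.square h' (wordF_dual hp) (wordF_dual hq)
  have k1 := wordF_dual h1
  have k2 := wordF_dual h2
  rw [dual_dual] at k1 k2
  exact ⟨dual s, k1, k2⟩

end AdjacentUp

/-! ### Pairs of words obtained by the same sequence of lowering operators -/

/-- The constant is a Cartan integer, but its value plays no role: along a parallel pair the
differences `φ_j - ε_j` remain equal, so equality of `ε_j` entails that of `φ_j`. -/
theorem exists_cartan (X : OType) (i j : ℕ) : ∃ c : ℤ, ∀ w v, wordF X i w = some v →
    (phi X j v : ℤ) - eps X j v = phi X j w - eps X j w - c := by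
  rcases j with _ | j
  · cases X
    · refine ⟨2 * rootCoord OType.B i 1, fun w v h => ?_⟩
      rw [phi_sub_eps_B_zero, phi_sub_eps_B_zero, wordF_weight h one_pos]; ring
    · refine ⟨rootCoord OType.D i 2 + rootCoord OType.D i 1, fun w v h => ?_⟩
      rw [phi_sub_eps_D_zero, phi_sub_eps_D_zero, wordF_weight h one_pos,
        wordF_weight h two_pos]; ring
  · refine ⟨rootCoord X i (j + 2) - rootCoord X i (j + 1), fun w v h => ?_⟩
    rw [phi_sub_eps_succ, phi_sub_eps_succ, wordF_weight h (by omega),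
        wordF_weight h (by omega)]; ring

/-- `b` and `b'` are obtained from `v` and `v'` by the same sequence of `k` operators. -/
inductive Parallel (X : OType) (m : ℕ) (v v' : List ℤ) : ℕ → List ℤ → List ℤ → Prop
  | refl : Parallel X m v v' 0 v v'
  | step {k i : ℕ} {a a' b b' : List ℤ} : i < m → Parallel X m v v' k a a' →
      wordF X i a = some b → wordF X i a' = some b' → Parallel X m v v' (k + 1) b b'

/-- A word that is killed by the raising operators. -/
def IsSource (X : OType) (m : ℕ) (w : List ℤ) : Prop := ∀ i < m, eps X i w = 0

/-- Any two colours are adjacent or commute. -/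
def SimplyLaced (X : OType) : Prop :=
  ∀ i j, i ≠ j → AdjacentColours X i j ∨ (CommutingColours X i j ∧ CommutingColours X j i)

section Parallel
variable {X : OType} {m : ℕ} {v v' : List ℤ}

theorem Parallel.symm {k : ℕ} {b b' : List ℤ} (h : Parallel X m v v' k b b') :
    Parallel X m v' v k b' b := by
  induction h with
  | refl => exact .refl
  | step hi _ h1 h2 ih => exact .step hi ih h2 h1

theorem Parallel.phi_sub_eps (hφ : ∀ i < m, (phi X i v : ℤ) - eps X i v = phi X i v' - eps X i v')
    {k : ℕ} {b b' : List ℤ} (h : Parallel X m v v' k b b') {j : ℕ} (hj : j < m) :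
    (phi X j b : ℤ) - eps X j b = phi X j b' - eps X j b' := by
  induction h with
  | refl => exact hφ j hj
  | @step k i a a' b b' hi _ h1 h2 ih =>
    obtain ⟨c, hc⟩ := exists_cartan X i j
    rw [hc _ _ h1, hc _ _ h2, ih]

/-- The two words of a parallel pair have the same place with respect to all colours. -/
def ParallelSpec (X : OType) (m : ℕ) (v v' : List ℤ) (k : ℕ) : Prop :=
  ∀ b b', Parallel X m v v' k b b' → ∀ j < m, eps X j b = eps X j b' ∧ phi X j b = phi X j b' ∧
    ∀ q, wordF X j q = some b → ∃ q' k', wordF X j q' = some b' ∧ k = k' + 1 ∧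
      Parallel X m v v' k' q q'

theorem Parallel.lower {k : ℕ} {a a' b : List ℤ} {i : ℕ} (h : Parallel X m v v' k a a')
    (hS : ParallelSpec X m v v' k) (hi : i < m) (hb : wordF X i a = some b) :
    ∃ b', wordF X i a' = some b' ∧ Parallel X m v v' (k + 1) b b' := by
  obtain ⟨b', hb'⟩ := exists_wordF (X := X) (i := i) (w := a') (by
    rw [← (hS _ _ h i hi).2.1]; exact phi_pos_of_wordF hb)
  exact ⟨b', hb', .step hi h hb hb'⟩

/-- The words `a` and `q` above `b` belong to a square or to a degree-four configuration, all of
whose other words lie at levels at most `k`, where parallelism is already understood. The same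
configuration is rebuilt on the primed side, starting from its top. -/
theorem ParallelSpec.raise_step (hX : SimplyLaced X) {k : ℕ}
    (hS : ∀ k' ≤ k, ParallelSpec X m v v' k') {a a' b b' q : List ℤ} {i j : ℕ} (hi : i < m)
    (hj : j < m) (h : Parallel X m v v' k a a') (hb : wordF X i a = some b)
    (hb' : wordF X i a' = some b') (hq : wordF X j q = some b) :
    ∃ q', wordF X j q' = some b' ∧ Parallel X m v v' k q q' := by
  by_cases hij : i = j
  · subst hij
    obtain rfl := wordF_inj hb hq
    exact ⟨a', hb', h⟩
  rcases hX i j hij with hA | ⟨hC, hC'⟩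
  · rcases hA.relations_above hb hq with ⟨r, hr1, hr2, hs⟩ |
      ⟨r, β, β₁, α, α₁, h1, h2, h3, h4, h5, h6, h7, h8⟩
    · obtain ⟨r', k', hr', rfl, hP⟩ := (hS k le_rfl _ _ h j hj).2.2 r hr1
      obtain ⟨q', hq', hP'⟩ := hP.lower (hS k' (by omega)) hi hr2
      refine ⟨q', ?_, hP'⟩
      -- That the configuration is a square is read off from values of `ε` only; these agree on the
      -- two sides.
      rw [hA.eps_lt_iff hr2, hA.symm.eps_lt_iff hr1, (hS _ le_rfl _ _ hP' j hj).1,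
        (hS _ (by omega) _ _ hP j hj).1, (hS _ (by omega) _ _ hP i hi).1,
        (hS _ le_rfl _ _ h i hi).1, ← hA.eps_lt_iff hq', ← hA.symm.eps_lt_iff hr'] at hs
      obtain ⟨s, hs1, hs2⟩ := (hA.localRelations hq' hr').1 hs
      rw [hb'] at hs2
      rw [hs1, hs2]
    · obtain ⟨β₁', k₁, e1, rfl, P1⟩ := (hS _ le_rfl _ _ h j hj).2.2 β₁ h3
      obtain ⟨β', k₂, e2, rfl, P2⟩ := (hS _ (by omega) _ _ P1 j hj).2.2 β h2
      obtain ⟨r', k₃, e3, rfl, P3⟩ := (hS _ (by omega) _ _ P2 i hi).2.2 r h1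
      obtain ⟨α', e4, P4⟩ := P3.lower (hS _ (by omega)) hj h4
      obtain ⟨α₁', e5, P5⟩ := P4.lower (hS _ (by omega)) hi h5
      obtain ⟨q', e6, P6⟩ := P5.lower (hS _ (by omega)) hi h6
      refine ⟨q', ?_, P6⟩
      have s1 : ¬ residue X i j r < eps X j r := by omega
      have s2 : ¬ residue X j i r < eps X i r := by omega
      rw [hA.eps_lt_iff h1, (hS _ (by omega) _ _ P2 j hj).1, (hS _ (by omega) _ _ P3 j hj).1,
        ← hA.eps_lt_iff e3] at s1
      rw [hA.symm.eps_lt_iff h4, (hS _ (by omega) _ _ P4 i hi).1, (hS _ (by omega) _ _ P3 i hi).1,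
        ← hA.symm.eps_lt_iff e4] at s2
      have t1 := hA.residue_le r'
      have t2 := hA.symm.residue_le r'
      obtain ⟨b₁, b₂, a₁, a₂, s, l1, l2, l3, l4, l5, l6⟩ :=
        (hA.localRelations e3 e4).2 (by omega) (by omega)
      obtain rfl := Option.some.inj (l1.symm.trans e2)
      obtain rfl := Option.some.inj (l2.symm.trans e1)
      obtain rfl := Option.some.inj (l3.symm.trans hb')
      obtain rfl := Option.some.inj (l4.symm.trans e5)
      obtain rfl := Option.some.inj (l5.symm.trans e6)
      exact l6
  · obtain ⟨r, hr1, hr2⟩ := hC.square_above hC' hb hq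
    obtain ⟨r', k', hr', rfl, hP⟩ := (hS k le_rfl _ _ h j hj).2.2 r hr1
    obtain ⟨q', hq', hP'⟩ := hP.lower (hS k' (by omega)) hi hr2
    refine ⟨q', ?_, hP'⟩
    obtain ⟨s, hs1, hs2⟩ := hC.square hC' hq' hr'
    rw [hb'] at hs2
    rw [hs1, hs2]

theorem ParallelSpec.symm {k : ℕ} (h : ParallelSpec X m v v' k) : ParallelSpec X m v' v k := by
  intro b b' hb j hj
  obtain ⟨h1, h2, h3⟩ := h b' b hb.symm j hj
  refine ⟨h1.symm, h2.symm, fun q hq => ?_⟩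
  obtain ⟨q', hq'⟩ := exists_wordF_eq (X := X) (i := j) (v := b') (by
    rw [h1]; exact eps_pos_of_wordF hq)
  obtain ⟨q'', k', h4, h5, h6⟩ := h3 q' hq'
  obtain rfl := wordF_inj hq h4
  exact ⟨q', k', hq', h5, h6.symm⟩

/-- Induction on the number of operators. Each raising of `b` is matched by one of `b'` and
conversely, so that the `ε_j` agree; the `φ_j` then agree because the differences `φ_j - ε_j` do. -/
theorem parallelSpec (hX : SimplyLaced X) (hv : IsSource X m v) (hv' : IsSource X m v')
    (hφ : ∀ i < m, phi X i v = phi X i v') (k : ℕ) : ParallelSpec X m v v' k := by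
  induction k using Nat.strong_induction_on with
  | _ k ih =>
    intro b b' hb j hj
    have hz : ∀ i < m, (phi X i v : ℤ) - eps X i v = phi X i v' - eps X i v' := fun i hi => by
      rw [hv i hi, hv' i hi, hφ i hi]
    have hd := hb.phi_sub_eps hz hj
    cases hb with
    | refl =>
      refine ⟨by rw [hv j hj, hv' j hj], hφ j hj, fun q hq => ?_⟩
      have := eps_pos_of_wordF hq
      rw [hv j hj] at this
      omega
    | @step k i a a' _ _ hi hP h1 h2 =>
      have key : ∀ q, wordF X j q = some b → ∃ q', wordF X j q' = some b' ∧
          Parallel X m v v' k q q' := fun q hq =>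
        ParallelSpec.raise_step hX (fun k' hk' => ih k' (by omega)) hi hj hP h1 h2 hq
      have key' : ∀ q, wordF X j q = some b' → ∃ q', wordF X j q' = some b ∧
          Parallel X m v' v k q q' := fun q hq =>
        ParallelSpec.raise_step hX (fun k' hk' => (ih k' (by omega)).symm) hi hj hP.symm h2 h1 hq
      have he : eps X j b = eps X j b' := by
        rcases Nat.eq_zero_or_pos (eps X j b) with h0 | h0
        · rcases Nat.eq_zero_or_pos (eps X j b') with h0' | h0'
          · rw [h0, h0']
          · obtain ⟨q, hq⟩ := exists_wordF_eq h0'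
            obtain ⟨q', hq', -⟩ := key' q hq
            have := eps_pos_of_wordF hq'
            omega
        · obtain ⟨q, hq⟩ := exists_wordF_eq h0
          obtain ⟨q', hq', hP'⟩ := key q hq
          have e1 := wordF_spec hq
          have e2 := wordF_spec hq'
          have e3 := (ih k (by omega) _ _ hP' j hj).1
          omega
      refine ⟨he, by omega, fun q hq => ?_⟩
      obtain ⟨q', h3, h4⟩ := key q hq
      exact ⟨q', k, h3, rfl, h4⟩

end Parallel

/-! ### Bisimilar words -/

/-- A relation that is compatible with all the operators of colour less than `m`. -/
def IsBisim (X : OType) (m : ℕ) (R : List ℤ → List ℤ → Prop) : Prop :=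
  ∀ a b, R a b → ∀ i < m, eps X i a = eps X i b ∧ phi X i a = phi X i b ∧
    (∀ a', wordF X i a = some a' → ∃ b', wordF X i b = some b' ∧ R a' b') ∧
    (∀ a', wordF X i a' = some a → ∃ b', wordF X i b' = some b ∧ R a' b')

/-- `a` and `b` have the same place in isomorphic components. -/
def Sim (X : OType) (m : ℕ) (a b : List ℤ) : Prop := ∃ R, IsBisim X m R ∧ R a b

section Sim
variable {X : OType} {m : ℕ}

theorem isBisim_sim : IsBisim X m (Sim X m) := by
  rintro a b ⟨R, hR, hab⟩ i hi
  obtain ⟨h1, h2, h3, h4⟩ := hR a b hab i hi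
  refine ⟨h1, h2, fun a' ha' => ?_, fun a' ha' => ?_⟩
  · obtain ⟨b', hb', h⟩ := h3 a' ha'
    exact ⟨b', hb', R, hR, h⟩
  · obtain ⟨b', hb', h⟩ := h4 a' ha'
    exact ⟨b', hb', R, hR, h⟩

theorem Sim.eps_eq {a b : List ℤ} (h : Sim X m a b) {i : ℕ} (hi : i < m) :
    eps X i a = eps X i b := (isBisim_sim a b h i hi).1
theorem Sim.phi_eq {a b : List ℤ} (h : Sim X m a b) {i : ℕ} (hi : i < m) :
    phi X i a = phi X i b := (isBisim_sim a b h i hi).2.1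
theorem Sim.lower {a b a' : List ℤ} (h : Sim X m a b) {i : ℕ} (hi : i < m)
    (ha : wordF X i a = some a') : ∃ b', wordF X i b = some b' ∧ Sim X m a' b' :=
  (isBisim_sim a b h i hi).2.2.1 a' ha
theorem Sim.raise {a b a' : List ℤ} (h : Sim X m a b) {i : ℕ} (hi : i < m)
    (ha : wordF X i a' = some a) : ∃ b', wordF X i b' = some b ∧ Sim X m a' b' :=
  (isBisim_sim a b h i hi).2.2.2 a' ha

theorem Sim.refl (a : List ℤ) : Sim X m a a :=
  ⟨Eq, by rintro a _ rfl i _; exact ⟨rfl, rfl, fun a' h => ⟨a', h, rfl⟩, fun a' h => ⟨a', h, rfl⟩⟩,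
    rfl⟩

theorem Sim.symm {a b : List ℤ} (h : Sim X m a b) : Sim X m b a := by
  refine ⟨fun x y => Sim X m y x, fun x y hxy i hi => ?_, h⟩
  refine ⟨(hxy.eps_eq hi).symm, (hxy.phi_eq hi).symm, fun x' hx' => ?_, fun x' hx' => ?_⟩
  · obtain ⟨y', hy'⟩ := exists_wordF (X := X) (i := i) (w := y) (by
      rw [hxy.phi_eq hi]; exact phi_pos_of_wordF hx')
    obtain ⟨x'', h1, h2⟩ := hxy.lower hi hy'
    obtain rfl := Option.some.inj (hx'.symm.trans h1)
    exact ⟨y', hy', h2⟩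
  · obtain ⟨y', hy'⟩ := exists_wordF_eq (X := X) (i := i) (v := y) (by
      rw [hxy.eps_eq hi]; exact eps_pos_of_wordF hx')
    obtain ⟨x'', h1, h2⟩ := hxy.raise hi hy'
    obtain rfl := wordF_inj hx' h1
    exact ⟨y', hy', h2⟩

theorem Sim.trans {a b c : List ℤ} (h : Sim X m a b) (h' : Sim X m b c) : Sim X m a c := by
  refine ⟨fun x z => ∃ y, Sim X m x y ∧ Sim X m y z, ?_, b, h, h'⟩
  rintro x z ⟨y, hxy, hyz⟩ i hi
  refine ⟨(hxy.eps_eq hi).trans (hyz.eps_eq hi), (hxy.phi_eq hi).trans (hyz.phi_eq hi),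
    fun x' hx' => ?_, fun x' hx' => ?_⟩
  · obtain ⟨y', h1, h2⟩ := hxy.lower hi hx'
    obtain ⟨z', h3, h4⟩ := hyz.lower hi h1
    exact ⟨z', h3, y', h2, h4⟩
  · obtain ⟨y', h1, h2⟩ := hxy.raise hi hx'
    obtain ⟨z', h3, h4⟩ := hyz.raise hi h1
    exact ⟨z', h3, y', h2, h4⟩

/-- The tensor product rule consults the factors only through `ε` and `φ`, which bisimilar words
share. Equivalence of words is thus a congruence for concatenation. -/
theorem Sim.append {a b c d : List ℤ} (h : Sim X m a b) (h' : Sim X m c d) :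
    Sim X m (a ++ c) (b ++ d) := by
  refine ⟨fun x y => ∃ x₁ x₂ y₁ y₂, x = x₁ ++ x₂ ∧ y = y₁ ++ y₂ ∧ Sim X m x₁ y₁ ∧ Sim X m x₂ y₂,
    ?_, a, c, b, d, rfl, rfl, h, h'⟩
  rintro _ _ ⟨x₁, x₂, y₁, y₂, rfl, rfl, h1, h2⟩ i hi
  have e1 := h1.eps_eq hi
  have e2 := h1.phi_eq hi
  have e3 := h2.eps_eq hi
  have e4 := h2.phi_eq hi
  refine ⟨by simp only [eps_append, e1, e2, e3], by simp only [phi_append, e4, e2, e3],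
    fun w hw => ?_, fun w hw => ?_⟩
  · rcases (wordF_append _ _ _).mp hw with ⟨k, x', hx', rfl⟩ | ⟨k, x', hx', rfl⟩
    · obtain ⟨y', hy', hs⟩ := h1.lower hi hx'
      exact ⟨y' ++ y₂, (wordF_append _ _ _).mpr (Or.inl ⟨by omega, y', hy', rfl⟩),
        x', x₂, y', y₂, rfl, rfl, hs, h2⟩
    · obtain ⟨y', hy', hs⟩ := h2.lower hi hx'
      exact ⟨y₁ ++ y', (wordF_append _ _ _).mpr (Or.inr ⟨by omega, y', hy', rfl⟩),
        x₁, x', y₁, y', rfl, rfl, h1, hs⟩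
  · rcases wordF_eq_append.mp hw with ⟨k, x', hx', rfl⟩ | ⟨k, x', hx', rfl⟩
    · obtain ⟨y', hy', hs⟩ := h1.raise hi hx'
      exact ⟨y' ++ y₂, wordF_eq_append.mpr (Or.inl ⟨by omega, y', hy', rfl⟩),
        x', x₂, y', y₂, rfl, rfl, hs, h2⟩
    · obtain ⟨y', hy', hs⟩ := h2.raise hi hx'
      exact ⟨y₁ ++ y', wordF_eq_append.mpr (Or.inr ⟨by omega, y', hy', rfl⟩),
        x₁, x', y₁, y', rfl, rfl, h1, hs⟩

theorem sim_of_sources_of_simplyLaced (hX : SimplyLaced X) {v v' : List ℤ} (hv : IsSource X m v)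
    (hv' : IsSource X m v') (hφ : ∀ i < m, phi X i v = phi X i v') : Sim X m v v' := by
  refine ⟨fun a b => ∃ k, Parallel X m v v' k a b, ?_, 0, .refl⟩
  rintro a b ⟨k, hk⟩ i hi
  have hS := parallelSpec hX hv hv' hφ k
  obtain ⟨h1, h2, h3⟩ := hS a b hk i hi
  refine ⟨h1, h2, fun a' ha' => ?_, fun a' ha' => ?_⟩
  · obtain ⟨b', hb', hP⟩ := hk.lower hS hi ha'
    exact ⟨b', hb', _, hP⟩
  · obtain ⟨b', k', hb', -, hP⟩ := h3 a' ha'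
    exact ⟨b', hb', k', hP⟩

/-- The words reached from `v` by lowering are closed under raising, by `parallelSpec` for `v`
paired with itself. They fill the component, and among them only `v` is a source. -/
theorem source_unique_of_simplyLaced (hX : SimplyLaced X) {v v' : List ℤ} (hv : IsSource X m v)
    (hv' : IsSource X m v') (h : Connected X m v v') : v = v' := by
  have hS := parallelSpec hX hv hv (fun _ _ => rfl)
  have key : ∀ a b, Connected X m a b →
      ((∃ k, Parallel X m v v k a a) ↔ ∃ k, Parallel X m v v k b b) := by
    intro a b hab
    induction hab with
    | rel a b hab =>
      obtain ⟨i, hi, hab⟩ := hab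
      constructor
      · rintro ⟨k, hk⟩
        exact ⟨k + 1, .step hi hk hab hab⟩
      · rintro ⟨k, hk⟩
        obtain ⟨a', k', ha', -, hP⟩ := (hS k _ _ hk i hi).2.2 a hab
        obtain rfl := wordF_inj hab ha'
        exact ⟨k', hP⟩
    | refl a => exact Iff.rfl
    | symm a b _ ih => exact ih.symm
    | trans a b c _ _ ih1 ih2 => exact ih1.trans ih2
  obtain ⟨k, hk⟩ := (key v v' h).mp ⟨0, .refl⟩
  cases hk with
  | refl => rfl
  | step hi _ h1 _ =>
    have := eps_pos_of_wordF h1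
    rw [hv' _ hi] at this
    omega

end Sim

/-! ### Type `D` -/

/-- In this numbering the Dynkin diagram is the chain `1 - 2 - 3 - ⋯` with the node `0` attached to
`2`; the nodes `0` and `1` are the two ends of the fork. -/
theorem simplyLaced_D : SimplyLaced OType.D := by
  have adj0 : AdjacentColours OType.D 0 2 := by
    intro x
    simp only [LetterState, letterPhi_succ, letterEps_succ, letterPhi_D_zero, letterEps_D_zero,
      letterF_succ OType.D 1, letterF_D_zero]
    by_cases h1 : x = -3
    · subst h1; norm_num
    by_cases h2 : x = -2
    · subst h2; norm_num
    by_cases h3 : x = -1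
    · subst h3; norm_num
    by_cases h4 : x = 1
    · subst h4; norm_num
    by_cases h5 : x = 2
    · subst h5; norm_num
    by_cases h6 : x = 3
    · subst h6; norm_num
    left
    norm_num
    omega
  have adj : ∀ i, AdjacentColours OType.D (i + 1) (i + 2) := by
    intro i x
    simp only [LetterState, letterPhi_succ, letterEps_succ, letterF_succ]
    by_cases h1 : x = -((i : ℤ) + 3)
    · right; right; right; right; left
      refine ⟨by split_ifs <;> omega, x + 1, by rw [if_pos (by push_cast; omega)], ?_⟩
      push_cast
      split_ifs <;> omega
    by_cases h2 : x = -((i : ℤ) + 2)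
    · right; right; right; right; right; left
      refine ⟨by push_cast; split_ifs <;> omega, x + 1, by rw [if_pos (by omega)], ?_⟩
      push_cast
      split_ifs <;> omega
    by_cases h3 : x = -((i : ℤ) + 1)
    · right; right; right; right; right; right
      push_cast
      split_ifs <;> omega
    by_cases h4 : x = (i : ℤ) + 1
    · right; left
      refine ⟨by push_cast; split_ifs <;> omega, x + 1, by rw [if_pos (by omega)], ?_⟩
      push_cast
      split_ifs <;> omega
    by_cases h5 : x = (i : ℤ) + 2
    · right; right; left
      refine ⟨by push_cast; split_ifs <;> omega, x + 1, by rw [if_pos (by push_cast; omega)], ?_⟩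
      push_cast
      split_ifs <;> omega
    by_cases h6 : x = (i : ℤ) + 3
    · right; right; right; left
      push_cast
      split_ifs <;> omega
    left
    push_cast
    split_ifs <;> omega
  have com01 : CommutingColours OType.D 0 1 ∧ CommutingColours OType.D 1 0 := by
    constructor <;> intro x y hy <;>
      simp only [letterPhi_succ OType.D 0, letterEps_succ OType.D 0, letterPhi_D_zero,
        letterEps_D_zero, letterF_succ OType.D 0, letterF_D_zero] at hy ⊢ <;>
      by_cases h1 : x = -2 <;> by_cases h2 : x = -1 <;> by_cases h3 : x = 1 <;>
      first
      | omega
      | (subst x; norm_num at hy; done)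
      | (subst x; norm_num at hy; subst hy; norm_num <;> (intro z hz; cases hz))
      | simp_all
  have com0 : ∀ i, CommutingColours OType.D 0 (i + 3) ∧ CommutingColours OType.D (i + 3) 0 := by
    intro i
    constructor <;> intro x y hy <;>
      simp only [letterPhi_succ, letterEps_succ, letterPhi_D_zero,
        letterEps_D_zero, letterF_succ, letterF_D_zero] at hy ⊢ <;> push_cast at hy ⊢ <;>
      split_ifs at hy <;> simp only [Option.some.injEq, reduceCtorEq] at hy <;> subst hy <;>
      refine ⟨by split_ifs <;> omega, by split_ifs <;> omega, fun z hz => ?_⟩ <;>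
      split_ifs at hz <;> omega
  have com : ∀ i k, CommutingColours OType.D (i + 1) (i + k + 3) ∧
      CommutingColours OType.D (i + k + 3) (i + 1) := by
    intro i k
    constructor <;> intro x y hy <;>
      simp only [letterPhi_succ, letterEps_succ, letterF_succ] at hy ⊢ <;> push_cast at hy ⊢ <;>
      split_ifs at hy <;> simp only [Option.some.injEq, reduceCtorEq] at hy <;> subst hy <;>
      refine ⟨by split_ifs <;> omega, by split_ifs <;> omega, fun z hz => ?_⟩ <;>
      split_ifs at hz <;> omega
  have key : ∀ i j, i < j → AdjacentColours OType.D i j ∨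
      (CommutingColours OType.D i j ∧ CommutingColours OType.D j i) := by
    intro i j hij
    obtain ⟨d, rfl⟩ := Nat.exists_eq_add_of_lt hij
    match i, d with
    | 0, 0 => exact Or.inr com01
    | 0, 1 => exact Or.inl adj0
    | 0, d + 2 => rw [Nat.zero_add]; exact Or.inr (com0 d)
    | i + 1, 0 => exact Or.inl (adj i)
    | i + 1, d + 1 =>
      have := com i d
      rw [show i + 1 + (d + 1) + 1 = i + d + 3 by omega]
      exact Or.inr this
  intro i j hij
  rcases lt_or_gt_of_ne hij with h | h
  · exact key i j h
  · rcases key j i h with h | h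
    · exact Or.inl h.symm
    · exact Or.inr h.symm

end OrthogonalTableaux

/-! ### Folding of type `D` onto type `B`, sources, and isomorphisms of components -/

namespace OrthogonalTableaux

/-! ### Type `B` inside type `D` -/

/-- A letter of type `B` as a word of type `D`. -/
def doubleLetter (x : ℤ) : List ℤ :=
  if 0 < x then [x + 1, x + 1] else if x < 0 then [x - 1, x - 1] else [2, -2]

/-- A word of type `B` as a word of type `D`. -/
def double (w : List ℤ) : List ℤ := w.flatMap doubleLetter

theorem double_cons (x : ℤ) (w : List ℤ) : double (x :: w) = doubleLetter x ++ double w := rfl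

/-- Folding of the diagram: the operator `f_0` of `B_m` becomes `f_0 f_1` in `D_{m+1}`, over the two
ends of the fork, and `f_{i+1}` becomes the square of `f_{i+2}`. The image of the letter `0` is the
middle of the path from `[-2, -2]` to `[2, 2]`. -/
theorem doubleLetter_stats_zero (x : ℤ) :
    eps OType.D 0 (doubleLetter x) = letterEps OType.B 0 x ∧
    phi OType.D 0 (doubleLetter x) = letterPhi OType.B 0 x ∧
    eps OType.D 1 (doubleLetter x) = letterEps OType.B 0 x ∧
    phi OType.D 1 (doubleLetter x) = letterPhi OType.B 0 x := by
  have h1 : (-x = -2 ↔ x = 2) ∧ (-x = -1 ↔ x = 1) := by omega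
  unfold doubleLetter
  split_ifs <;> simp only [eps_cons, phi_cons, eps_nil, phi_nil, letterEps_B_zero,
    letterPhi_B_zero, letterEps_D_zero, letterPhi_D_zero, letterEps_succ OType.D 0,
    letterPhi_succ OType.D 0] <;> push_cast <;> (try norm_num) <;>
    (try refine ⟨?_, ?_, ?_, ?_⟩) <;> (try split_ifs) <;> (try omega)

theorem doubleLetter_stats_succ (i : ℕ) (x : ℤ) :
    eps OType.D (i + 2) (doubleLetter x) = 2 * letterEps OType.B (i + 1) x ∧
    phi OType.D (i + 2) (doubleLetter x) = 2 * letterPhi OType.B (i + 1) x := by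
  unfold doubleLetter
  split_ifs <;> simp only [eps_cons, phi_cons, eps_nil, phi_nil, letterEps_succ,
    letterPhi_succ] <;> push_cast <;> refine ⟨?_, ?_⟩ <;> split_ifs <;> omega

theorem double_stats_zero (w : List ℤ) :
    eps OType.D 0 (double w) = eps OType.B 0 w ∧
    phi OType.D 0 (double w) = phi OType.B 0 w ∧
    eps OType.D 1 (double w) = eps OType.B 0 w ∧
    phi OType.D 1 (double w) = phi OType.B 0 w := by
  induction w with
  | nil => simp [double]
  | cons x w ih =>
    obtain ⟨h1, h2, h3, h4⟩ := ih
    obtain ⟨k1, k2, k3, k4⟩ := doubleLetter_stats_zero x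
    simp only [double_cons, eps_append, phi_append, eps_cons, phi_cons, *, and_self]

theorem double_stats_succ (i : ℕ) (w : List ℤ) :
    eps OType.D (i + 2) (double w) = 2 * eps OType.B (i + 1) w ∧
    phi OType.D (i + 2) (double w) = 2 * phi OType.B (i + 1) w := by
  induction w with
  | nil => simp [double]
  | cons x w ih =>
    obtain ⟨k1, k2⟩ := doubleLetter_stats_succ i x
    simp only [double_cons, eps_append, phi_append, eps_cons, phi_cons, ih.1, ih.2, k1, k2]
    omega

theorem doubleLetter_letterF_zero {x y : ℤ} (h : letterF OType.B 0 x = some y) :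
    ∃ t, wordF OType.D 1 (doubleLetter x) = some t ∧ phi OType.D 0 t = letterPhi OType.B 0 x ∧
      wordF OType.D 0 t = some (doubleLetter y) := by
  rw [letterF_B_zero] at h
  split_ifs at h with h1 h2 <;> simp only [Option.some.injEq] at h <;> subst h
  · subst h1
    exact ⟨[-1, -2], by decide, by decide, by decide⟩
  · subst h2
    exact ⟨[2, -1], by decide, by decide, by decide⟩

theorem doubleLetter_letterF_succ {i : ℕ} {x y : ℤ} (h : letterF OType.B (i + 1) x = some y) :
    ∃ t, wordF OType.D (i + 2) (doubleLetter x) = some t ∧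
      phi OType.D (i + 2) t = 1 ∧
      wordF OType.D (i + 2) t = some (doubleLetter y) := by
  rw [letterF_succ] at h
  split_ifs at h with h1
  simp only [Option.some.injEq] at h
  subst h
  rcases h1 with rfl | rfl
  · have e1 : doubleLetter (-((i : ℤ) + 2)) = [-((i : ℤ) + 3), -((i : ℤ) + 3)] := by
      unfold doubleLetter
      rw [if_neg (by omega), if_pos (by omega)]
      simp only [List.cons.injEq, and_true]; omega
    have e2 : doubleLetter (-((i : ℤ) + 2) + 1) = [-((i : ℤ) + 2), -((i : ℤ) + 2)] := by
      unfold doubleLetter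
      rw [if_neg (by omega), if_pos (by omega)]
      simp only [List.cons.injEq, and_true]; omega
    rw [e1, e2]
    refine ⟨[-((i : ℤ) + 2), -((i : ℤ) + 3)], wordF_cons_some.mpr (Or.inl ⟨?_, _, ?_, rfl⟩), ?_,
      wordF_cons_some.mpr (Or.inr ⟨?_, [-((i : ℤ) + 2)], wordF_letter ?_ ?_, rfl⟩)⟩ <;>
    simp only [phi_cons, eps_cons, eps_nil, phi_nil, letterPhi_succ, letterEps_succ,
      letterF_succ] <;> push_cast <;> split_ifs <;> first | omega | (simp only [Option.some.injEq, List.cons.injEq, and_true]; omega)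
  · have e1 : doubleLetter ((i : ℤ) + 1) = [(i : ℤ) + 2, (i : ℤ) + 2] := by
      unfold doubleLetter
      rw [if_pos (by omega)]
      simp only [List.cons.injEq, and_true]; omega
    have e2 : doubleLetter ((i : ℤ) + 1 + 1) = [(i : ℤ) + 3, (i : ℤ) + 3] := by
      unfold doubleLetter
      rw [if_pos (by omega)]
      simp only [List.cons.injEq, and_true]; omega
    rw [e1, e2]
    refine ⟨[(i : ℤ) + 3, (i : ℤ) + 2], wordF_cons_some.mpr (Or.inl ⟨?_, _, ?_, rfl⟩), ?_,
      wordF_cons_some.mpr (Or.inr ⟨?_, [(i : ℤ) + 3], wordF_letter ?_ ?_, rfl⟩)⟩ <;>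
    simp only [phi_cons, eps_cons, eps_nil, phi_nil, letterPhi_succ, letterEps_succ,
      letterF_succ] <;> push_cast <;> split_ifs <;> first | omega | (simp only [Option.some.injEq, List.cons.injEq, and_true]; omega)

theorem wordF_append_left {X : OType} {i : ℕ} {u u' v : List ℤ} (h : eps X i v < phi X i u)
    (hu : wordF X i u = some u') : wordF X i (u ++ v) = some (u' ++ v) :=
  (wordF_append _ _ _).mpr (Or.inl ⟨h, u', hu, rfl⟩)

theorem wordF_append_right {X : OType} {i : ℕ} {u v v' : List ℤ} (h : phi X i u ≤ eps X i v)
    (hv : wordF X i v = some v') : wordF X i (u ++ v) = some (u ++ v') :=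
  (wordF_append _ _ _).mpr (Or.inr ⟨h, v', hv, rfl⟩)

theorem commutingColours_D_one_zero : CommutingColours OType.D 1 0 := by
  rcases simplyLaced_D 1 0 (by decide) with h | h
  · exfalso
    have := h (-2)
    simp only [LetterState, letterPhi_succ OType.D 0, letterEps_succ OType.D 0, letterPhi_D_zero,
      letterEps_D_zero] at this
    norm_num at this
  · exact h.1

theorem double_wordF_zero {w v : List ℤ} (h : wordF OType.B 0 w = some v) :
    ∃ t, wordF OType.D 1 (double w) = some t ∧ wordF OType.D 0 t = some (double v) := by
  induction w generalizing v with
  | nil => simp [wordF] at h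
  | cons x w ih =>
    obtain ⟨s1, s2, s3, s4⟩ := double_stats_zero w
    obtain ⟨k1, k2, k3, k4⟩ := doubleLetter_stats_zero x
    rcases wordF_cons_some.mp h with ⟨h1, y, hy, rfl⟩ | ⟨h1, u, hu, rfl⟩
    · obtain ⟨t, ht, ht', ht''⟩ := doubleLetter_letterF_zero hy
      rw [double_cons, double_cons]
      refine ⟨t ++ double w, wordF_append_left ?_ ht, wordF_append_left ?_ ht''⟩ <;> omega
    · obtain ⟨t, ht, ht'⟩ := ih hu
      have := commutingColours_D_one_zero.eps_eq ht
      rw [double_cons, double_cons]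
      refine ⟨doubleLetter x ++ t, wordF_append_right ?_ ht, wordF_append_right ?_ ht'⟩ <;> omega

theorem double_wordF_succ {i : ℕ} {w v : List ℤ} (h : wordF OType.B (i + 1) w = some v) :
    ∃ t, wordF OType.D (i + 2) (double w) = some t ∧
      wordF OType.D (i + 2) t = some (double v) := by
  induction w generalizing v with
  | nil => simp [wordF] at h
  | cons x w ih =>
    obtain ⟨s1, s2⟩ := double_stats_succ i w
    obtain ⟨k1, k2⟩ := doubleLetter_stats_succ i x
    rcases wordF_cons_some.mp h with ⟨h1, y, hy, rfl⟩ | ⟨h1, u, hu, rfl⟩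
    · obtain ⟨t, ht, ht', ht''⟩ := doubleLetter_letterF_succ hy
      have hx : letterPhi OType.B (i + 1) x ≤ 1 := by rw [letterPhi_succ]; split_ifs <;> omega
      rw [double_cons, double_cons]
      refine ⟨t ++ double w, wordF_append_left ?_ ht, wordF_append_left ?_ ht''⟩ <;> omega
    · obtain ⟨t, ht, ht'⟩ := ih hu
      have := wordF_spec ht
      rw [double_cons, double_cons]
      refine ⟨doubleLetter x ++ t, wordF_append_right ?_ ht, wordF_append_right ?_ ht'⟩ <;> omega

theorem double_injective : Function.Injective double := by
  have key : ∀ x y : ℤ, ∀ u v : List ℤ, doubleLetter x ++ u = doubleLetter y ++ v →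
      x = y ∧ u = v := by
    intro x y u v h
    unfold doubleLetter at h
    split_ifs at h <;> simp only [List.cons_append, List.nil_append, List.cons.injEq] at h <;>
      refine ⟨by omega, by tauto⟩
  intro w
  induction w with
  | nil =>
    intro w' h
    cases w' with
    | nil => rfl
    | cons y w' =>
      exfalso
      have := congrArg List.length h
      simp only [double_cons, List.length_append] at this
      unfold doubleLetter at this
      split_ifs at this <;> simp [double] at this <;> omega
  | cons x w ih =>
    intro w' h
    cases w' with
    | nil =>
      exfalso
      have := congrArg List.length h
      simp only [double_cons, List.length_append] at this
      unfold doubleLetter at this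
      split_ifs at this <;> simp [double] at this
    | cons y w' =>
      obtain ⟨rfl, h'⟩ := key _ _ _ _ h
      rw [ih h']

theorem double_stats_eq {a b : List ℤ} {m : ℕ} (h : Sim OType.D (m + 1) (double a) (double b))
    {i : ℕ} (hi : i < m) : eps OType.B i a = eps OType.B i b ∧ phi OType.B i a = phi OType.B i b := by
  rcases i with _ | i
  · have h1 := h.eps_eq (show 0 < m + 1 by omega)
    have h2 := h.phi_eq (show 0 < m + 1 by omega)
    rw [(double_stats_zero a).1, (double_stats_zero b).1] at h1
    rw [(double_stats_zero a).2.1, (double_stats_zero b).2.1] at h2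
    exact ⟨h1, h2⟩
  · have h1 := h.eps_eq (show i + 2 < m + 1 by omega)
    have h2 := h.phi_eq (show i + 2 < m + 1 by omega)
    rw [(double_stats_succ i a).1, (double_stats_succ i b).1] at h1
    rw [(double_stats_succ i a).2, (double_stats_succ i b).2] at h2
    omega

/-- An arrow of type `B` gives a path of two arrows of type `D`. -/
theorem double_wordF {i m : ℕ} (hi : i < m) : ∃ j k, j < m + 1 ∧ k < m + 1 ∧
    ∀ w v, wordF OType.B i w = some v →
      ∃ t, wordF OType.D j (double w) = some t ∧ wordF OType.D k t = some (double v) := by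
  rcases i with _ | i
  · exact ⟨1, 0, by omega, by omega, fun w v h => double_wordF_zero h⟩
  · exact ⟨i + 2, i + 2, by omega, by omega, fun w v h => double_wordF_succ h⟩

/-- Bisimilarity of the doubled words is itself a bisimulation in type `B`, since an arrow of type
`B` is a path of two arrows of type `D` whose colours depend only on its own colour. -/
theorem sim_of_double {a b : List ℤ} {m : ℕ} (h : Sim OType.D (m + 1) (double a) (double b)) :
    Sim OType.B m a b := by
  refine ⟨fun a b => Sim OType.D (m + 1) (double a) (double b), ?_, h⟩
  intro a b h i hi
  obtain ⟨h1, h2⟩ := double_stats_eq h hi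
  obtain ⟨j, k, hj, hk, hjk⟩ := double_wordF hi
  refine ⟨h1, h2, fun a' ha' => ?_, fun a' ha' => ?_⟩
  · obtain ⟨b', hb'⟩ := exists_wordF (X := OType.B) (i := i) (w := b) (by
      rw [← h2]; exact phi_pos_of_wordF ha')
    refine ⟨b', hb', ?_⟩
    obtain ⟨t, h3, h4⟩ := hjk _ _ ha'
    obtain ⟨t', h5, h6⟩ := hjk _ _ hb'
    obtain ⟨t'', h7, h8⟩ := h.lower hj h3
    obtain rfl := Option.some.inj (h5.symm.trans h7)
    obtain ⟨c, h9, h10⟩ := h8.lower hk h4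
    rwa [Option.some.inj (h6.symm.trans h9)]
  · obtain ⟨b', hb'⟩ := exists_wordF_eq (X := OType.B) (i := i) (v := b) (by
      rw [← h1]; exact eps_pos_of_wordF ha')
    refine ⟨b', hb', ?_⟩
    obtain ⟨t, h3, h4⟩ := hjk _ _ ha'
    obtain ⟨t', h5, h6⟩ := hjk _ _ hb'
    obtain ⟨t'', h7, h8⟩ := h.raise hk h4
    obtain rfl := wordF_inj h6 h7
    obtain ⟨c, h9, h10⟩ := h8.raise hj h3
    rwa [wordF_inj h5 h9]

theorem connected_double {a b : List ℤ} {m : ℕ} (h : Connected OType.B m a b) :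
    Connected OType.D (m + 1) (double a) (double b) := by
  induction h with
  | rel a b hab =>
    obtain ⟨i, hi, hab⟩ := hab
    obtain ⟨j, k, hj, hk, hjk⟩ := double_wordF hi
    obtain ⟨t, h1, h2⟩ := hjk _ _ hab
    exact (Relation.EqvGen.rel _ _ ⟨j, hj, h1⟩).trans _ _ _ (Relation.EqvGen.rel _ _ ⟨k, hk, h2⟩)
  | refl a => exact .refl _
  | symm a b _ ih => exact ih.symm
  | trans a b c _ _ ih1 ih2 => exact ih1.trans _ _ _ ih2

theorem IsSource.double {w : List ℤ} {m : ℕ} (h : IsSource OType.B m w) (hm : 0 < m) :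
    IsSource OType.D (m + 1) (double w) := by
  intro i hi
  match i with
  | 0 => rw [(double_stats_zero w).1, h 0 hm]
  | 1 => rw [(double_stats_zero w).2.2.1, h 0 hm]
  | i + 2 => rw [(double_stats_succ i w).1, h (i + 1) (by omega)]

/-! ### Sources -/

variable {X : OType} {m : ℕ}

theorem sim_zero (a b : List ℤ) : Sim X 0 a b :=
  ⟨fun _ _ => True, fun _ _ _ i hi => by omega, trivial⟩

theorem connected_zero {a b : List ℤ} (h : Connected X 0 a b) : a = b := by
  induction h with
  | rel a b hab => obtain ⟨i, hi, -⟩ := hab; omega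
  | refl => rfl
  | symm _ _ _ ih => exact ih.symm
  | trans _ _ _ _ _ ih1 ih2 => exact ih1.trans ih2

/-- Components with highest weight vertices of the same weight are isomorphic. -/
theorem sim_of_sources {v v' : List ℤ} (hv : IsSource X m v)
    (hv' : IsSource X m v') (hφ : ∀ i < m, phi X i v = phi X i v') : Sim X m v v' := by
  cases X with
  | D => exact sim_of_sources_of_simplyLaced simplyLaced_D hv hv' hφ
  | B =>
    rcases Nat.eq_zero_or_pos m with rfl | hm
    · exact sim_zero _ _
    refine sim_of_double (sim_of_sources_of_simplyLaced simplyLaced_D (hv.double hm)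
      (hv'.double hm) ?_)
    intro i hi
    match i with
    | 0 => rw [(double_stats_zero v).2.1, (double_stats_zero v').2.1, hφ 0 hm]
    | 1 => rw [(double_stats_zero v).2.2.2, (double_stats_zero v').2.2.2, hφ 0 hm]
    | i + 2 => rw [(double_stats_succ i v).2, (double_stats_succ i v').2, hφ (i + 1) (by omega)]

/-- A component contains at most one highest weight vertex. -/
theorem source_unique {v v' : List ℤ} (hv : IsSource X m v)
    (hv' : IsSource X m v') (h : Connected X m v v') : v = v' := by
  cases X with
  | D => exact source_unique_of_simplyLaced simplyLaced_D hv hv' h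
  | B =>
    rcases Nat.eq_zero_or_pos m with rfl | hm
    · exact connected_zero h
    exact double_injective (source_unique_of_simplyLaced simplyLaced_D (hv.double hm)
      (hv'.double hm) (connected_double h))

/-- `b` is obtained from `a` by raising operators with colours in `J`. -/
def Raises (X : OType) (J : ℕ → Prop) : List ℤ → List ℤ → Prop :=
  Relation.ReflTransGen (fun a b => ∃ i, J i ∧ wordF X i b = some a)

theorem letterF_lt {i : ℕ} {x y : ℤ} (h : letterF X i x = some y) : x < y := by
  rcases i with _ | i
  · cases X
    · rw [letterF_B_zero] at h
      split_ifs at h <;> simp only [Option.some.injEq] at h <;> omega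
    · rw [letterF_D_zero] at h
      split_ifs at h <;> simp only [Option.some.injEq] at h <;> omega
  · rw [letterF_succ] at h
    split_ifs at h
    simp only [Option.some.injEq] at h
    omega

theorem letterF_ge {i : ℕ} {x y : ℤ} (h : letterF X i x = some y) : -((i : ℤ) + 2) ≤ x := by
  rcases i with _ | i
  · cases X
    · rw [letterF_B_zero] at h
      split_ifs at h <;> omega
    · rw [letterF_D_zero] at h
      split_ifs at h <;> omega
  · rw [letterF_succ] at h
    split_ifs at h
    push_cast
    omega

/-- Raising operators can be applied until they all vanish. -/
theorem exists_raises (X : OType) {J : ℕ → Prop} {m : ℕ} (hJ : ∀ i, J i → i < m) (w : List ℤ) :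
    ∃ s, Raises X J w s ∧ ∀ i, J i → eps X i s = 0 := by
  -- With `m + 2 ≤ K`, letters produced by raising operators of colours below `m` stay at least
  -- `-K`. The sum of the natural numbers `x + K` then decreases strictly at each raising.
  obtain ⟨K, hK, hKw⟩ : ∃ K : ℕ, m + 2 ≤ K ∧ ∀ x ∈ w, -(K : ℤ) ≤ x := by
    induction w with
    | nil => exact ⟨m + 2, le_rfl, by simp⟩
    | cons x w ih =>
      obtain ⟨K, h1, h2⟩ := ih
      refine ⟨K + x.natAbs, by omega, fun y hy => ?_⟩
      rcases List.mem_cons.mp hy with rfl | hy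
      · omega
      · have := h2 y hy; omega
  obtain ⟨n, hn⟩ : ∃ n, n = (w.map (fun x : ℤ => (x + (K : ℤ)).toNat)).sum := ⟨_, rfl⟩
  induction n using Nat.strong_induction_on generalizing w with
  | _ n ih =>
    by_cases hs : ∀ i, J i → eps X i w = 0
    · exact ⟨w, .refl, hs⟩
    · push Not at hs
      obtain ⟨i, hi, he⟩ := hs
      obtain ⟨v, hv⟩ := exists_wordF_eq (Nat.pos_of_ne_zero he)
      obtain ⟨a, b, x, y, rfl, rfl, hl⟩ := wordF_change hv
      have h1 := letterF_lt hl
      have h2 := letterF_ge hl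
      have h3 := hJ i hi
      obtain ⟨s, hs1, hs2⟩ := ih _ (by
        rw [hn]
        simp only [List.map_append, List.map_cons, List.sum_append, List.sum_cons]
        have : (x + K).toNat < (y + K).toNat := by omega
        omega) (a ++ x :: b) (by
          intro z hz
          simp only [List.mem_append, List.mem_cons] at hz hKw
          rcases hz with hz | rfl | hz
          · exact hKw z (Or.inl hz)
          · omega
          · exact hKw z (Or.inr (Or.inr hz))) rfl
      exact ⟨s, Relation.ReflTransGen.head ⟨i, hi, hv⟩ hs1, hs2⟩

theorem Raises.connected {J : ℕ → Prop} (hJ : ∀ i, J i → i < m) {a b : List ℤ}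
    (h : Raises X J a b) : Connected X m a b := by
  induction h with
  | refl => exact .refl _
  | tail _ h1 ih =>
    obtain ⟨i, hi, h2⟩ := h1
    exact ih.trans _ _ _ (.symm _ _ (.rel _ _ ⟨i, hJ i hi, h2⟩))

theorem Sim.raises {J : ℕ → Prop} (hJ : ∀ i, J i → i < m) {a b a' : List ℤ} (h : Sim X m a b)
    (ha : Raises X J a a') : ∃ b', Raises X J b b' ∧ Sim X m a' b' := by
  induction ha with
  | refl => exact ⟨b, .refl, h⟩
  | tail _ h1 ih =>
    obtain ⟨i, hi, h2⟩ := h1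
    obtain ⟨b', hb', hs⟩ := ih
    obtain ⟨b'', h3, h4⟩ := hs.raise (hJ i hi) h2
    exact ⟨b'', hb'.tail ⟨i, hi, h3⟩, h4⟩

theorem Sim.isSource {a b : List ℤ} (h : Sim X m a b) (ha : IsSource X m a) : IsSource X m b :=
  fun i hi => by rw [← h.eps_eq hi, ha i hi]

/-- Every word is obtained by lowering operators from the source of its component. -/
theorem exists_source (X : OType) (m : ℕ) (w : List ℤ) :
    ∃ s, Raises X (· < m) w s ∧ IsSource X m s :=
  exists_raises X (fun _ h => h) w

theorem raises_of_connected {w s : List ℤ} (h : Connected X m w s) (hs : IsSource X m s) :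
    Raises X (· < m) w s := by
  obtain ⟨s', h1, h2⟩ := exists_source X m w
  have := source_unique hs h2 (h.symm.trans _ _ _ (h1.connected (fun _ h => h)))
  rwa [this]

/-- Both words are raised in parallel until they are sources of one component, hence equal; the
lowering operators being single valued, the way back down gives equal words. -/
theorem Sim.connected_raise {a b : List ℤ} (h : Sim X m a b) (hab : Connected X m a b) : a = b := by
  obtain ⟨s, h1, h2⟩ := exists_source X m a
  obtain ⟨t, ht⟩ : ∃ t, t = a := ⟨a, rfl⟩
  have key : ∀ s, Raises X (· < m) a s → ∃ s', Raises X (· < m) b s' ∧ Sim X m s s' ∧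
      (s = s' → a = b) := by
    intro s hs
    induction hs with
    | refl => exact ⟨b, .refl, h, id⟩
    | tail _ h1 ih =>
      obtain ⟨i, hi, h2⟩ := h1
      obtain ⟨b', hb', hs, he⟩ := ih
      obtain ⟨b'', h3, h4⟩ := hs.raise hi h2
      refine ⟨b'', hb'.tail ⟨i, hi, h3⟩, h4, fun e => he ?_⟩
      subst e
      exact Option.some.inj (h2.symm.trans h3)
  obtain ⟨s', h3, h4, h5⟩ := key s h1
  refine h5 (source_unique h2 (h4.isSource h2) ?_)
  exact ((h1.connected (fun _ h => h)).symm.trans _ _ _ hab).trans _ _ _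
    (h3.connected (fun _ h => h))

/-! ### Bisimilarity and isomorphisms of components -/

/-- An isomorphism of coloured graphs preserves the lengths of strings, hence `ε` and `φ`, so its
graph is a bisimulation. -/
theorem Equivalent.sim {a b : List ℤ} (h : Equivalent X m a b) : Sim X m a b := by
  obtain ⟨f, hf, hc⟩ := h
  have low : ∀ i < m, ∀ x : Component X m a, ∀ u, wordF X i x.1 = some u →
      ∃ y : Component X m a, y.1 = u ∧ wordF X i (f x).1 = some (f y).1 := by
    intro i hi x u hu
    have hcon : Connected X m a u := x.2.trans _ _ _ (.rel _ _ ⟨i, hi, hu⟩)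
    exact ⟨⟨u, hcon⟩, rfl, (hc i hi x ⟨u, hcon⟩).mp hu⟩
  have low' : ∀ i < m, ∀ x : Component X m a, ∀ u, wordF X i (f x).1 = some u →
      ∃ y : Component X m a, (f y).1 = u ∧ wordF X i x.1 = some y.1 := by
    intro i hi x u hu
    have hcon : Connected X m b u := (f x).2.trans _ _ _ (.rel _ _ ⟨i, hi, hu⟩)
    refine ⟨f.symm ⟨u, hcon⟩, by simp, (hc i hi x _).mpr ?_⟩
    simpa using hu
  have up : ∀ i < m, ∀ x : Component X m a, ∀ u, wordF X i u = some x.1 →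
      ∃ y : Component X m a, y.1 = u ∧ wordF X i (f y).1 = some (f x).1 := by
    intro i hi x u hu
    have hcon : Connected X m a u := x.2.trans _ _ _ (.symm _ _ (.rel _ _ ⟨i, hi, hu⟩))
    exact ⟨⟨u, hcon⟩, rfl, (hc i hi ⟨u, hcon⟩ x).mp hu⟩
  have up' : ∀ i < m, ∀ x : Component X m a, ∀ u, wordF X i u = some (f x).1 →
      ∃ y : Component X m a, (f y).1 = u ∧ wordF X i y.1 = some x.1 := by
    intro i hi x u hu
    have hcon : Connected X m b u := (f x).2.trans _ _ _ (.symm _ _ (.rel _ _ ⟨i, hi, hu⟩))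
    refine ⟨f.symm ⟨u, hcon⟩, by simp, (hc i hi _ x).mpr ?_⟩
    simpa using hu
  have hphi : ∀ i < m, ∀ n, ∀ x : Component X m a, phi X i x.1 = n → phi X i (f x).1 = n := by
    intro i hi n
    induction n with
    | zero =>
      intro x hx
      by_contra hcon
      obtain ⟨u, hu⟩ := exists_wordF (Nat.pos_of_ne_zero hcon)
      obtain ⟨y, -, hy⟩ := low' i hi x u hu
      have := phi_pos_of_wordF hy
      omega
    | succ n ih =>
      intro x hx
      obtain ⟨u, hu⟩ := exists_wordF (X := X) (i := i) (w := x.1) (by omega)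
      obtain ⟨y, hy, hy'⟩ := low i hi x u hu
      have h1 := wordF_spec hu
      have h2 := wordF_spec hy'
      have h3 := ih y (by rw [hy]; omega)
      omega
  have heps : ∀ i < m, ∀ n, ∀ x : Component X m a, eps X i x.1 = n → eps X i (f x).1 = n := by
    intro i hi n
    induction n with
    | zero =>
      intro x hx
      by_contra hcon
      obtain ⟨u, hu⟩ := exists_wordF_eq (Nat.pos_of_ne_zero hcon)
      obtain ⟨y, -, hy⟩ := up' i hi x u hu
      have := eps_pos_of_wordF hy
      omega
    | succ n ih =>
      intro x hx
      obtain ⟨u, hu⟩ := exists_wordF_eq (X := X) (i := i) (v := x.1) (by omega)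
      obtain ⟨y, hy, hy'⟩ := up i hi x u hu
      have h1 := wordF_spec hu
      have h2 := wordF_spec hy'
      have h3 := ih y (by rw [hy]; omega)
      omega
  refine ⟨fun u v => ∃ x : Component X m a, x.1 = u ∧ (f x).1 = v, ?_, _, rfl, hf⟩
  rintro _ _ ⟨x, rfl, rfl⟩ i hi
  refine ⟨(heps i hi _ x rfl).symm, (hphi i hi _ x rfl).symm, fun u hu => ?_, fun u hu => ?_⟩
  · obtain ⟨y, h1, h2⟩ := low i hi x u hu
    exact ⟨_, h2, y, h1, rfl⟩
  · obtain ⟨y, h1, h2⟩ := up i hi x u hu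
    exact ⟨_, h2, y, h1, rfl⟩

theorem Sim.exists_connected {a b : List ℤ} (h : Sim X m a b) {a' : List ℤ}
    (ha : Connected X m a a') : ∃ b', Connected X m b b' ∧ Sim X m a' b' := by
  have key : ∀ x y, Connected X m x y →
      ((∃ z, Connected X m b z ∧ Sim X m x z) ↔ ∃ z, Connected X m b z ∧ Sim X m y z) := by
    intro x y hxy
    induction hxy with
    | rel x y hxy =>
      obtain ⟨i, hi, hxy⟩ := hxy
      constructor
      · rintro ⟨z, hz, hs⟩
        obtain ⟨z', h1, h2⟩ := hs.lower hi hxy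
        exact ⟨z', hz.trans _ _ _ (.rel _ _ ⟨i, hi, h1⟩), h2⟩
      · rintro ⟨z, hz, hs⟩
        obtain ⟨z', h1, h2⟩ := hs.raise hi hxy
        exact ⟨z', hz.trans _ _ _ (.symm _ _ (.rel _ _ ⟨i, hi, h1⟩)), h2⟩
    | refl => exact Iff.rfl
    | symm _ _ _ ih => exact ih.symm
    | trans _ _ _ _ _ ih1 ih2 => exact ih1.trans ih2
  exact (key _ _ ha).mp ⟨b, .refl _, h⟩

/-- Each word of one component has a bisimilar partner in the other, unique by
`Sim.connected_raise`; the choice of partners is the isomorphism. -/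
theorem Sim.equivalent {a b : List ℤ} (h : Sim X m a b) : Equivalent X m a b := by
  choose f hf using fun x : Component X m a => h.exists_connected x.2
  choose g hg using fun y : Component X m b => h.symm.exists_connected y.2
  have hfu : ∀ (x : Component X m a) (z : List ℤ), Connected X m b z → Sim X m x.1 z → z = f x :=
    fun x z hz hs => (hs.symm.trans (hf x).2).connected_raise (hz.symm.trans _ _ _ (hf x).1)
  have hgu : ∀ (y : Component X m b) (z : List ℤ), Connected X m a z → Sim X m y.1 z → z = g y :=
    fun x z hz hs => (hs.symm.trans (hg x).2).connected_raise (hz.symm.trans _ _ _ (hg x).1)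
  refine ⟨⟨fun x => ⟨f x, (hf x).1⟩, fun y => ⟨g y, (hg y).1⟩, fun x => ?_, fun y => ?_⟩, ?_, ?_⟩
  · exact Subtype.ext (hgu ⟨f x, (hf x).1⟩ x.1 x.2 (hf x).2.symm).symm
  · exact Subtype.ext (hfu ⟨g y, (hg y).1⟩ y.1 y.2 (hg y).2.symm).symm
  · exact (hfu _ b (.refl _) h).symm
  · intro i hi x y
    constructor
    · intro hxy
      obtain ⟨z, h1, h2⟩ := (hf x).2.lower hi hxy
      have := hfu y z ((hf x).1.trans _ _ _ (.rel _ _ ⟨i, hi, h1⟩)) h2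
      rw [this] at h1
      exact h1
    · intro hxy
      obtain ⟨z, h1, h2⟩ := (hf x).2.symm.lower hi hxy
      have e1 := hgu ⟨f y, (hf y).1⟩ z (x.2.trans _ _ _ (.rel _ _ ⟨i, hi, h1⟩)) h2
      have e2 := hgu ⟨f y, (hf y).1⟩ y.1 y.2 (hf y).2.symm
      rw [e1, ← e2] at h1
      exact h1

end OrthogonalTableaux

/-! ### Columns, barred words, and words free of contraction -/

namespace OrthogonalTableaux

section Columns
variable {X : OType} {m M : ℕ}

/-! ### Columns -/

/-- `y` can stand just below `x` in a column. -/
def Desc : OType → ℤ → ℤ → Prop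
  | OType.B, x, y => x < y ∨ (x = 0 ∧ y = 0)
  | OType.D, x, y => x ≠ 0 ∧ y ≠ 0 ∧ (x < y ∨ (x = 1 ∧ y = -1))

theorem desc_iff_of_left {i : ℕ} {x x' y : ℤ} (h : letterF X i x = some x')
    (hy : letterEps X i y < letterPhi X i x) : Desc X x y ↔ Desc X x' y := by
  rcases i with _ | i
  · cases X
    · rw [letterF_B_zero] at h
      rw [letterEps_B_zero, letterPhi_B_zero] at hy
      simp only [Desc]
      split_ifs at h hy <;> simp only [Option.some.injEq, reduceCtorEq] at h <;> omega
    · rw [letterF_D_zero] at h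
      rw [letterEps_D_zero, letterPhi_D_zero] at hy
      simp only [Desc]
      split_ifs at h hy <;> simp only [Option.some.injEq, reduceCtorEq] at h <;> omega
  · rw [letterF_succ] at h
    rw [letterEps_succ, letterPhi_succ] at hy
    split_ifs at h with h1
    simp only [Option.some.injEq] at h
    cases X <;> simp only [Desc] <;> split_ifs at hy <;> omega

theorem desc_iff_of_right {i : ℕ} {x y y' : ℤ} (h : letterF X i y = some y')
    (hx : letterPhi X i x ≤ letterEps X i y) : Desc X x y ↔ Desc X x y' := by
  rcases i with _ | i
  · cases X
    · rw [letterF_B_zero] at h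
      rw [letterEps_B_zero, letterPhi_B_zero] at hx
      simp only [Desc]
      split_ifs at h hx <;> simp only [Option.some.injEq, reduceCtorEq] at h <;> omega
    · rw [letterF_D_zero] at h
      rw [letterEps_D_zero, letterPhi_D_zero] at hx
      simp only [Desc]
      split_ifs at h hx <;> simp only [Option.some.injEq, reduceCtorEq] at h <;> omega
  · rw [letterF_succ] at h
    rw [letterEps_succ, letterPhi_succ] at hx
    split_ifs at h with h1
    simp only [Option.some.injEq] at h
    cases X <;> simp only [Desc] <;> split_ifs at hx <;> omega

/-- The words whose consecutive letters can be stacked in a column. -/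
abbrev ColumnWord (X : OType) (w : List ℤ) : Prop := w.IsChain (Desc X)

/-- The condition concerns consecutive letters only, and the signature rule lets `f_i` change a
letter only where its relation to both neighbours is preserved. Column words are thus a union of
components, on which the source can be examined. -/
theorem columnWord_wordF {i : ℕ} {w w' : List ℤ} (h : wordF X i w = some w') :
    ColumnWord X w ↔ ColumnWord X w' := by
  induction w generalizing w' with
  | nil => simp [wordF] at h
  | cons x w ih =>
    rcases wordF_cons_some.mp h with ⟨h1, y, hy, rfl⟩ | ⟨h1, u, hu, rfl⟩
    · cases w with
      | nil => simp [ColumnWord]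
      | cons z w =>
        simp only [ColumnWord, List.isChain_cons_cons]
        rw [eps_cons] at h1
        rw [desc_iff_of_left hy (by omega)]
    · cases w with
      | nil => simp [wordF] at hu
      | cons z w =>
        rcases wordF_cons_some.mp hu with ⟨h2, y, hy, rfl⟩ | ⟨h2, u', hu', rfl⟩
        · have := ih hu
          simp only [ColumnWord, List.isChain_cons_cons] at this ⊢
          rw [eps_cons] at h1
          rw [desc_iff_of_right hy (by omega)]
          simp only [this]
        · have := ih hu
          simp only [ColumnWord, List.isChain_cons_cons] at this ⊢
          simp only [this]

theorem columnWord_connected {w w' : List ℤ} (h : Connected X m w w') :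
    ColumnWord X w ↔ ColumnWord X w' := by
  induction h with
  | rel a b hab => obtain ⟨i, -, h⟩ := hab; exact columnWord_wordF h
  | refl => rfl
  | symm _ _ _ ih => exact ih.symm
  | trans _ _ _ _ _ ih1 ih2 => exact ih1.trans ih2

/-! ### Connected words -/

theorem Connected.mono {m' : ℕ} (hm : m ≤ m') {w w' : List ℤ} (h : Connected X m w w') :
    Connected X m' w w' := by
  refine Relation.EqvGen.mono (fun a b => ?_) _ _ h
  rintro ⟨i, hi, h⟩
  exact ⟨i, by omega, h⟩

theorem Raises.length_eq {J : ℕ → Prop} {a b : List ℤ} (h : Raises X J a b) :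
    b.length = a.length := by
  induction h with
  | refl => rfl
  | tail _ h1 ih => obtain ⟨i, -, h2⟩ := h1; rw [← ih, wordF_length h2]

/-- Raising operators act on a product through its factors. -/
theorem Raises.append {J : ℕ → Prop} {u v s : List ℤ} (h : Raises X J (u ++ v) s) :
    ∃ u' v', s = u' ++ v' ∧ Raises X J u u' ∧ Raises X J v v' := by
  induction h with
  | refl => exact ⟨u, v, rfl, .refl, .refl⟩
  | tail _ h1 ih =>
    obtain ⟨i, hi, h2⟩ := h1
    obtain ⟨u', v', rfl, hu, hv⟩ := ih
    rcases wordF_eq_append.mp h2 with ⟨-, u'', hu'', rfl⟩ | ⟨-, v'', hv'', rfl⟩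
    · exact ⟨u'', v', rfl, hu.tail ⟨i, hi, hu''⟩, hv⟩
    · exact ⟨u', v'', rfl, hu, hv.tail ⟨i, hi, hv''⟩⟩

theorem letterF_inAlphabet (hX : ValidRank X m) {i : ℕ} (hi : i < m) {x y : ℤ}
    (h : letterF X i x = some y) : InAlphabet X m x ∧ InAlphabet X m y := by
  rcases i with _ | i
  · cases X
    · rw [letterF_B_zero] at h
      simp only [InAlphabet, abs_le]
      split_ifs at h <;> simp only [Option.some.injEq, reduceCtorEq] at h <;> omega
    · rw [letterF_D_zero] at h
      simp only [InAlphabet, ValidRank, abs_le] at hX ⊢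
      split_ifs at h <;> simp only [Option.some.injEq, reduceCtorEq] at h <;> omega
  · rw [letterF_succ] at h
    split_ifs at h with h1
    simp only [Option.some.injEq] at h
    cases X <;> simp only [InAlphabet, abs_le] <;> omega

theorem wordF_inAlphabet (hX : ValidRank X m) {i : ℕ} (hi : i < m) {w v : List ℤ}
    (h : wordF X i w = some v) : (∀ x ∈ w, InAlphabet X m x) ↔ ∀ x ∈ v, InAlphabet X m x := by
  obtain ⟨a, b, x, y, rfl, rfl, hl⟩ := wordF_change h
  obtain ⟨h1, h2⟩ := letterF_inAlphabet hX hi hl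
  simp only [List.mem_append, List.mem_cons, or_imp, forall_and, forall_eq, h1, h2]

theorem connected_inAlphabet (hX : ValidRank X m) {w v : List ℤ}
    (h : Connected X m w v) : (∀ x ∈ w, InAlphabet X m x) ↔ ∀ x ∈ v, InAlphabet X m x := by
  induction h with
  | rel a b hab => obtain ⟨i, hi, h⟩ := hab; exact wordF_inAlphabet hX hi h
  | refl => rfl
  | symm _ _ _ ih => exact ih.symm
  | trans _ _ _ _ _ ih1 ih2 => exact ih1.trans ih2

theorem InAlphabet.mono {m' : ℕ} (hm : m ≤ m') {x : ℤ} (h : InAlphabet X m x) :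
    InAlphabet X m' x := by
  cases X <;> simp only [InAlphabet, abs_le] at h ⊢ <;> omega

theorem exists_letterPhi_pos {i : ℕ} {w : List ℤ} (h : 0 < phi X i w) :
    ∃ x ∈ w, 0 < letterPhi X i x := by
  induction w with
  | nil => simp at h
  | cons x w ih =>
    rw [phi_cons] at h
    by_cases hx : 0 < letterPhi X i x
    · exact ⟨x, by simp, hx⟩
    · obtain ⟨y, hy, hy'⟩ := ih (by omega)
      exact ⟨y, by simp [hy], hy'⟩

theorem exists_letterEps_pos {i : ℕ} {w : List ℤ} (h : 0 < eps X i w) :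
    ∃ x ∈ w, 0 < letterEps X i x := by
  induction w with
  | nil => simp at h
  | cons x w ih =>
    rw [eps_cons] at h
    by_cases hx : 0 < letterEps X i x
    · exact ⟨x, by simp, hx⟩
    · obtain ⟨y, hy, hy'⟩ := ih (by omega)
      exact ⟨y, by simp [hy], hy'⟩

theorem IsSource.left {u v : List ℤ} (h : IsSource X m (u ++ v)) : IsSource X m u := by
  intro i hi
  have := h i hi
  rw [eps_append] at this
  omega

theorem IsSource.append {u v : List ℤ} (hu : IsSource X m u) (hv : IsSource X m v) :
    IsSource X m (u ++ v) := by
  intro i hi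
  rw [eps_append, hu i hi, hv i hi]
  omega

/-! ### Words on the barred letters -/

/-- All the letters of the word are barred letters of rank `M`. -/
def Barred (M : ℕ) (w : List ℤ) : Prop := ∀ x ∈ w, -(M : ℤ) ≤ x ∧ x ≤ -1

theorem Barred.raise {i : ℕ} (hi : i < M) {u v : List ℤ} (hv : Barred M v)
    (h : wordF X i u = some v) : Barred M u := by
  obtain ⟨a, b, x, y, rfl, rfl, hl⟩ := wordF_change h
  have hy := hv y (by simp)
  intro z hz
  simp only [List.mem_append, List.mem_cons] at hz
  rcases hz with hz | rfl | hz
  · exact hv z (by simp [hz])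
  · rcases i with _ | i
    · cases X
      · rw [letterF_B_zero] at hl
        split_ifs at hl <;> simp only [Option.some.injEq, reduceCtorEq] at hl <;> omega
      · rw [letterF_D_zero] at hl
        split_ifs at hl <;> simp only [Option.some.injEq, reduceCtorEq] at hl <;> omega
    · rw [letterF_succ] at hl
      split_ifs at hl with h1
      simp only [Option.some.injEq] at hl
      omega
  · exact hv z (by simp [hz])

theorem Barred.raises {J : ℕ → Prop} (hJ : ∀ i, J i → i < M) {u v : List ℤ} (hv : Barred M v)
    (h : Raises X J v u) : Barred M u := by
  induction h with
  | refl => exact hv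
  | tail _ h1 ih => obtain ⟨i, hi, h2⟩ := h1; exact ih.raise (hJ i hi) h2

theorem letterEps_zero_of_neg {y : ℤ} (hy : y ≤ -1) : letterEps X 0 y = 0 := by
  cases X
  · rw [letterEps_B_zero]; split_ifs <;> omega
  · rw [letterEps_D_zero]; split_ifs <;> omega

/-- The last letter of a barred highest weight word. -/
theorem IsSource.last_barred {v : List ℤ} {y : ℤ} (h : IsSource X M (v ++ [y]))
    (hb : Barred M (v ++ [y])) : y = -(M : ℤ) ∨ y - 1 ∈ v := by
  by_contra hc
  push Not at hc
  obtain ⟨h1, h2⟩ := hc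
  have hy := hb y (by simp)
  obtain ⟨k, hk⟩ : ∃ k : ℕ, y = -((k : ℤ) + 1) := ⟨(-y - 1).toNat, by omega⟩
  have h3 := h (k + 1) (by omega)
  rw [eps_append, eps_singleton, letterEps_succ, if_pos (Or.inr hk)] at h3
  obtain ⟨x, hx, hx'⟩ := exists_letterPhi_pos (X := X) (i := k + 1) (w := v) (by omega)
  have h4 := hb x (by simp [hx])
  rw [letterPhi_succ] at hx'
  split_ifs at hx' with h5
  · have : x = y - 1 := by omega
    exact h2 (this ▸ hx)
  · omega

/-- In such a word every letter other than `-M` is preceded somewhere by the letter just below it,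
so each further position gains at most one. -/
theorem IsSource.barred_le {v : List ℤ} (h : IsSource X M v) (hb : Barred M v) :
    ∀ x ∈ v, x ≤ -(M : ℤ) + v.length - 1 := by
  induction v using List.reverseRecOn with
  | nil => simp
  | append_singleton v y ih =>
    have ih := ih h.left (fun x hx => hb x (by simp [hx]))
    intro x hx
    simp only [List.length_append, List.length_singleton]
    push_cast
    rcases List.mem_append.mp hx with hx | hx
    · have := ih x hx; omega
    · rw [List.mem_singleton] at hx
      subst hx
      rcases h.last_barred hb with h1 | h1
      · omega
      · have := ih _ h1; omega

/-- The highest weight column of height `h`. -/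
def highColumn (M h : ℕ) : List ℤ := (List.range h).map (fun j : ℕ => (j : ℤ) - (M : ℤ))

theorem highColumn_succ (M h : ℕ) : highColumn M (h + 1) = highColumn M h ++ [(h : ℤ) - M] := by
  simp [highColumn, List.range_succ]

@[simp] theorem length_highColumn (M h : ℕ) : (highColumn M h).length = h := by simp [highColumn]

theorem mem_highColumn {M h : ℕ} {x : ℤ} :
    x ∈ highColumn M h ↔ -(M : ℤ) ≤ x ∧ x < (h : ℤ) - M := by
  simp only [highColumn, List.mem_map, List.mem_range]
  constructor
  · rintro ⟨j, hj, rfl⟩; omega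
  · intro hx; exact ⟨(x + M).toNat, by omega, by omega⟩

theorem barred_highColumn {h : ℕ} (hh : h ≤ M) : Barred M (highColumn M h) := by
  intro x hx
  rw [mem_highColumn] at hx
  omega

theorem isSource_highColumn {h : ℕ} (hh : h ≤ M) : IsSource X M (highColumn M h) := by
  induction h with
  | zero => intro i _; simp [highColumn]
  | succ h ih =>
    have ih := ih (by omega)
    intro i hi
    rw [highColumn_succ, eps_append, ih i hi, eps_singleton]
    rcases i with _ | i
    · rw [letterEps_zero_of_neg (by omega)]; omega
    · rw [letterEps_succ]
      split_ifs with h1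
      · obtain ⟨h, rfl⟩ : ∃ h', h = h' + 1 := ⟨h - 1, by omega⟩
        rw [highColumn_succ, phi_append, phi_singleton, letterPhi_succ, if_pos (by omega)]
        omega
      · omega

theorem columnWord_highColumn (M : ℕ) {h : ℕ} (hh : h ≤ M) :
    ColumnWord X (highColumn M h) := by
  induction h with
  | zero => simp [highColumn, ColumnWord]
  | succ h ih =>
    rw [highColumn_succ, ColumnWord, List.isChain_append]
    refine ⟨ih (by omega), by simp, ?_⟩
    intro x hx y hy
    have hx' := mem_highColumn.mp (List.mem_of_mem_getLast? hx)
    simp only [List.head?_cons, Option.mem_def, Option.some.injEq] at hy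
    cases X <;> simp only [Desc] <;> omega

theorem columnWord_source {v : List ℤ} (h : IsSource X M v) (hb : Barred M v)
    (hc : ColumnWord X v) : v = highColumn M v.length := by
  induction v using List.reverseRecOn with
  | nil => simp [highColumn]
  | append_singleton v y ih =>
    have hb' : Barred M v := fun x hx => hb x (by simp [hx])
    have hc' := List.isChain_append.mp hc
    have ih := ih h.left hb' hc'.1
    rw [List.length_append, List.length_singleton, highColumn_succ, ← ih]
    congr 2
    have hy := hb y (by simp)
    rcases List.eq_nil_or_concat' v with rfl | ⟨v', z, rfl⟩
    · rcases h.last_barred hb with h1 | h1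
      · simpa using h1
      · simp at h1
    · have hz : z = ((v'.length : ℕ) : ℤ) - M := by
        rw [List.length_append, List.length_singleton, highColumn_succ] at ih
        simpa using (List.append_inj' ih rfl).2
      have hzb := hb' z (by simp)
      have hd : Desc X z y := hc'.2.2 z (by simp) y (by simp)
      have hzy : z < y := by cases X <;> simp only [Desc] at hd <;> omega
      rw [List.length_append, List.length_singleton]
      push_cast
      rcases h.last_barred hb with h1 | h1
      · omega
      · rw [ih, mem_highColumn] at h1
        rw [List.length_append, List.length_singleton] at h1
        push_cast at h1
        omega

/-- The words connected to a word on the barred letters: their symbol is obtained without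
contraction. -/
def Full (X : OType) (M : ℕ) (w : List ℤ) : Prop := ∃ b, Connected X M w b ∧ Barred M b

theorem Full.source {w s : List ℤ} (h : Full X M w) (hs : Raises X (· < M) w s)
    (hs' : IsSource X M s) : Barred M s := by
  obtain ⟨b, h1, h2⟩ := h
  refine h2.raises (fun _ h => h) (raises_of_connected ?_ hs')
  exact h1.symm.trans _ _ _ (hs.connected (fun _ h => h))

theorem Full.exists_source {w : List ℤ} (h : Full X M w) :
    ∃ s, Raises X (· < M) w s ∧ IsSource X M s ∧ Barred M s := by
  obtain ⟨s, h1, h2⟩ := OrthogonalTableaux.exists_source X M w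
  exact ⟨s, h1, h2, h.source h1 h2⟩

theorem Full.connected {w w' : List ℤ} (h : Full X M w) (hc : Connected X M w w') :
    Full X M w' := by
  obtain ⟨b, h1, h2⟩ := h
  exact ⟨b, hc.symm.trans _ _ _ h1, h2⟩

/-- Words with small letters are full in large rank. -/
theorem full_of_inAlphabet {N : ℕ} {w : List ℤ} (hX : ValidRank X M)
    (hw : ∀ x ∈ w, InAlphabet X N x) (hM : N + w.length + 2 ≤ M) : Full X M w := by
  induction w using List.reverseRecOn with
  | nil => exact ⟨[], .refl _, by simp [Barred]⟩
  | append_singleton u x ih =>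
    simp only [List.length_append, List.length_singleton] at hM
    have ih := ih (fun y hy => hw y (by simp [hy])) (by omega)
    obtain ⟨s, h1, h2⟩ := exists_source X M (u ++ [x])
    have hsa : ∀ y ∈ s, InAlphabet X M y :=
      (connected_inAlphabet hX (h1.connected (fun _ h => h))).mp
        fun y hy => (hw y hy).mono (by omega)
    obtain ⟨v, t, rfl, hv, ht⟩ := h1.append
    have hvb := ih.source hv h2.left
    have hvl := h2.left.barred_le hvb
    rw [hv.length_eq] at hvl
    obtain ⟨y, rfl⟩ : ∃ y, t = [y] := List.length_eq_one_iff.mp ht.length_eq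
    have hya := hsa y (by simp)
    have hxa := hw x (by simp)
    have hyx : y ≤ x := by
      clear h1 h2 hsa hya
      have : ∀ t, Raises X (· < M) [x] t → ∃ y, t = [y] ∧ y ≤ x := by
        intro t ht
        induction ht with
        | refl => exact ⟨x, rfl, le_rfl⟩
        | tail _ h3 ih3 =>
          obtain ⟨i, -, h4⟩ := h3
          obtain ⟨y, rfl, hy⟩ := ih3
          obtain ⟨a, b, p, q, rfl, h5, h6⟩ := wordF_change h4
          have := letterF_lt h6
          have hab : a = [] ∧ b = [] := by
            have := congrArg List.length h5
            simp only [List.length_append, List.length_cons, List.length_nil] at this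
            exact ⟨List.eq_nil_of_length_eq_zero (by omega),
              List.eq_nil_of_length_eq_zero (by omega)⟩
          obtain ⟨rfl, rfl⟩ := hab
          simp only [List.nil_append, List.cons.injEq, and_true] at h5
          exact ⟨p, rfl, by omega⟩
      obtain ⟨y', h3, h4⟩ := this _ ht
      simp only [List.cons.injEq, and_true] at h3
      rwa [h3]
    have hxN : x ≤ N := by cases X <;> simp only [InAlphabet, abs_le] at hxa <;> omega
    have hyM : -(M : ℤ) ≤ y := by cases X <;> simp only [InAlphabet, abs_le] at hya <;> omega
    refine ⟨_, h1.connected (fun _ h => h), fun z hz => ?_⟩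
    rcases List.mem_append.mp hz with hz | hz
    · exact hvb z hz
    rw [List.mem_singleton] at hz
    subst hz
    refine ⟨hyM, ?_⟩
    by_contra hneg
    -- A last letter `z` with `0 ≤ z ≤ N` can occur in a source only if `v` contains some `p`
    -- absorbing its `ε_i`, and for the colours used below such a `p` is at least `-(N + 2)`. The
    -- letters of `v` are at most `-M + |u| - 1`, which is smaller.
    have key : ∀ i < M, 0 < letterEps X i z → ∃ p ∈ v, 0 < letterPhi X i p := by
      intro i hi hz
      refine exists_letterPhi_pos ?_
      have := h2 i hi
      rw [eps_append, eps_singleton] at this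
      omega
    rcases (show z = 0 ∨ z = 1 ∨ ∃ k : ℕ, z = k + 2 by
      by_cases h0 : z = 0
      · exact Or.inl h0
      by_cases h1 : z = 1
      · exact Or.inr (Or.inl h1)
      exact Or.inr (Or.inr ⟨(z - 2).toNat, by omega⟩)) with rfl | rfl | ⟨k, rfl⟩
    · cases X
      · obtain ⟨p, hp, hp'⟩ := key 0 (by omega) (by simp [letterEps_B_zero])
        have := hvl p hp
        rw [letterPhi_B_zero] at hp'
        split_ifs at hp' <;> omega
      · simp [InAlphabet] at hya
    · obtain ⟨p, hp, hp'⟩ := key 0 (by omega) (by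
        cases X <;> simp [letterEps_B_zero, letterEps_D_zero])
      have := hvl p hp
      cases X
      · rw [letterPhi_B_zero] at hp'
        split_ifs at hp' <;> omega
      · rw [letterPhi_D_zero] at hp'
        split_ifs at hp' <;> omega
    · obtain ⟨p, hp, hp'⟩ := key (k + 1) (by omega) (by simp [letterEps_succ])
      have := hvl p hp
      have := hvb p hp
      rw [letterPhi_succ] at hp'
      split_ifs at hp' <;> omega

theorem highestFilling_eq (m : ℕ) (T : Filling) :
    highestFilling m T = T.map (fun C => highColumn m C.length) := by
  unfold highestFilling highColumn
  refine List.map_congr_left fun C _ => ?_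
  simp [List.map_eq_flatMap, List.flatMap_assoc]

end Columns

end OrthogonalTableaux

/-! ### Weights, change of rank, and uniqueness of the symbol -/

namespace OrthogonalTableaux

section Weights
variable {X : OType} {m M : ℕ}

/-! ### Weights -/

/-- The differences `φ_i - ε_i` are the pairings of the weight with the simple coroots, and these
determine its first `m` coordinates; in type `D` this takes both colours `0` and `1`, hence rank at
least `2`. -/
theorem Sim.weightCoord_eq (hX : ValidRank X m) (hm : 1 ≤ m) {a b : List ℤ} (h : Sim X m a b)
    {k : ℕ} (hk : 1 ≤ k) (hkm : k ≤ m) : weightCoord a k = weightCoord b k := by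
  have step : ∀ i, i + 1 < m → weightCoord a (i + 2) - weightCoord a (i + 1) =
      weightCoord b (i + 2) - weightCoord b (i + 1) := by
    intro i hi
    rw [← phi_sub_eps_succ X, ← phi_sub_eps_succ X, h.eps_eq hi, h.phi_eq hi]
  have base : weightCoord a 1 = weightCoord b 1 := by
    cases X with
    | B =>
      have h1 := phi_sub_eps_B_zero a
      have h2 := phi_sub_eps_B_zero b
      rw [h.eps_eq hm, h.phi_eq hm] at h1
      omega
    | D =>
      simp only [ValidRank] at hX
      have h1 := phi_sub_eps_D_zero a
      have h2 := phi_sub_eps_D_zero b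
      rw [h.eps_eq hm, h.phi_eq hm] at h1
      have := step 0 (by omega)
      simp only [Nat.zero_add] at this
      omega
  induction k, hk using Nat.le_induction with
  | base => exact base
  | succ k hk ih =>
    obtain ⟨k, rfl⟩ : ∃ j, k = j + 1 := ⟨k - 1, by omega⟩
    have := step k (by omega)
    have := ih (by omega)
    simp only [Nat.add_assoc, Nat.reduceAdd] at *
    omega

theorem sim_of_weights (hX : ValidRank X m) {a b : List ℤ} (ha : IsSource X m a)
    (hb : IsSource X m b) (h : ∀ k, 1 ≤ k → k ≤ m → weightCoord a k = weightCoord b k) :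
    Sim X m a b := by
  refine sim_of_sources ha hb fun i hi => ?_
  rcases i with _ | i
  · cases X with
    | B =>
      have h1 := phi_sub_eps_B_zero a
      have h2 := phi_sub_eps_B_zero b
      have := h 1 le_rfl hi
      rw [ha 0 hi] at h1
      rw [hb 0 hi] at h2
      omega
    | D =>
      simp only [ValidRank] at hX
      have h1 := phi_sub_eps_D_zero a
      have h2 := phi_sub_eps_D_zero b
      have := h 1 le_rfl (by omega)
      have := h 2 (by omega) hX
      rw [ha 0 hi] at h1
      rw [hb 0 hi] at h2
      omega
  · have h1 := phi_sub_eps_succ X i a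
    have h2 := phi_sub_eps_succ X i b
    have := h (i + 1) (by omega) (by omega)
    have := h (i + 2) (by omega) (by omega)
    rw [ha _ hi] at h1
    rw [hb _ hi] at h2
    omega

theorem sum_weightCoord_singleton (M : ℕ) (x : ℤ) :
    ∑ k ∈ Finset.range M, weightCoord [x] (k + 1) =
      (if -(M : ℤ) ≤ x ∧ x ≤ -1 then 1 else 0) - (if 1 ≤ x ∧ x ≤ (M : ℤ) then 1 else 0) := by
  induction M with
  | zero =>
    simp only [Finset.range_zero, Finset.sum_empty]
    split_ifs <;> omega
  | succ M ih =>
    rw [Finset.sum_range_succ, ih, weightCoord_singleton]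
    push_cast
    split_ifs <;> omega

/-- Barred words are those whose total weight attains their length, so being barred can be tested on
weight and length alone. -/
theorem sum_weightCoord (M : ℕ) (w : List ℤ) :
    ∑ k ∈ Finset.range M, weightCoord w (k + 1) ≤ w.length ∧
      (∑ k ∈ Finset.range M, weightCoord w (k + 1) = w.length ↔ Barred M w) := by
  induction w with
  | nil => simp [weightCoord, Barred]
  | cons x w ih =>
    have h1 : ∑ k ∈ Finset.range M, weightCoord (x :: w) (k + 1) =
        ∑ k ∈ Finset.range M, weightCoord w (k + 1) +
          ∑ k ∈ Finset.range M, weightCoord [x] (k + 1) := by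
      rw [← Finset.sum_add_distrib]
      exact Finset.sum_congr rfl fun k _ => weightCoord_cons x w (k + 1)
    have h2 : Barred M (x :: w) ↔ (-(M : ℤ) ≤ x ∧ x ≤ -1) ∧ Barred M w := by
      simp [Barred]
    rw [h1, h2, sum_weightCoord_singleton, ← ih.2, List.length_cons]
    have := ih.1
    push_cast
    split_ifs <;> omega

theorem Barred.of_weights {a b : List ℤ} (ha : Barred M a) (hl : a.length = b.length)
    (h : ∀ k, 1 ≤ k → k ≤ M → weightCoord a k = weightCoord b k) : Barred M b := by
  rw [← (sum_weightCoord M b).2, ← hl, ← (sum_weightCoord M a).2.mpr ha]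
  refine Finset.sum_congr rfl fun k hk => (h _ (by omega) ?_).symm
  rw [Finset.mem_range] at hk
  omega

theorem Barred.perm {a b : List ℤ} (ha : Barred M a) (hb : Barred M b)
    (h : ∀ k, 1 ≤ k → k ≤ M → weightCoord a k = weightCoord b k) : a.Perm b := by
  rw [List.perm_iff_count]
  intro x
  by_cases hx : -(M : ℤ) ≤ x ∧ x ≤ -1
  · obtain ⟨k, rfl⟩ : ∃ k : ℕ, x = -(k : ℤ) := ⟨(-x).toNat, by omega⟩
    have h1 := h k (by omega) (by omega)
    simp only [weightCoord] at h1
    rw [List.count_eq_zero_of_not_mem (a := (k : ℤ)) (l := a) (fun hk => by have := ha _ hk; omega),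
      List.count_eq_zero_of_not_mem (a := (k : ℤ)) (l := b) (fun hk => by have := hb _ hk; omega)]
      at h1
    omega
  · rw [List.count_eq_zero_of_not_mem (fun hk => hx (ha _ hk)),
      List.count_eq_zero_of_not_mem (fun hk => hx (hb _ hk))]

theorem Full.sim (hX : ValidRank X M) (hM : 1 ≤ M) {a b : List ℤ} (ha : Full X M a)
    (h : Sim X M a b) (hl : a.length = b.length) : Full X M b := by
  obtain ⟨s, h1, h2, h3⟩ := ha.exists_source
  obtain ⟨t, h4, h5⟩ := h.raises (fun _ h => h) h1
  refine ⟨t, h4.connected (fun _ h => h), h3.of_weights ?_ fun k hk hk' =>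
    h5.weightCoord_eq hX hM hk hk'⟩
  rw [h1.length_eq, h4.length_eq, hl]

end Weights

/-! ### The diagram automorphism of type `D` -/

/-- The exchange of the letters `1` and `-1`. -/
def flipOne (x : ℤ) : ℤ := if x = 1 then -1 else if x = -1 then 1 else x

theorem flipOne_flipOne (x : ℤ) : flipOne (flipOne x) = x := by
  by_cases h1 : x = 1
  · subst h1; decide
  · by_cases h2 : x = -1
    · subst h2; decide
    · simp [flipOne, h1, h2]

theorem flipOne_cases (x : ℤ) : (x = 1 ∧ flipOne x = -1) ∨ (x = -1 ∧ flipOne x = 1) ∨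
    (x ≠ 1 ∧ x ≠ -1 ∧ flipOne x = x) := by
  unfold flipOne; split_ifs <;> omega

/-- The exchange of `1` and `-1` realises the diagram automorphism swapping the colours `0` and `1`.
It reduces tableaux with highest filling `highestFillingNeg` to those with `highestFilling`. -/
theorem letterStats_flipOne (i : ℕ) (x : ℤ) :
    letterEps OType.D (Equiv.swap 0 1 i) (flipOne x) = letterEps OType.D i x ∧
    letterPhi OType.D (Equiv.swap 0 1 i) (flipOne x) = letterPhi OType.D i x := by
  match i with
  | 0 =>
    rw [Equiv.swap_apply_left, letterEps_succ OType.D 0, letterPhi_succ OType.D 0,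
      letterEps_D_zero, letterPhi_D_zero]
    rcases flipOne_cases x with ⟨rfl, e⟩ | ⟨rfl, e⟩ | ⟨h, h', e⟩
    · rw [e]; norm_num
    · rw [e]; norm_num
    · rw [e]; simp [h, h', or_comm]
  | 1 =>
    rw [Equiv.swap_apply_right, letterEps_succ OType.D 0, letterPhi_succ OType.D 0,
      letterEps_D_zero, letterPhi_D_zero]
    rcases flipOne_cases x with ⟨rfl, e⟩ | ⟨rfl, e⟩ | ⟨h, h', e⟩
    · rw [e]; norm_num
    · rw [e]; norm_num
    · rw [e]; simp [h, h', or_comm]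
  | i + 2 =>
    rw [Equiv.swap_apply_of_ne_of_ne (by omega) (by omega), letterEps_succ, letterPhi_succ,
      letterEps_succ, letterPhi_succ]
    rcases flipOne_cases x with ⟨rfl, e⟩ | ⟨rfl, e⟩ | ⟨h, h', e⟩
    · rw [e]; push_cast; constructor <;> repeat rw [if_neg (by omega)]
    · rw [e]; push_cast; constructor <;> repeat rw [if_neg (by omega)]
    · rw [e]; exact ⟨rfl, rfl⟩

theorem letterF_flipOne {i : ℕ} {x y : ℤ} (h : letterF OType.D i x = some y) :
    letterF OType.D (Equiv.swap 0 1 i) (flipOne x) = some (flipOne y) := by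
  match i with
  | 0 =>
    rw [letterF_D_zero] at h
    split_ifs at h with h1 h2 <;> simp only [Option.some.injEq] at h <;> subst h
    · subst h1; rw [Equiv.swap_apply_left]; decide
    · subst h2; rw [Equiv.swap_apply_left]; decide
  | 1 =>
    rw [letterF_succ OType.D 0] at h
    split_ifs at h with h1
    simp only [Option.some.injEq] at h
    subst h
    rcases h1 with rfl | rfl <;> rw [Equiv.swap_apply_right] <;> decide
  | i + 2 =>
    rw [letterF_succ] at h
    rw [Equiv.swap_apply_of_ne_of_ne (by omega) (by omega), letterF_succ]
    split_ifs at h with h1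
    simp only [Option.some.injEq] at h
    subst h
    have e1 : flipOne x = x := by unfold flipOne; split_ifs <;> omega
    have e2 : flipOne (x + 1) = x + 1 := by unfold flipOne; split_ifs <;> omega
    rw [e1, e2, if_pos h1]

theorem stats_flipOne (i : ℕ) (w : List ℤ) :
    eps OType.D (Equiv.swap 0 1 i) (w.map flipOne) = eps OType.D i w ∧
    phi OType.D (Equiv.swap 0 1 i) (w.map flipOne) = phi OType.D i w := by
  induction w with
  | nil => simp
  | cons x w ih =>
    simp only [List.map_cons, eps_cons, phi_cons, ih, letterStats_flipOne, and_self]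

theorem wordF_flipOne {i : ℕ} {w v : List ℤ} (h : wordF OType.D i w = some v) :
    wordF OType.D (Equiv.swap 0 1 i) (w.map flipOne) = some (v.map flipOne) := by
  induction w generalizing v with
  | nil => simp [wordF] at h
  | cons x w ih =>
    simp only [List.map_cons, wordF_cons_some, stats_flipOne, letterStats_flipOne]
    rcases wordF_cons_some.mp h with ⟨h1, y, hy, rfl⟩ | ⟨h1, u, hu, rfl⟩
    · exact Or.inl ⟨h1, _, letterF_flipOne hy, rfl⟩
    · exact Or.inr ⟨h1, _, ih hu, rfl⟩

theorem swap_lt {i m : ℕ} (hm : 2 ≤ m) (hi : i < m) : Equiv.swap 0 1 i < m := by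
  rw [Equiv.swap_apply_def]
  split_ifs <;> omega

theorem map_flipOne_flipOne (w : List ℤ) : (w.map flipOne).map flipOne = w := by
  rw [List.map_map, show flipOne ∘ flipOne = id from funext flipOne_flipOne, List.map_id]

theorem Connected.flipOne {m : ℕ} (hm : 2 ≤ m) {w v : List ℤ} (h : Connected OType.D m w v) :
    Connected OType.D m (w.map flipOne) (v.map flipOne) := by
  induction h with
  | rel a b hab =>
    obtain ⟨i, hi, h⟩ := hab
    exact .rel _ _ ⟨_, swap_lt hm hi, wordF_flipOne h⟩
  | refl => exact .refl _
  | symm _ _ _ ih => exact ih.symm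
  | trans _ _ _ _ _ ih1 ih2 => exact ih1.trans _ _ _ ih2

theorem Sim.flipOne {m : ℕ} (hm : 2 ≤ m) {w v : List ℤ} (h : Sim OType.D m w v) :
    Sim OType.D m (w.map flipOne) (v.map flipOne) := by
  refine ⟨fun a b => Sim OType.D m (a.map OrthogonalTableaux.flipOne)
    (b.map OrthogonalTableaux.flipOne), ?_, by simpa only [map_flipOne_flipOne]⟩
  intro a b hab i hi
  have hi' := swap_lt hm hi
  refine ⟨?_, ?_, fun a' ha' => ?_, fun a' ha' => ?_⟩
  · rw [← (stats_flipOne i a).1, ← (stats_flipOne i b).1, hab.eps_eq hi']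
  · rw [← (stats_flipOne i a).2, ← (stats_flipOne i b).2, hab.phi_eq hi']
  · obtain ⟨b', h1, h2⟩ := hab.lower hi' (wordF_flipOne ha')
    have := wordF_flipOne h1
    rw [map_flipOne_flipOne, Equiv.swap_apply_self] at this
    exact ⟨_, this, by simpa only [map_flipOne_flipOne] using h2⟩
  · obtain ⟨b', h1, h2⟩ := hab.raise hi' (wordF_flipOne ha')
    have := wordF_flipOne h1
    rw [map_flipOne_flipOne, Equiv.swap_apply_self] at this
    exact ⟨_, this, by simpa only [map_flipOne_flipOne] using h2⟩

section Lift
variable {X : OType} {m M : ℕ}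

/-! ### Change of rank -/

theorem phi_eq_zero_of_forall {i : ℕ} {w : List ℤ} (h : ∀ x ∈ w, letterPhi X i x = 0) :
    phi X i w = 0 := by
  by_contra hc
  obtain ⟨x, hx, hx'⟩ := exists_letterPhi_pos (Nat.pos_of_ne_zero hc)
  have := h x hx
  omega

theorem eps_eq_zero_of_forall {i : ℕ} {w : List ℤ} (h : ∀ x ∈ w, letterEps X i x = 0) :
    eps X i w = 0 := by
  by_contra hc
  obtain ⟨x, hx, hx'⟩ := exists_letterEps_pos (Nat.pos_of_ne_zero hc)
  have := h x hx
  omega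

/-- The words `v` and `v'` are the lower ends of the `c`-strings through `u` and `u'`, reached after
the common number `φ_c u = φ_c u'` of steps. -/
theorem Sim.of_raises_max {c : ℕ} (hc : c < m) {v u v' u' : List ℤ}
    (h : Raises X (· = c) v u) (hv : phi X c v = 0) (h' : Raises X (· = c) v' u')
    (hv' : phi X c v' = 0) (hs : Sim X m u u') : Sim X m v v' := by
  induction h generalizing u' with
  | refl =>
    rcases Relation.ReflTransGen.cases_tail h' with rfl | ⟨t, -, i, rfl, h1⟩
    · exact hs
    · have := phi_pos_of_wordF h1
      rw [← hs.phi_eq hc] at this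
      omega
  | tail _ h1 ih =>
    obtain ⟨i, rfl, h1⟩ := h1
    have hpos := phi_pos_of_wordF h1
    rw [hs.phi_eq hc] at hpos
    rcases Relation.ReflTransGen.cases_tail h' with rfl | ⟨t, h2, i, rfl, h3⟩
    · omega
    · obtain ⟨t', h4, h5⟩ := hs.lower hc h1
      obtain rfl := Option.some.inj (h3.symm.trans h4)
      exact ih h2 h5

/-- The letters at most `-c` moved one step up. -/
def shiftFrom (c : ℕ) (x : ℤ) : ℤ := if x ≤ -(c : ℤ) then x - 1 else x

/-- After the letters at most `-(c + 1)` have been moved, the place `-(c + 1)` is vacant, so nothing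
cancels in the `c`-signature and all letters `-c` can be raised to it. -/
theorem raises_shiftFrom {c : ℕ} (hc : 1 ≤ c) {v : List ℤ} (hv : ∀ x ∈ v, x ≤ -1) :
    Raises X (· = c) (v.map (shiftFrom (c + 1))) (v.map (shiftFrom c)) ∧
      phi X c (v.map (shiftFrom (c + 1))) = 0 := by
  obtain ⟨c, rfl⟩ : ∃ d, c = d + 1 := ⟨c - 1, by omega⟩
  have hphi : ∀ x ≤ (-1 : ℤ), letterPhi X (c + 1) (shiftFrom (c + 1 + 1) x) = 0 := by
    intro x hx
    rw [letterPhi_succ]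
    unfold shiftFrom
    push_cast
    split_ifs <;> omega
  have heps : ∀ x ≤ (-1 : ℤ), letterEps X (c + 1) (shiftFrom (c + 1) x) = 0 := by
    intro x hx
    rw [letterEps_succ]
    unfold shiftFrom
    push_cast
    split_ifs <;> omega
  constructor
  · induction v with
    | nil => exact .refl
    | cons x v ih =>
      have ih := ih fun y hy => hv y (by simp [hy])
      have hx := hv x (by simp)
      have h1 : Raises X (· = c + 1) (shiftFrom (c + 1 + 1) x :: v.map (shiftFrom (c + 1 + 1)))
          (shiftFrom (c + 1 + 1) x :: v.map (shiftFrom (c + 1))) := by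
        generalize v.map (shiftFrom (c + 1)) = u at ih
        induction ih with
        | refl => exact .refl
        | tail _ h2 ih2 =>
          obtain ⟨i, rfl, h3⟩ := h2
          refine ih2.tail ⟨_, rfl, wordF_cons_some.mpr (Or.inr ⟨?_, _, h3, rfl⟩)⟩
          rw [hphi x hx]
          omega
      by_cases hxc : x = -((c : ℤ) + 1)
      · refine h1.tail ⟨_, rfl, ?_⟩
        have e1 : shiftFrom (c + 1) x = -((c : ℤ) + 2) := by
          unfold shiftFrom; push_cast; split_ifs <;> omega
        have e2 : shiftFrom (c + 1 + 1) x = -((c : ℤ) + 2) + 1 := by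
          unfold shiftFrom; push_cast; split_ifs <;> omega
        rw [List.map_cons, e1, e2]
        refine wordF_cons_some.mpr (Or.inl ⟨?_, _, ?_, rfl⟩)
        · rw [eps_eq_zero_of_forall, letterPhi_succ, if_pos (Or.inl rfl)]
          · omega
          · intro y hy
            obtain ⟨z, hz, rfl⟩ := List.mem_map.mp hy
            exact heps z (hv z (by simp [hz]))
        · rw [letterF_succ, if_pos (Or.inl rfl)]
      · have e : shiftFrom (c + 1 + 1) x = shiftFrom (c + 1) x := by
          unfold shiftFrom; push_cast; split_ifs <;> omega
        rw [e] at h1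
        rw [List.map_cons, List.map_cons, e]
        exact h1
  · refine phi_eq_zero_of_forall fun y hy => ?_
    obtain ⟨z, hz, rfl⟩ := List.mem_map.mp hy
    exact hphi z (hv z hz)

theorem map_shiftFrom_one {v : List ℤ} (hv : Barred m v) :
    v.map (shiftFrom 1) = v.map (· - 1) := by
  refine List.map_congr_left fun x hx => ?_
  have := hv x hx
  unfold shiftFrom
  rw [if_pos (by push_cast; omega)]

theorem map_shiftFrom_succ {v : List ℤ} (hv : Barred m v) : v.map (shiftFrom (m + 1)) = v := by
  conv_rhs => rw [← List.map_id v]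
  refine List.map_congr_left fun x hx => ?_
  have := hv x hx
  unfold shiftFrom
  rw [if_neg (by push_cast; omega)]
  rfl

/-- The moves of `raises_shiftFrom` are composed for `c = m, …, 1`. Highest weight words of rank `m`
are thereby linked to those of rank `m + 1`, which is what lets the rank grow. -/
theorem connected_shift {v : List ℤ} (hv : Barred m v) :
    Connected X (m + 1) v (v.map (· - 1)) := by
  have key : ∀ k ≤ m, Connected X (m + 1) (v.map (shiftFrom (k + 1))) (v.map (shiftFrom 1)) := by
    intro k
    induction k with
    | zero => intro _; exact .refl _
    | succ k ih =>
      intro hk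
      refine Relation.EqvGen.trans _ _ _ ?_ (ih (by omega))
      exact (raises_shiftFrom (X := X) (c := k + 1) (by omega) fun x hx => (hv x hx).2).1.connected
        (fun i hi => by omega)
  have := key m le_rfl
  rwa [map_shiftFrom_succ hv, map_shiftFrom_one hv] at this

theorem Sim.of_shift {v v' : List ℤ} (hv : Barred m v) (hv' : Barred m v')
    (h : Sim X (m + 1) (v.map (· - 1)) (v'.map (· - 1))) : Sim X (m + 1) v v' := by
  have key : ∀ k ≤ m, Sim X (m + 1) (v.map (shiftFrom (k + 1))) (v'.map (shiftFrom (k + 1))) := by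
    intro k
    induction k with
    | zero =>
      intro _
      rwa [map_shiftFrom_one hv, map_shiftFrom_one hv']
    | succ k ih =>
      intro hk
      have h1 := raises_shiftFrom (X := X) (c := k + 1) (by omega) fun x hx => (hv x hx).2
      have h2 := raises_shiftFrom (X := X) (c := k + 1) (by omega) fun x hx => (hv' x hx).2
      exact Sim.of_raises_max (by omega) h1.1 h1.2 h2.1 h2.2 (ih (by omega))
  have := key m le_rfl
  rwa [map_shiftFrom_succ hv, map_shiftFrom_succ hv'] at this

theorem stats_shift {v : List ℤ} (hv : ∀ x ∈ v, x ≤ -1) (i : ℕ) :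
    eps X (i + 2) (v.map (· - 1)) = eps X (i + 1) v ∧
    phi X (i + 2) (v.map (· - 1)) = phi X (i + 1) v := by
  induction v with
  | nil => simp
  | cons x v ih =>
    have ih := ih fun y hy => hv y (by simp [hy])
    have hx := hv x (by simp)
    have h1 : letterEps X (i + 2) (x - 1) = letterEps X (i + 1) x := by
      rw [letterEps_succ, letterEps_succ]; push_cast; split_ifs <;> omega
    have h2 : letterPhi X (i + 2) (x - 1) = letterPhi X (i + 1) x := by
      rw [letterPhi_succ, letterPhi_succ]; push_cast; split_ifs <;> omega
    simp only [List.map_cons, eps_cons, phi_cons, ih.1, ih.2, h1, h2, and_self]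

theorem isSource_shift {v : List ℤ} (hv : Barred m v) (h : IsSource X m v) :
    IsSource X (m + 1) (v.map (· - 1)) := by
  intro i hi
  match i with
  | 0 =>
    refine eps_eq_zero_of_forall fun x hx => ?_
    obtain ⟨y, hy, rfl⟩ := List.mem_map.mp hx
    exact letterEps_zero_of_neg (by have := hv y hy; omega)
  | 1 =>
    refine eps_eq_zero_of_forall fun x hx => ?_
    obtain ⟨y, hy, rfl⟩ := List.mem_map.mp hx
    have := hv y hy
    rw [letterEps_succ X 0, if_neg (by push_cast; omega)]
  | i + 2 => rw [(stats_shift (fun x hx => (hv x hx).2) i).1, h _ (by omega)]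

/-- Isomorphic components containing barred words of the same length remain isomorphic when the
rank grows. -/
theorem Sim.succ (hX : ValidRank X m) (hm : 1 ≤ m) {w r t : List ℤ} (h : Sim X m w r)
    (hl : w.length = r.length) (hc : Connected X m t r) (ht : IsSource X m t)
    (hb : Barred m t) : Sim X (m + 1) w r := by
  -- Both words are raised by the same operators; the same path read downwards carries bisimilarity
  -- in rank `m + 1` from the tops back to `w` and `r`.
  have key : ∀ t, Raises X (· < m) r t → ∃ v, Raises X (· < m) w v ∧ Sim X m v t ∧
      (Sim X (m + 1) v t → Sim X (m + 1) w r) := by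
    intro t ht
    induction ht with
    | refl => exact ⟨w, .refl, h, id⟩
    | tail _ h1 ih =>
      obtain ⟨i, hi, h2⟩ := h1
      obtain ⟨v, hv, hs, he⟩ := ih
      obtain ⟨v', h3, h4⟩ := hs.symm.raise hi h2
      refine ⟨v', hv.tail ⟨i, hi, h3⟩, h4.symm, fun hs' => he ?_⟩
      obtain ⟨a, h5, h6⟩ := hs'.lower (show i < m + 1 by omega) h3
      rwa [Option.some.inj (h2.symm.trans h5)]
  have hr := raises_of_connected hc.symm ht
  obtain ⟨v, hv, hs, he⟩ := key t hr
  have hw : ∀ k, 1 ≤ k → k ≤ m → weightCoord t k = weightCoord v k :=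
    fun k hk hk' => hs.symm.weightCoord_eq hX hm hk hk'
  have hbv : Barred m v := hb.of_weights (by rw [hr.length_eq, hv.length_eq, hl]) hw
  -- The tops are barred words of one weight, hence rearrangements of each other; after the shift
  -- they are sources of rank `m + 1` that still have the same weight.
  have hp := (hb.perm hbv hw).map (· - 1)
  refine he (Sim.of_shift hbv hb (sim_of_weights ?_ (isSource_shift hbv (hs.symm.isSource ht))
    (isSource_shift hb ht) fun k _ _ => ?_))
  · cases X <;> simp only [ValidRank] at hX ⊢; omega
  · simp only [weightCoord, hp.count_eq]

/-! ### Tableaux in all ranks -/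

theorem reading_cons (C : List ℤ) (T : Filling) : reading (C :: T) = reading T ++ C := by
  simp [reading]

@[simp] theorem reading_nil : reading [] = [] := rfl

/-- A tableau whose highest weight vertex is a word on the barred letters. -/
def PlusTableau (X : OType) (M : ℕ) (T : Filling) : Prop :=
  HasYoungShape T ∧ (∀ C ∈ T, C.length ≤ M) ∧
    Connected X M (reading (highestFilling M T)) (reading T)

theorem reading_highestFilling_cons (M : ℕ) (C : List ℤ) (T : Filling) :
    reading (highestFilling M (C :: T)) =
      reading (highestFilling M T) ++ highColumn M C.length := by
  rw [highestFilling_eq, List.map_cons, reading_cons, ← highestFilling_eq]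

theorem reading_highestFilling_spec {T : Filling} (hT : ∀ C ∈ T, C.length ≤ M) :
    Barred M (reading (highestFilling M T)) ∧ IsSource X M (reading (highestFilling M T)) := by
  induction T with
  | nil => exact ⟨by simp [highestFilling, Barred], fun i _ => by simp [highestFilling]⟩
  | cons C T ih =>
    obtain ⟨h1, h2⟩ := ih fun D hD => hT D (by simp [hD])
    have hC := hT C (by simp)
    rw [reading_highestFilling_cons]
    refine ⟨fun x hx => ?_, h2.append (isSource_highColumn hC)⟩
    rcases List.mem_append.mp hx with hx | hx
    · exact h1 x hx
    · exact barred_highColumn hC x hx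

theorem length_reading_highestFilling (M : ℕ) (T : Filling) :
    (reading (highestFilling M T)).length = (reading T).length := by
  induction T with
  | nil => rfl
  | cons C T ih =>
    rw [reading_highestFilling_cons, reading_cons, List.length_append, List.length_append, ih,
      length_highColumn]

theorem reading_highestFilling_succ (M : ℕ) (T : Filling) :
    reading (highestFilling (M + 1) T) = (reading (highestFilling M T)).map (· - 1) := by
  induction T with
  | nil => rfl
  | cons C T ih =>
    rw [reading_highestFilling_cons, reading_highestFilling_cons, List.map_append, ih]
    congr 1
    simp only [highColumn, List.map_map]
    refine List.map_congr_left fun j _ => ?_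
    simp only [Function.comp_apply]
    push_cast
    ring

theorem reading_highestFillingNeg {T : Filling} (hT : ∀ C ∈ T, C.length ≤ M) :
    reading (highestFillingNeg M T) = (reading (highestFilling M T)).map flipOne := by
  have h := (reading_highestFilling_spec (X := OType.B) hT).1
  have e : reading (highestFillingNeg M T) =
      (reading (highestFilling M T)).map (fun x => if x = -1 then 1 else x) := by
    rw [reading, highestFillingNeg, ← List.map_reverse, ← List.map_flatten, ← reading]
  rw [e]
  refine List.map_congr_left fun x hx => ?_
  have := h x hx
  unfold flipOne
  split_ifs <;> omega

theorem ValidRank.succ (hX : ValidRank X m) : ValidRank X (m + 1) := by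
  cases X <;> simp only [ValidRank] at hX ⊢; omega

theorem ValidRank.mono {m' : ℕ} (h : m ≤ m') (hX : ValidRank X m) : ValidRank X m' := by
  cases X <;> simp only [ValidRank] at hX ⊢; omega

theorem PlusTableau.full {T : Filling} (h : PlusTableau X M T) : Full X M (reading T) :=
  ⟨_, h.2.2.symm, (reading_highestFilling_spec (X := X) h.2.1).1⟩

theorem PlusTableau.succ {T : Filling} (h : PlusTableau X m T) : PlusTableau X (m + 1) T := by
  refine ⟨h.1, fun C hC => (h.2.1 C hC).trans (by omega), ?_⟩
  rw [reading_highestFilling_succ]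
  exact (connected_shift (reading_highestFilling_spec (X := X) h.2.1).1).symm.trans _ _ _
    (h.2.2.mono (by omega))

theorem PlusTableau.isTableauOfRank (hX : ValidRank X M) {T : Filling} (h : PlusTableau X M T) :
    IsTableauOfRank X M T := ⟨hX, h.1, h.2.1, Or.inl h.2.2⟩

/-- Once shifted to rank `m + 1`, the highest filling contains neither `1` nor `-1` and is fixed by
`flipOne`, so the distinction between the two kinds of highest weight in type `D` disappears. -/
theorem IsTableauOfRank.succ {T : Filling} (h : IsTableauOfRank X m T) :
    PlusTableau X (m + 1) T := by
  obtain ⟨hX, h1, h2, h3 | ⟨rfl, h3⟩⟩ := h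
  · exact PlusTableau.succ ⟨h1, h2, h3⟩
  · refine ⟨h1, fun C hC => (h2 C hC).trans (by omega), ?_⟩
    simp only [ValidRank] at hX
    have hb := (reading_highestFilling_spec (X := OType.D) h2).1
    rw [reading_highestFillingNeg h2] at h3
    have h4 := (connected_shift (X := OType.D) hb).flipOne (by omega)
    rw [reading_highestFilling_succ]
    have e : ((reading (highestFilling m T)).map (· - 1)).map flipOne =
        (reading (highestFilling m T)).map (· - 1) := by
      rw [List.map_map]
      refine List.map_congr_left fun x hx => ?_
      have := hb x hx
      simp only [Function.comp_apply]
      unfold flipOne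
      split_ifs <;> omega
    rw [e] at h4
    exact h4.symm.trans _ _ _ (h3.mono (by omega))

theorem PlusTableau.mono {m' : ℕ} {T : Filling} (h : PlusTableau X m T) (hm : m ≤ m') :
    PlusTableau X m' T := by
  induction m', hm using Nat.le_induction with
  | base => exact h
  | succ k _ ih => exact ih.succ

theorem IsTableauOfRank.plusTableau {m' : ℕ} {T : Filling} (h : IsTableauOfRank X m T)
    (hm : m < m') : PlusTableau X m' T := h.succ.mono hm

theorem IsTableauOfRank.sim_succ (hm : 1 ≤ m) {w : List ℤ} {T : Filling}
    (h : IsTableauOfRank X m T) (hs : Sim X m w (reading T)) (hl : (reading T).length = w.length) :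
    Sim X (m + 1) w (reading T) := by
  obtain ⟨hX, h1, h2, h3 | ⟨rfl, h3⟩⟩ := h
  · obtain ⟨h4, h5⟩ := reading_highestFilling_spec (X := X) h2
    exact hs.succ hX hm hl.symm h3 h5 h4
  · obtain ⟨h4, h5⟩ := reading_highestFilling_spec (X := OType.D) h2
    have hX' := hX
    simp only [ValidRank] at hX
    rw [reading_highestFillingNeg h2] at h3
    have h6 := h3.flipOne hX
    rw [map_flipOne_flipOne] at h6
    have h7 := (Sim.succ hX' hm (hs.flipOne hX) (by simpa using hl.symm) h6 h5 h4).flipOne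
      (by omega)
    simpa only [map_flipOne_flipOne] using h7

theorem IsTableauOfRank.sim_mono {m' : ℕ} (hm : 1 ≤ m) {w : List ℤ} {T : Filling}
    (h : IsTableauOfRank X m T) (hs : Sim X m w (reading T)) (hl : (reading T).length = w.length)
    (hm' : m ≤ m') : Sim X m' w (reading T) := by
  induction m', hm' using Nat.le_induction with
  | base => exact hs
  | succ k hk ih =>
    rcases hk.eq_or_lt with rfl | hk'
    · exact h.sim_succ hm hs hl
    · exact ((h.plusTableau hk').isTableauOfRank (h.1.mono hk)).sim_succ (by omega) ih hl

theorem count_reading_highestFilling {T : Filling} {j : ℕ} :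
    (reading (highestFilling M T)).count ((j : ℤ) - M) =
      (T.map List.length).countP (fun h => decide (j < h)) := by
  induction T with
  | nil => rfl
  | cons C T ih =>
    rw [reading_highestFilling_cons, List.count_append, ih, List.map_cons, List.countP_cons]
    congr 1
    have hnd : (highColumn M C.length).Nodup := by
      unfold highColumn
      exact List.Nodup.map (fun a b h => by have h : (a : ℤ) - M = b - M := h; omega) List.nodup_range
    rw [hnd.count]
    have : (j : ℤ) - M ∈ highColumn M C.length ↔ j < C.length := by
      rw [mem_highColumn]; omega
    simp only [this, decide_eq_true_eq]

/-- Tableaux with bisimilar readings are equal. -/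
theorem PlusTableau.eq_of_sim (hX : ValidRank X M) (hM : 1 ≤ M) {S T : Filling}
    (hS : PlusTableau X M S) (hT : PlusTableau X M T) (h : Sim X M (reading S) (reading T)) :
    S = T := by
  obtain ⟨hSb, hSs⟩ := reading_highestFilling_spec (X := X) hS.2.1
  obtain ⟨hTb, hTs⟩ := reading_highestFilling_spec (X := X) hT.2.1
  have h1 := raises_of_connected hS.2.2.symm hSs
  obtain ⟨t, h2, h3⟩ := h.raises (fun _ h => h) h1
  have h4 := source_unique (h3.isSource hSs) hTs
    ((h2.connected (fun _ h => h)).symm.trans _ _ _ hT.2.2.symm)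
  subst h4
  have hp := hSb.perm hTb fun k hk hk' => h3.weightCoord_eq hX hM hk hk'
  -- The letter `j - M` occurs in the highest filling once per column of height greater than `j`;
  -- the content of the highest weight word thus recovers the shape.
  have hcount : ∀ j, (S.map List.length).countP (fun h => decide (j < h)) =
      (T.map List.length).countP (fun h => decide (j < h)) := by
    intro j
    by_cases hj : j < M
    · rw [← count_reading_highestFilling, ← count_reading_highestFilling, hp.count_eq]
    · have : ∀ U : Filling, (∀ C ∈ U, C.length ≤ M) →
          (U.map List.length).countP (fun h => decide (j < h)) = 0 := by
        intro U hU
        rw [List.countP_eq_zero]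
        intro a ha
        obtain ⟨C, hC, rfl⟩ := List.mem_map.mp ha
        have := hU C hC
        simp only [decide_eq_true_eq]
        omega
      rw [this S hS.2.1, this T hT.2.1]
  have hc : ∀ (L : List ℕ) (j : ℕ), L.countP (fun h => decide (j < h)) =
      L.count (j + 1) + L.countP (fun h => decide (j + 1 < h)) := by
    intro L j
    induction L with
    | nil => rfl
    | cons a L ih =>
      rw [List.countP_cons, List.countP_cons, List.count_cons, ih]
      simp only [decide_eq_true_eq, beq_iff_eq]
      split_ifs <;> omega
  have hlen : S.map List.length = T.map List.length := by
    refine List.Perm.eq_of_pairwise (le := (· ≥ ·)) (fun a b _ _ h1 h2 => le_antisymm h2 h1)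
      hS.1.2 hT.1.2 (List.perm_iff_count.mpr fun j => ?_)
    rcases j with _ | j
    · have : ∀ U : Filling, HasYoungShape U → (U.map List.length).count 0 = 0 := by
        intro U hU
        rw [List.count_eq_zero]
        intro h0
        obtain ⟨C, hC, hC0⟩ := List.mem_map.mp h0
        exact hU.1 C hC (List.eq_nil_of_length_eq_zero hC0)
      rw [this S hS.1, this T hT.1]
    · have e1 := hc (S.map List.length) j
      have e2 := hc (T.map List.length) j
      have e3 := hcount j
      have e4 := hcount (j + 1)
      omega
  have hhigh : highestFilling M S = highestFilling M T := by
    rw [highestFilling_eq, highestFilling_eq]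
    have := congrArg (List.map (highColumn M)) hlen
    simpa only [List.map_map, Function.comp_def] using this
  have hr : reading S = reading T := by
    refine h.connected_raise (hS.2.2.symm.trans _ _ _ ?_)
    rw [hhigh]
    exact hT.2.2
  have := List.eq_iff_flatten_eq.mpr ⟨hr, by simp only [List.map_reverse, hlen]⟩
  exact List.reverse_injective this

/-- A symbol obtained in one rank without contraction remains valid in all larger ranks. Symbols
found in different ranks can therefore be compared, and the rank may be taken as large as any
argument requires. -/
theorem IsPSymbol.spec {w : List ℤ} (hw : w ≠ []) {T : Filling} (h : IsPSymbol X w T) :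
    ∃ m₀, ∀ M ≥ m₀, ValidRank X M ∧ PlusTableau X M T ∧ Sim X M w (reading T) ∧
      (reading T).length = w.length := by
  obtain ⟨m, -, hT, hs, hl⟩ := h
  have hm : 1 ≤ m := by
    by_contra hm
    have hm0 : m = 0 := by omega
    have : T = [] := by
      by_contra hT0
      obtain ⟨C, hC⟩ := List.exists_mem_of_ne_nil _ hT0
      have h1 := hT.2.2.1 C hC
      exact hT.2.1.1 C hC (List.eq_nil_of_length_eq_zero (by omega))
    subst this
    simp only [reading_nil, List.length_nil] at hl
    exact hw (List.eq_nil_of_length_eq_zero hl.symm)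
  refine ⟨m + 1, fun M hM => ⟨hT.1.mono (by omega), hT.plusTableau hM, ?_, hl⟩⟩
  exact hT.sim_mono hm hs.sim hl (by omega)

theorem IsPSymbol.unique {w : List ℤ} (hw : w ≠ []) {S T : Filling} (hS : IsPSymbol X w S)
    (hT : IsPSymbol X w T) : S = T := by
  obtain ⟨a, ha⟩ := hS.spec hw
  obtain ⟨b, hb⟩ := hT.spec hw
  obtain ⟨h1, h2, h3, -⟩ := ha (max (max a b) 1) (by omega)
  obtain ⟨-, h4, h5, -⟩ := hb (max (max a b) 1) (by omega)
  exact h2.eq_of_sim h1 (by omega) h4 (h3.symm.trans h5)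

end Lift

end OrthogonalTableaux

/-! ### Column insertion and the removal of the first letter -/

namespace OrthogonalTableaux

section Insertion
variable {X : OType} {m M : ℕ}

/-! ### Column insertion without contraction -/

/-- The insertion of `x` in the column `D` pushes out the letter `z` and leaves the column `D'`. -/
structure Slide (X : OType) (M : ℕ) (D : List ℤ) (x z : ℤ) (D' : List ℤ) : Prop where
  full : Full X M (D ++ [x])
  sim : Sim X M (D ++ [x]) (z :: D')
  column : ColumnWord X D
  not_column : ¬ ColumnWord X (D ++ [x])
  column' : ColumnWord X D'
  not_column' : ¬ ColumnWord X (z :: D')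
  length : D'.length = D.length

/-- The insertion of a letter in a filling. -/
inductive Ins (X : OType) (M : ℕ) : Filling → ℤ → Filling → Prop
  | new (x : ℤ) : Ins X M [] x [[x]]
  | app (D : List ℤ) (T : Filling) (x : ℤ) (h : ColumnWord X (D ++ [x])) :
      Ins X M (D :: T) x ((D ++ [x]) :: T)
  | pass (D D' : List ℤ) (T T' : Filling) (x z : ℤ) (h : Slide X M D x z D') (h' : Ins X M T z T') :
      Ins X M (D :: T) x (D' :: T')

theorem Ins.sim {T F : Filling} {x : ℤ} (h : Ins X M T x F) :
    Sim X M (reading T ++ [x]) (reading F) := by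
  induction h with
  | new x => simpa [reading] using Sim.refl _
  | app D T x h => rw [reading_cons, reading_cons, List.append_assoc]; exact Sim.refl _
  | pass D D' T T' x z h _ ih =>
    rw [reading_cons, reading_cons, List.append_assoc]
    refine ((Sim.refl (reading T)).append h.sim).trans ?_
    have := ih.append (Sim.refl (X := X) (m := M) D')
    simpa using this

theorem exists_reading (T : Filling) {u : List ℤ} (hu : u.length = (reading T).length) :
    ∃ S, u = reading S ∧ S.map List.length = T.map List.length := by
  induction T generalizing u with
  | nil => exact ⟨[], List.eq_nil_of_length_eq_zero hu, rfl⟩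
  | cons C T ih =>
    rw [reading_cons, List.length_append] at hu
    obtain ⟨S, h1, h2⟩ := ih (u := u.take (reading T).length) (by
      rw [List.length_take]; omega)
    refine ⟨u.drop (reading T).length :: S, ?_, ?_⟩
    · rw [reading_cons, ← h1, List.take_append_drop]
    · rw [List.map_cons, List.map_cons, h2, List.length_drop]
      congr 1
      omega

theorem reading_injective {S T : Filling} (h : reading S = reading T)
    (hl : S.map List.length = T.map List.length) : S = T :=
  List.reverse_injective (List.eq_iff_flatten_eq.mpr ⟨h, by simp only [List.map_reverse, hl]⟩)

theorem exists_snoc {w u : List ℤ} {x : ℤ} (h : w.length = (u ++ [x]).length) :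
    ∃ v y, w = v ++ [y] ∧ v.length = u.length := by
  rw [List.length_append, List.length_singleton] at h
  rcases List.eq_nil_or_concat' w with rfl | ⟨v, y, rfl⟩
  · simp at h
  · exact ⟨v, y, rfl, by simpa using h⟩

theorem columnWord_of_snoc {i : ℕ} {D D₂ : List ℤ} {x x₂ : ℤ} (hD : ColumnWord X D)
    (h : wordF X i (D ++ [x]) = some (D₂ ++ [x₂])) : ColumnWord X D₂ := by
  rcases (wordF_append _ _ _).mp h with ⟨-, u, hu, h1⟩ | ⟨-, u, hu, h1⟩
  · obtain ⟨rfl, -⟩ := List.append_inj' h1 rfl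
    exact (columnWord_wordF hu).mp hD
  · have hl := wordF_length hu
    obtain ⟨rfl, -⟩ := List.append_inj' h1 (by rw [hl]; rfl)
    exact hD

/-- The insertion commutes with the lowering operators. -/
theorem Ins.lower {T F : Filling} {x : ℤ} (h : Ins X M T x F) {i : ℕ} (hi : i < M) {w : List ℤ}
    (hw : wordF X i (reading T ++ [x]) = some w) :
    ∃ T₂ x₂ F₂, w = reading T₂ ++ [x₂] ∧ Ins X M T₂ x₂ F₂ ∧
      T₂.map List.length = T.map List.length ∧ F₂.map List.length = F.map List.length ∧
      wordF X i (reading F) = some (reading F₂) := by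
  induction h generalizing w with
  | new x =>
    obtain ⟨y, rfl⟩ : ∃ y, w = [y] := List.length_eq_one_iff.mp (wordF_length hw)
    exact ⟨[], y, [[y]], rfl, .new y, rfl, rfl, by simpa [reading] using hw⟩
  | app D T x h =>
    rw [reading_cons, List.append_assoc] at hw
    rcases (wordF_append _ _ _).mp hw with ⟨h1, u, hu, rfl⟩ | ⟨h1, u, hu, rfl⟩
    · obtain ⟨S, rfl, hS⟩ := exists_reading T (wordF_length hu)
      refine ⟨D :: S, x, (D ++ [x]) :: S, by rw [reading_cons, List.append_assoc],
        .app D S x h, by simp [hS], by simp [hS], ?_⟩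
      rw [reading_cons, reading_cons]
      exact wordF_append_left h1 hu
    · obtain ⟨D₂, x₂, rfl, hl⟩ := exists_snoc (wordF_length hu)
      refine ⟨D₂ :: T, x₂, (D₂ ++ [x₂]) :: T, by rw [reading_cons, List.append_assoc],
        .app D₂ T x₂ ((columnWord_wordF hu).mp h), by simp [hl], by simp [hl], ?_⟩
      rw [reading_cons, reading_cons]
      exact wordF_append_right h1 hu
  | pass D D' T T' x z h h' ih =>
    rw [reading_cons, List.append_assoc] at hw
    have e1 := h.sim.eps_eq hi
    have e2 := h'.sim.phi_eq hi
    rw [eps_cons] at e1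
    rw [phi_append, eps_singleton, phi_singleton] at e2
    rcases (wordF_append _ _ _).mp hw with ⟨h1, u, hu, rfl⟩ | ⟨h1, u, hu, rfl⟩
    -- The inequality selecting `reading T` against `D ++ [x]` also selects it against `z` alone,
    -- because `ε_i z ≤ ε_i (z :: D')`; the induction hypothesis therefore applies to `reading T ++
    -- [z]`.
    · obtain ⟨T₂, x₂, F₂, h2, h3, h4, h5, h6⟩ := ih (w := u ++ [z])
        (wordF_append_left (by rw [eps_singleton]; omega) hu)
      obtain ⟨rfl, h7⟩ := List.append_inj' h2 rfl
      simp only [List.cons.injEq, and_true] at h7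
      subst h7
      refine ⟨D :: T₂, x, D' :: F₂, by rw [reading_cons, List.append_assoc],
        .pass _ _ _ _ _ _ h h3, by simp [h4], by simp [h5], ?_⟩
      rw [reading_cons, reading_cons]
      exact wordF_append_left (by omega) h6
    · obtain ⟨s, h2, h3⟩ := h.sim.lower hi hu
      have hc := columnWord_wordF hu
      have hf : Full X M u := h.full.connected (.rel _ _ ⟨i, hi, hu⟩)
      have hc' := columnWord_wordF h2
      obtain ⟨D₂, x₂, rfl, hl⟩ := exists_snoc (wordF_length hu)
      have hD₂ := columnWord_of_snoc h.column hu
      -- On the bumped side `z :: D'` the operator changes either `z`, and the change is forwarded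
      -- to the next columns by induction, or `D'`, and the later columns are not affected.
      rcases wordF_cons_some.mp h2 with ⟨h4, z₂, hz, rfl⟩ | ⟨h4, D₂', hz, rfl⟩
      · obtain ⟨T₂, x₃, F₂, h5, h6, h7, h8, h9⟩ := ih (w := reading T ++ [z₂])
          (wordF_append_right (by rw [eps_singleton]; omega) (wordF_letter (by rw [eps_nil]; omega) hz))
        obtain ⟨h10, h11⟩ := List.append_inj' h5 rfl
        simp only [List.cons.injEq, and_true] at h11
        subst h11
        refine ⟨D₂ :: T₂, x₂, D' :: F₂, by rw [reading_cons, List.append_assoc, h10],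
          .pass _ _ _ _ _ _ ⟨hf, h3, hD₂, by rw [← hc]; exact h.not_column, h.column',
            by rw [← hc']; exact h.not_column', by rw [hl, h.length]⟩ h6, by simp [h7, hl],
          by simp [h8], ?_⟩
        rw [reading_cons, reading_cons]
        exact wordF_append_left (by omega) h9
      · have hl' := wordF_length hz
        refine ⟨D₂ :: T, x₂, D₂' :: T', by rw [reading_cons, List.append_assoc],
          .pass _ _ _ _ _ _ ⟨hf, h3, hD₂, by rw [← hc]; exact h.not_column,
            (columnWord_wordF hz).mp h.column', by rw [← hc']; exact h.not_column',
            by rw [hl, hl', h.length]⟩ h', by simp [hl],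
          by simp [hl'], ?_⟩
        rw [reading_cons, reading_cons]
        exact wordF_append_right (by omega) hz

/-! ### Insertion in a highest weight tableau -/

/-- For `j = 0` both sides are sources of the same weight. The operator of colour `M - j - 1` then
moves the extra letter one step on both sides: it does not act in the column, which contains both
letters of this colour's arrow and has `ε = φ = 0`. -/
theorem sim_highColumn_rotate {h j : ℕ} (hX : ValidRank X M) (hj : j < h) (hh : h ≤ M) :
    Sim X M (highColumn M h ++ [(j : ℤ) - M]) (((j : ℤ) - M) :: highColumn M h) := by
  have hs := isSource_highColumn (X := X) hh
  induction j with
  | zero =>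
    have e : [((0 : ℕ) : ℤ) - M] = highColumn M 1 := by simp [highColumn]
    have h1 := isSource_highColumn (X := X) (M := M) (h := 1) (by omega)
    refine sim_of_weights hX ?_ ?_ fun k _ _ => ?_
    · rw [e]; exact hs.append h1
    · rw [← List.singleton_append, e]; exact h1.append hs
    · rw [weightCoord_append, weightCoord_cons _ (highColumn M h)]
  | succ j ih =>
    have ih := ih (by omega)
    obtain ⟨c, hc⟩ : ∃ c : ℕ, (c : ℤ) + 2 = M - j := ⟨M - j - 2, by omega⟩
    have e1 : (j : ℤ) - M = -((c : ℤ) + 2) := by omega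
    have hl : letterF X (c + 1) ((j : ℤ) - M) = some (((j + 1 : ℕ) : ℤ) - M) := by
      rw [letterF_succ, if_pos (Or.inl e1)]
      push_cast
      congr 1
      ring
    have hp : 0 < letterPhi X (c + 1) ((j : ℤ) - M) := by
      rw [letterPhi_succ, if_pos (Or.inl e1)]; omega
    have hphi : phi X (c + 1) (highColumn M h) = 0 := by
      have h1 := phi_sub_eps_succ X c (highColumn M h)
      have hnd : (highColumn M h).Nodup := by
        unfold highColumn
        exact List.Nodup.map (fun a b h => by have h : (a : ℤ) - M = b - M := h; omega)
          List.nodup_range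
      simp only [weightCoord] at h1
      rw [hs (c + 1) (by omega), hnd.count, hnd.count, hnd.count, hnd.count,
        if_pos (mem_highColumn.mpr (by push_cast; omega)),
        if_neg (fun h => by have := mem_highColumn.mp h; push_cast at this; omega),
        if_pos (mem_highColumn.mpr (by push_cast; omega)),
        if_neg (fun h => by have := mem_highColumn.mp h; push_cast at this; omega)] at h1
      omega
    have hL : wordF X (c + 1) (highColumn M h ++ [(j : ℤ) - M]) =
        some (highColumn M h ++ [((j + 1 : ℕ) : ℤ) - M]) :=
      wordF_append_right (by omega) (wordF_letter (by simpa using hp) hl)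
    have hR : wordF X (c + 1) (((j : ℤ) - M) :: highColumn M h) =
        some ((((j + 1 : ℕ) : ℤ) - M) :: highColumn M h) :=
      wordF_cons_some.mpr (Or.inl ⟨by rw [hs (c + 1) (by omega)]; exact hp, _, hl, rfl⟩)
    obtain ⟨b, h2, h3⟩ := ih.lower (by omega) hL
    rwa [Option.some.inj (hR.symm.trans h2)]

theorem slide_highColumn {h j : ℕ} (hX : ValidRank X M) (hj : j < h) (hh : h ≤ M) :
    Slide X M (highColumn M h) ((j : ℤ) - M) ((j : ℤ) - M) (highColumn M h) where
  full := by
    refine ⟨_, .refl _, fun x hx => ?_⟩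
    rcases List.mem_append.mp hx with hx | hx
    · exact barred_highColumn hh x hx
    · rw [List.mem_singleton] at hx; omega
  sim := sim_highColumn_rotate hX hj hh
  column := columnWord_highColumn M hh
  not_column := by
    intro hc
    obtain ⟨h, rfl⟩ : ∃ h', h = h' + 1 := ⟨h - 1, by omega⟩
    rw [highColumn_succ] at hc
    have := (List.isChain_append.mp hc).2.2 ((h : ℤ) - M) (by simp) ((j : ℤ) - M) (by simp)
    cases X <;> simp only [Desc] at this <;> omega
  column' := columnWord_highColumn M hh
  not_column' := by
    intro hc
    have := hc.rel_head? (y := -(M : ℤ)) (by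
      obtain ⟨h, rfl⟩ : ∃ h', h = h' + 1 := ⟨h - 1, by omega⟩
      simp [highColumn, List.range_succ_eq_map])
    cases X <;> simp only [Desc] at this <;> omega
  length := rfl

/-- At highest weight the letter `j - M` crosses unchanged the columns of height greater than `j`
and stops below the first column of height `j`, or opens a new column when `j = 0`. The bound `b`
records the height available to the left, which keeps the shape a Young diagram. -/
theorem ins_highestFilling (hX : ValidRank X M) (T : Filling) {j b : ℕ} (hT : HasYoungShape T)
    (hb : ∀ C ∈ T, C.length ≤ b) (hj : j = 0 ∨ ∃ C ∈ T, C.length = j) (hjb : j + 1 ≤ b)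
    (hbM : b ≤ M) : ∃ F, Ins X M (highestFilling M T) ((j : ℤ) - M) F ∧ HasYoungShape F ∧
      (∀ C ∈ F, C.length ≤ b) ∧ F = highestFilling M F := by
  induction T generalizing b with
  | nil =>
    have hj0 : j = 0 := by simpa using hj
    subst hj0
    refine ⟨_, .new _, ⟨by simp, by simp⟩, by simpa using hjb, ?_⟩
    simp [highestFilling_eq, highColumn]
  | cons C T ih =>
    have hC := hb C (by simp)
    have hCT : ∀ D ∈ T, D.length ≤ C.length := by
      have := hT.2
      rw [List.map_cons, List.pairwise_cons] at this
      intro D hD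
      exact this.1 _ (List.mem_map.mpr ⟨D, hD, rfl⟩)
    have hT' : HasYoungShape T := by
      have := hT.2
      rw [List.map_cons, List.pairwise_cons] at this
      exact ⟨fun D hD => hT.1 D (by simp [hD]), this.2⟩
    have hC0 : 0 < C.length := List.length_pos_iff.mpr (hT.1 C (by simp))
    have hjC : j ≤ C.length := by
      rcases hj with rfl | ⟨D, hD, rfl⟩
      · omega
      · rcases List.mem_cons.mp hD with rfl | hD
        · exact le_rfl
        · exact hCT D hD
    have eT : highestFilling M (highestFilling M T) = highestFilling M T := by
      simp [highestFilling_eq]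
    rw [highestFilling_eq, List.map_cons, ← highestFilling_eq]
    rcases hjC.eq_or_lt with hjC | hjC
    · have e : highColumn M C.length ++ [(j : ℤ) - M] = highColumn M (C.length + 1) := by
        rw [highColumn_succ, hjC]
      refine ⟨_, .app _ _ _ (by rw [e]; exact columnWord_highColumn M (by omega)), ⟨?_, ?_⟩, ?_, ?_⟩
      · intro D hD
        rcases List.mem_cons.mp hD with rfl | hD
        · simp
        · rw [highestFilling_eq] at hD
          obtain ⟨E, hE, rfl⟩ := List.mem_map.mp hD
          have := List.length_pos_iff.mpr (hT'.1 E hE)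
          intro h0
          have := congrArg List.length h0
          simp only [length_highColumn, List.length_nil] at this
          omega
      · have el : (highestFilling M T).map List.length = T.map List.length := by
          simp [highestFilling_eq, Function.comp_def]
        rw [List.map_cons, el, List.pairwise_cons]
        refine ⟨fun a ha => ?_, hT'.2⟩
        obtain ⟨E, hE, rfl⟩ := List.mem_map.mp ha
        have := hCT E hE
        simp only [List.length_append, length_highColumn, List.length_singleton]
        omega
      · intro D hD
        rcases List.mem_cons.mp hD with rfl | hD
        · simp only [List.length_append, length_highColumn, List.length_singleton]
          omega
        · rw [highestFilling_eq] at hD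
          obtain ⟨E, hE, rfl⟩ := List.mem_map.mp hD
          have := hb E (by simp [hE])
          simpa using this
      · rw [highestFilling_eq M (_ :: _), List.map_cons, ← highestFilling_eq, eT, e, length_highColumn]
    · obtain ⟨F, h1, h2, h3, h4⟩ := ih hT' hCT (by
        rcases hj with rfl | ⟨D, hD, rfl⟩
        · exact Or.inl rfl
        · rcases List.mem_cons.mp hD with rfl | hD
          · omega
          · exact Or.inr ⟨D, hD, rfl⟩) (by omega) (by omega)
      refine ⟨_, .pass _ _ _ _ _ _ (slide_highColumn hX hjC (by omega)) h1, ⟨?_, ?_⟩, ?_, ?_⟩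
      · intro D hD
        rcases List.mem_cons.mp hD with rfl | hD
        · exact List.length_pos_iff.mp (by simpa using hC0)
        · exact h2.1 D hD
      · rw [List.map_cons, List.pairwise_cons]
        refine ⟨fun a ha => ?_, h2.2⟩
        obtain ⟨E, hE, rfl⟩ := List.mem_map.mp ha
        simpa using h3 E hE
      · intro D hD
        rcases List.mem_cons.mp hD with rfl | hD
        · simpa using hC
        · exact (h3 D hD).trans hC
      · conv_rhs => rw [highestFilling_eq, List.map_cons, ← highestFilling_eq, ← h4,
          length_highColumn]

theorem PlusTableau.of_lengths {F S : Filling} (hF : PlusTableau X M F)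
    (hl : S.map List.length = F.map List.length) (hc : Connected X M (reading F) (reading S)) :
    PlusTableau X M S := by
  have hmem : ∀ C ∈ S, ∃ D ∈ F, D.length = C.length := by
    intro C hC
    have : C.length ∈ F.map List.length := hl ▸ List.mem_map.mpr ⟨C, hC, rfl⟩
    simpa using this
  refine ⟨⟨fun C hC => ?_, by rw [hl]; exact hF.1.2⟩, fun C hC => ?_, ?_⟩
  · obtain ⟨D, hD, h⟩ := hmem C hC
    have := List.length_pos_iff.mpr (hF.1.1 D hD)
    exact List.length_pos_iff.mp (by omega)
  · obtain ⟨D, hD, h⟩ := hmem C hC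
    have := hF.2.1 D hD
    omega
  · have : highestFilling M S = highestFilling M F := by
      rw [highestFilling_eq, highestFilling_eq]
      have := congrArg (List.map (highColumn M)) hl
      simpa only [List.map_map, Function.comp_def] using this
    rw [this]
    exact hF.2.2.trans _ _ _ hc

theorem Ins.of_raises {T F : Filling} {x : ℤ} (h : Ins X M T x F) {w : List ℤ}
    (hw : Raises X (· < M) w (reading T ++ [x])) :
    ∃ T₂ x₂ F₂, w = reading T₂ ++ [x₂] ∧ Ins X M T₂ x₂ F₂ ∧
      T₂.map List.length = T.map List.length ∧ F₂.map List.length = F.map List.length ∧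
      Connected X M (reading F) (reading F₂) := by
  induction hw using Relation.ReflTransGen.head_induction_on with
  | refl => exact ⟨T, x, F, rfl, h, rfl, rfl, .refl _⟩
  | head h1 _ ih =>
    obtain ⟨i, hi, h2⟩ := h1
    obtain ⟨T₂, x₂, F₂, rfl, h3, h4, h5, h6⟩ := ih
    obtain ⟨T₃, x₃, F₃, h7, h8, h9, h10, h11⟩ := h3.lower hi h2
    exact ⟨T₃, x₃, F₃, h7, h8, h9.trans h4, h10.trans h5,
      h6.trans _ _ _ (.rel _ _ ⟨i, hi, h11⟩)⟩

/-- The insertion of a letter in a tableau is possible when the rank is large, and gives a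
tableau. -/
theorem PlusTableau.exists_ins (hX : ValidRank X M) {T : Filling} {x : ℤ}
    (hT : PlusTableau X M T) (hf : Full X M (reading T ++ [x])) :
    ∃ F, Ins X M T x F ∧ PlusTableau X M F := by
  obtain ⟨s, h1, h2, h3⟩ := hf.exists_source
  obtain ⟨u, t, rfl, hu, ht⟩ := h1.append
  obtain ⟨y, rfl⟩ : ∃ y, t = [y] := List.length_eq_one_iff.mp ht.length_eq
  obtain ⟨hHb, hHs⟩ := reading_highestFilling_spec (X := X) hT.2.1
  have hu' : u = reading (highestFilling M T) :=
    source_unique h2.left hHs ((hu.connected (fun _ h => h)).symm.trans _ _ _ hT.2.2.symm)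
  subst hu'
  have hy := h3 y (by simp)
  obtain ⟨j, rfl⟩ : ∃ j : ℕ, y = (j : ℤ) - M := ⟨(y + M).toNat, by omega⟩
  -- For `j > 0` the source condition requires `φ > 0` on the highest filling for the colour `M -
  -- j`, and this `φ` is the number of columns of height exactly `j`.
  have hj : j = 0 ∨ ∃ C ∈ T, C.length = j := by
    rcases Nat.eq_zero_or_pos j with h0 | h0
    · exact Or.inl h0
    right
    obtain ⟨c, hc⟩ : ∃ c : ℕ, (c : ℤ) + 1 = M - j := ⟨M - j - 1, by omega⟩
    have h4 := h2 (c + 1) (by omega)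
    rw [eps_append, eps_singleton, letterEps_succ, if_pos (by omega)] at h4
    have h5 := phi_sub_eps_succ X c (reading (highestFilling M T))
    rw [hHs _ (by omega)] at h5
    simp only [weightCoord] at h5
    have hpos : ∀ k : ℕ, 0 < k → (reading (highestFilling M T)).count (k : ℤ) = 0 := by
      intro k hk
      exact List.count_eq_zero_of_not_mem fun hk' => by have := hHb _ hk'; omega
    rw [hpos _ (by omega), hpos _ (by omega)] at h5
    obtain ⟨j, rfl⟩ : ∃ i, j = i + 1 := ⟨j - 1, by omega⟩
    have e1 : -((c + 2 : ℕ) : ℤ) = (j : ℤ) - M := by push_cast at hc ⊢; omega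
    have e2 : -((c + 1 : ℕ) : ℤ) = ((j + 1 : ℕ) : ℤ) - M := by push_cast at hc ⊢; omega
    rw [e1, e2, count_reading_highestFilling, count_reading_highestFilling]
      at h5
    by_contra hc'
    have : (T.map List.length).countP (fun h => decide (j < h)) =
        (T.map List.length).countP (fun h => decide (j + 1 < h)) := by
      refine List.countP_congr fun a ha => ?_
      obtain ⟨C, hC, rfl⟩ := List.mem_map.mp ha
      have : C.length ≠ j + 1 := fun h => hc' ⟨C, hC, h⟩
      simp only [decide_eq_true_eq]
      omega
    omega
  obtain ⟨F, h4, h5, h6, h7⟩ := ins_highestFilling hX T hT.1 hT.2.1 hj (by omega) le_rfl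
  have hF : PlusTableau X M F := ⟨h5, h6, by rw [← h7]; exact .refl _⟩
  obtain ⟨T₂, x₂, F₂, h8, h9, h10, h11, h12⟩ := h4.of_raises h1
  obtain ⟨h13, h14⟩ := List.append_inj' h8 rfl
  simp only [List.cons.injEq, and_true] at h14
  have : T₂ = T := by
    refine reading_injective h13.symm (h10.trans ?_)
    simp [highestFilling_eq, Function.comp_def]
  subst this h14
  exact ⟨F₂, h9, hF.of_lengths h11 h12⟩

/-! ### Removal of the first letter of the reading -/

/-- The filling without its rightmost letter in the first row. -/
def pop : Filling → Filling
  | [] => []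
  | [C] => if C.tail = [] then [] else [C.tail]
  | C :: D :: T => C :: pop (D :: T)

theorem reading_pop {T : Filling} (hT : ∀ C ∈ T, C ≠ []) : reading (pop T) = (reading T).tail := by
  induction T with
  | nil => rfl
  | cons C T ih =>
    cases T with
    | nil =>
      unfold pop
      split_ifs with h
      · simp [reading, h]
      · simp [reading]
    | cons D T =>
      have hne : reading (D :: T) ≠ [] := by
        rw [reading_cons]
        simp [hT D (by simp)]
      rw [pop, reading_cons, ih fun E hE => hT E (by simp [hE]), reading_cons C,
        List.tail_append_of_ne_nil hne]

theorem length_le_of_mem_pop {T : Filling} {b : ℕ} (hT : ∀ C ∈ T, C.length ≤ b) :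
    ∀ C ∈ pop T, C.length ≤ b := by
  induction T with
  | nil => simp [pop]
  | cons C T ih =>
    cases T with
    | nil =>
      unfold pop
      have := hT C (by simp)
      split_ifs
      · simp
      · simp only [List.mem_singleton, forall_eq, List.length_tail]; omega
    | cons D T =>
      have ih := ih fun E hE => hT E (by simp [hE])
      intro E hE
      rcases List.mem_cons.mp hE with rfl | hE
      · exact hT _ (by simp)
      · exact ih E hE

theorem HasYoungShape.pop {T : Filling} (hT : HasYoungShape T) : HasYoungShape (pop T) := by
  induction T with
  | nil => exact hT
  | cons C T ih =>
    cases T with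
    | nil =>
      unfold OrthogonalTableaux.pop
      split_ifs with h
      · exact ⟨by simp, by simp⟩
      · exact ⟨by simpa using h, by simp⟩
    | cons D T =>
      have h2 := hT.2
      rw [List.map_cons, List.pairwise_cons] at h2
      have ih := ih ⟨fun E hE => hT.1 E (by simp [hE]), h2.2⟩
      refine ⟨fun E hE => ?_, ?_⟩
      · rcases List.mem_cons.mp hE with rfl | hE
        · exact hT.1 _ (by simp)
        · exact ih.1 E hE
      · rw [OrthogonalTableaux.pop, List.map_cons, List.pairwise_cons]
        refine ⟨fun a ha => ?_, ih.2⟩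
        obtain ⟨E, hE, rfl⟩ := List.mem_map.mp ha
        exact length_le_of_mem_pop (b := C.length) (fun F hF =>
          h2.1 _ (List.mem_map.mpr ⟨F, hF, rfl⟩)) E hE

theorem Connected.append_source {u v s : List ℤ} (h : Connected X M u v) (hs : IsSource X M s) :
    Connected X M (u ++ s) (v ++ s) := by
  induction h with
  | rel a b hab =>
    obtain ⟨i, hi, h⟩ := hab
    refine .rel _ _ ⟨i, hi, wordF_append_left ?_ h⟩
    rw [hs i hi]
    exact phi_pos_of_wordF h
  | refl => exact .refl _
  | symm _ _ _ ih => exact ih.symm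
  | trans _ _ _ _ _ ih1 ih2 => exact ih1.trans _ _ _ ih2

/-- A highest weight column deprived of its top letter is a shorter one moved down by one. The
letters are moved one at a time starting from the bottom; `B` collects those already moved, which
must not interfere with the later moves. -/
theorem connected_highColumn_tail (t : ℕ) (B : List ℤ)
    (hB : ∀ b ∈ B, (t : ℤ) - M < b ∧ b ≤ -1) (ht : t + 1 ≤ M) :
    Connected X M (highColumn M t ++ B) ((highColumn M t).map (· + 1) ++ B) := by
  induction t generalizing B with
  | zero => exact .refl _
  | succ t ih =>
    have h1 := ih ((((t : ℤ) - M) + 1) :: B) (by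
      intro b hb
      rcases List.mem_cons.mp hb with rfl | hb
      · push_cast at *; omega
      · have := hB b hb; push_cast at this; omega) (by omega)
    rw [highColumn_succ, List.map_append, List.append_assoc, List.append_assoc]
    refine Relation.EqvGen.trans _ _ _ ?_ h1
    obtain ⟨c, hc⟩ : ∃ c : ℕ, (c : ℤ) + 2 = M - t := ⟨M - t - 2, by omega⟩
    have e1 : (t : ℤ) - M = -((c : ℤ) + 2) := by omega
    have hphi : phi X (c + 1) (highColumn M t) = 0 := by
      refine phi_eq_zero_of_forall fun x hx => ?_
      have := mem_highColumn.mp hx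
      rw [letterPhi_succ, if_neg (by omega)]
    have heps : eps X (c + 1) B = 0 := by
      refine eps_eq_zero_of_forall fun x hx => ?_
      have := hB x hx
      push_cast at this
      rw [letterEps_succ, if_neg (by omega)]
    refine .rel _ _ ⟨c + 1, by omega, wordF_append_right (by omega) ?_⟩
    refine wordF_cons_some.mpr (Or.inl ⟨?_, _, ?_, rfl⟩)
    · rw [letterPhi_succ, if_pos (Or.inl e1)]
      exact heps.trans_lt one_pos
    · rw [letterF_succ, if_pos (Or.inl e1)]

theorem connected_pop_highestFilling {T : Filling} (hT : ∀ C ∈ T, C ≠ [] ∧ C.length ≤ M) :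
    Connected X M (reading (highestFilling M (pop T))) (reading (highestFilling M T)).tail := by
  induction T with
  | nil => exact .refl _
  | cons C T ih =>
    cases T with
    | nil =>
      obtain ⟨h1, h2⟩ := hT C (by simp)
      have h1 := List.length_pos_iff.mpr h1
      obtain ⟨h, hh⟩ : ∃ h, C.length = h + 1 := ⟨C.length - 1, by omega⟩
      have e : reading (highestFilling M (pop [C])) = highColumn M h := by
        unfold pop
        split_ifs with h0
        · have := congrArg List.length h0
          rw [List.length_tail, List.length_nil] at this
          obtain rfl : h = 0 := by omega
          rfl
        · simp [highestFilling_eq, reading, hh]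
      have e' : (reading (highestFilling M [C])).tail = (highColumn M h).map (· + 1) := by
        simp only [highestFilling_eq, reading, hh, highColumn, List.map_cons, List.map_nil,
          List.reverse_singleton, List.flatten_singleton, List.range_succ_eq_map, List.tail_cons,
          List.map_map]
        refine List.map_congr_left fun j _ => ?_
        simp only [Function.comp_apply]
        push_cast
        ring
      rw [e, e']
      simpa using connected_highColumn_tail (X := X) (M := M) h [] (by simp) (by omega)
    | cons D T =>
      have ih := ih fun E hE => hT E (by simp [hE])
      have hne : reading (highestFilling M (D :: T)) ≠ [] := by
        rw [reading_highestFilling_cons]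
        have := List.length_pos_iff.mpr (hT D (by simp)).1
        have h2 : highColumn M D.length ≠ [] := List.length_pos_iff.mp (by simpa using this)
        simp [h2]
      rw [pop, reading_highestFilling_cons, reading_highestFilling_cons,
        List.tail_append_of_ne_nil hne]
      exact ih.append_source (isSource_highColumn (hT C (by simp)).2)

/-- Raising operators act on a product through its factors, so raising the reading to its source
connects the tail of the one with the tail of the other; the latter is connected to the highest
filling of `pop T`. -/
theorem PlusTableau.pop {T : Filling} (hT : PlusTableau X M T) : PlusTableau X M (pop T) := by
  refine ⟨hT.1.pop, length_le_of_mem_pop hT.2.1, ?_⟩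
  refine (connected_pop_highestFilling fun C hC => ⟨hT.1.1 C hC, hT.2.1 C hC⟩).trans _ _ _ ?_
  rw [reading_pop hT.1.1]
  have hs := (reading_highestFilling_spec (X := X) hT.2.1).2
  have h1 := raises_of_connected hT.2.2.symm hs
  cases h : reading T with
  | nil =>
    rw [h] at h1
    have := List.eq_nil_of_length_eq_zero h1.length_eq
    rw [this]
    exact .refl _
  | cons x u =>
    rw [h] at h1
    obtain ⟨a, b, h2, h3, h4⟩ := Raises.append (u := [x]) (v := u) h1
    obtain ⟨y, rfl⟩ : ∃ y, a = [y] := List.length_eq_one_iff.mp h3.length_eq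
    rw [h2]
    exact (h4.connected (fun _ h => h)).symm

end Insertion

end OrthogonalTableaux

/-! ### Bounds on the letters during an insertion -/

namespace OrthogonalTableaux

section Bounds
variable {X : OType} {m M : ℕ}

/-! ### Letters of columns -/

theorem ColumnWord.head_of_not {x y : ℤ} {w : List ℤ} (h : ColumnWord X (y :: w))
    (h' : ¬ ColumnWord X (x :: y :: w)) : ¬ Desc X x y := by
  intro hd
  exact h' (List.isChain_cons_cons.mpr ⟨hd, h⟩)

/-- Columns increase strictly except for `0, 0` in type `B` and the descent `1, -1` in type `D`; the
latter is the reason for the maximum with `1`. -/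
theorem ColumnWord.le_max_last {v : List ℤ} {y : ℤ} (h : ColumnWord X (v ++ [y])) :
    ∀ a ∈ v ++ [y], a ≤ max y 1 := by
  induction v with
  | nil => simp
  | cons b v ih =>
    have h1 := ih h.tail
    intro a ha
    rcases List.mem_cons.mp ha with rfl | ha
    · have key : ∃ c ∈ v ++ [y], Desc X a c := by
        cases v with
        | nil => exact ⟨y, by simp, (List.isChain_cons_cons.mp h).1⟩
        | cons c v => exact ⟨c, by simp, (List.isChain_cons_cons.mp h).1⟩
      obtain ⟨c, hc, hd⟩ := key
      have := h1 c hc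
      cases X <;> simp only [Desc] at hd <;> omega
    · exact h1 a ha

/-- The letter `0` may be repeated, but it has `ε_0 = φ_0 = 1`, so its repetitions do not
accumulate. -/
theorem eps_columnWord_B {w : List ℤ} (h : ColumnWord OType.B w) :
    eps OType.B 0 w ≤ 2 ∧ (∀ y ∈ w.head?, 1 < y → eps OType.B 0 w = 0) := by
  induction w with
  | nil => simp
  | cons x w ih =>
    have ih := ih h.tail
    have hd : ∀ y ∈ w.head?, Desc OType.B x y := fun y hy => by
      exact h.rel_head? hy
    rw [eps_cons, letterEps_B_zero, letterPhi_B_zero]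
    have h1 : 1 ≤ x → eps OType.B 0 w = 0 := by
      intro hx
      cases w with
      | nil => rfl
      | cons y w =>
        have := hd y (by simp)
        simp only [Desc] at this
        exact ih.2 y (by simp) (by omega)
    have h2 := ih.1
    refine ⟨?_, ?_⟩
    · split_ifs <;> omega
    · intro y hy hy1
      simp only [List.head?_cons, Option.mem_def, Option.some.injEq] at hy
      subst hy
      rw [h1 (by omega), if_neg (by omega), if_neg (by omega)]
      omega

/-- Only `i + 2` and `-(i + 1)` have positive `ε`, and as `1 ≤ i` neither is among the letters `0`,
`1`, `-1` that a column may repeat. -/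
theorem eps_columnWord_succ {i : ℕ} (hi : 1 ≤ i) {w : List ℤ} (h : ColumnWord X w) :
    eps X (i + 1) w ≤ 2 ∧ (∀ y ∈ w.head?, -((i : ℤ) + 1) < y → eps X (i + 1) w ≤ 1) ∧
      (∀ y ∈ w.head?, (i : ℤ) + 2 < y → eps X (i + 1) w = 0) := by
  induction w with
  | nil => simp
  | cons x w ih =>
    obtain ⟨i1, i2, i3⟩ := ih h.tail
    have hd : ∀ y ∈ w.head?, x < y ∨ (x = 1 ∧ y = -1) ∨ (x = 0 ∧ y = 0) := by
      intro y hy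
      have := h.rel_head? hy
      cases X <;> simp only [Desc] at this <;> omega
    have h1 : (i : ℤ) + 2 ≤ x → eps X (i + 1) w = 0 := by
      intro hx
      cases w with
      | nil => rfl
      | cons y w =>
        have := hd y (by simp)
        exact i3 y (by simp) (by omega)
    have h2 : -((i : ℤ) + 1) ≤ x → eps X (i + 1) w ≤ 1 := by
      intro hx
      cases w with
      | nil => simp
      | cons y w =>
        have := hd y (by simp)
        exact i2 y (by simp) (by omega)
    simp only [List.head?_cons, Option.mem_def, Option.some.injEq, forall_eq']
    rw [eps_cons, letterEps_succ, letterPhi_succ]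
    refine ⟨?_, fun hx => ?_, fun hx => ?_⟩
    · split_ifs <;> omega
    · split_ifs <;> omega
    · rw [h1 (by omega), if_neg (by omega)]; omega

theorem ColumnWord.not_mem {b y : ℤ} {w : List ℤ} (h : ColumnWord X (b :: w)) (hy : y ≠ 0)
    (hb : y < b) (hD : X = OType.D → y = -1 → b ≠ 1) : y ∉ b :: w := by
  induction w generalizing b with
  | nil => simpa using hb.ne
  | cons c w ih =>
    obtain ⟨h1, h2⟩ := List.isChain_cons_cons.mp h
    have h3 := ih h2 (by cases X <;> simp only [Desc, true_imp_iff] at h1 hD <;> omega)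
      (fun hX => by
        subst hX
        simp only [Desc, true_imp_iff] at h1 hD
        omega)
    rw [List.mem_cons, not_or]
    exact ⟨hb.ne, h3⟩

/-- The head of a column occurs there at least as often as its opposite. -/
theorem ColumnWord.count_neg_le {w : List ℤ} (h : ColumnWord X w) {x : ℤ} (hx : x ≠ 0) :
    w.count (-x) ≤ w.count x + 1 ∧ (x ∈ w.head? → w.count (-x) ≤ w.count x) := by
  induction w with
  | nil => simp
  | cons a w ih =>
    obtain ⟨i1, i2⟩ := ih h.tail
    have hne : -x ≠ x := by omega
    refine ⟨?_, fun hax => ?_⟩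
    · rw [List.count_cons, List.count_cons]
      by_cases ha : a = -x
      · have : w.count (-x) ≤ w.count x := by
          cases w with
          | nil => simp
          | cons b w =>
            obtain ⟨h1, h2⟩ := List.isChain_cons_cons.mp h
            by_cases hb : b = x
            · exact i2 (by simp [hb])
            · rw [List.count_eq_zero_of_not_mem (ColumnWord.not_mem h2 (neg_ne_zero.mpr hx) ?_ ?_)]
              · omega
              · cases X <;> simp only [Desc] at h1 <;> omega
              · intro _ h3; omega
        rw [if_pos (by simp [ha])]
        split_ifs <;> omega
      · rw [if_neg (by simp [ha])]
        split_ifs <;> omega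
    · simp only [List.head?_cons, Option.mem_def, Option.some.injEq] at hax
      subst hax
      rw [List.count_cons, List.count_cons, if_neg (by rw [beq_iff_eq]; omega), if_pos (by simp)]
      omega

/-! ### Sums of letters -/

theorem sum_mul_weightCoord_singleton (M : ℕ) (x : ℤ) :
    ∑ k ∈ Finset.range M, ((k : ℤ) + 1) * weightCoord [x] (k + 1) =
      if |x| ≤ (M : ℤ) then -x else 0 := by
  induction M with
  | zero =>
    simp only [Finset.range_zero, Finset.sum_empty, Nat.cast_zero, abs_nonpos_iff]
    split_ifs <;> omega
  | succ M ih =>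
    rw [Finset.sum_range_succ, ih, weightCoord_singleton]
    simp only [abs_le]
    push_cast
    by_cases h1 : x = -((M : ℤ) + 1)
    · subst h1
      rw [if_neg (by omega), if_pos (by omega), if_neg (by omega), if_pos (by omega)]
      ring
    · by_cases h2 : x = (M : ℤ) + 1
      · subst h2
        rw [if_neg (by omega), if_neg (by omega), if_pos (by omega), if_pos (by omega)]
        ring
      · rw [if_neg h1, if_neg h2]
        split_ifs <;> omega

/-- The sum of the letters is a linear form in the weight, hence an invariant of bisimilarity. A
slide that increases the travelling letter must decrease the sum of the column. -/
theorem sum_eq_neg_sum_weightCoord {w : List ℤ} (hw : ∀ x ∈ w, |x| ≤ (M : ℤ)) :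
    w.sum = -∑ k ∈ Finset.range M, ((k : ℤ) + 1) * weightCoord w (k + 1) := by
  induction w with
  | nil => simp [weightCoord]
  | cons x w ih =>
    have h1 : ∑ k ∈ Finset.range M, ((k : ℤ) + 1) * weightCoord (x :: w) (k + 1) =
        ∑ k ∈ Finset.range M, ((k : ℤ) + 1) * weightCoord w (k + 1) +
          ∑ k ∈ Finset.range M, ((k : ℤ) + 1) * weightCoord [x] (k + 1) := by
      rw [← Finset.sum_add_distrib]
      exact Finset.sum_congr rfl fun k _ => by rw [weightCoord_cons]; ring
    rw [List.sum_cons, ih fun y hy => hw y (by simp [hy]), h1, sum_mul_weightCoord_singleton,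
      if_pos (hw x (by simp))]
    ring

theorem InAlphabet.abs_le {x : ℤ} (h : InAlphabet X m x) : |x| ≤ (m : ℤ) := by
  cases X
  · exact h
  · exact h.1

theorem Sim.sum_eq (hX : ValidRank X M) (hM : 1 ≤ M) {a b : List ℤ} (h : Sim X M a b)
    (ha : ∀ x ∈ a, InAlphabet X M x) (hb : ∀ x ∈ b, InAlphabet X M x) : a.sum = b.sum := by
  rw [sum_eq_neg_sum_weightCoord fun x hx => (ha x hx).abs_le,
    sum_eq_neg_sum_weightCoord fun x hx => (hb x hx).abs_le]
  congr 1
  refine Finset.sum_congr rfl fun k hk => ?_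
  rw [Finset.mem_range] at hk
  rw [h.weightCoord_eq hX hM (by omega) (by omega)]

theorem Full.inAlphabet (hX : ValidRank X M) {w : List ℤ} (h : Full X M w) :
    ∀ x ∈ w, InAlphabet X M x := by
  obtain ⟨b, h1, h2⟩ := h
  refine (connected_inAlphabet hX h1).mpr fun x hx => ?_
  have := h2 x hx
  cases X <;> simp only [InAlphabet, _root_.abs_le] <;> omega

theorem Slide.full' (hX : ValidRank X M) (hM : 1 ≤ M) {D D' : List ℤ} {x z : ℤ}
    (h : Slide X M D x z D') : Full X M (z :: D') :=
  h.full.sim hX hM h.sim (by simp [h.length])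

theorem Slide.sum_eq (hX : ValidRank X M) (hM : 1 ≤ M) {D D' : List ℤ} {x z : ℤ}
    (h : Slide X M D x z D') : D.sum + x = z + D'.sum := by
  have := h.sim.sum_eq hX hM (h.full.inAlphabet hX) ((h.full' hX hM).inAlphabet hX)
  simpa using this

theorem Slide.ne_nil {D D' : List ℤ} {x z : ℤ} (h : Slide X M D x z D') : D ≠ [] := by
  rintro rfl
  exact h.not_column (by simp [ColumnWord])

/-- Since `x` cannot be stacked below the last letter of `D`, it does not exceed that letter, apart
from the incomparable pair `-1`, `1` of type `D`, covered by `1 ≤ b`. A letter that slides through a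
column is thus controlled by the column. -/
theorem Slide.le_of_mem (hX : ValidRank X M) {D D' : List ℤ} {x z b : ℤ} (h : Slide X M D x z D')
    (hb : ∀ a ∈ D, a ≤ b) (hb1 : 1 ≤ b) : x ≤ b := by
  obtain ⟨D, c, rfl⟩ := (List.eq_nil_or_concat' D).resolve_left h.ne_nil
  have h1 : ¬ Desc X c x := by
    intro hd
    refine h.not_column (List.isChain_append.mpr ⟨h.column, by simp, ?_⟩)
    intro p hp q hq
    simp only [List.getLast?_append, List.getLast?_singleton, Option.some_or, Option.mem_def,
      Option.some.injEq, List.head?_cons] at hp hq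
    rwa [← hp, ← hq]
  have h2 := hb c (by simp)
  have h3 := h.full.inAlphabet hX c (by simp)
  cases X <;> simp only [Desc, InAlphabet] at h1 h3 <;> omega

/-! ### Raising operators of large colours -/

/-- The letter `y` is obtained from `x` by raising operators with colours in `J`. -/
def LetterRaises (X : OType) (J : ℕ → Prop) : ℤ → ℤ → Prop :=
  Relation.ReflTransGen (fun a b => ∃ i, J i ∧ letterF X i b = some a)

theorem raises_singleton {J : ℕ → Prop} {x : ℤ} {t : List ℤ} (h : Raises X J [x] t) :
    ∃ y, t = [y] ∧ LetterRaises X J x y := by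
  induction h with
  | refl => exact ⟨x, rfl, .refl⟩
  | tail _ h1 ih =>
    obtain ⟨i, hi, h2⟩ := h1
    obtain ⟨y, rfl, hy⟩ := ih
    obtain ⟨a, b, p, q, rfl, h5, h6⟩ := wordF_change h2
    have hab : a = [] ∧ b = [] := by
      have := congrArg List.length h5
      simp only [List.length_append, List.length_cons, List.length_nil] at this
      exact ⟨List.eq_nil_of_length_eq_zero (by omega), List.eq_nil_of_length_eq_zero (by omega)⟩
    obtain ⟨rfl, rfl⟩ := hab
    simp only [List.nil_append, List.cons.injEq, and_true] at h5
    subst h5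
    exact ⟨p, rfl, hy.tail ⟨i, hi, h6⟩⟩

theorem letterRaises_ge {J : ℕ → Prop} {g : ℕ} (hJ : ∀ i, J i → g < i) {x y : ℤ}
    (h : LetterRaises X J x y) (hx : (g : ℤ) + 1 ≤ x) : (g : ℤ) + 1 ≤ y ∧ y ≤ x := by
  induction h with
  | refl => exact ⟨hx, le_rfl⟩
  | tail _ h1 ih =>
    obtain ⟨i, hi, h2⟩ := h1
    have := hJ i hi
    obtain ⟨c, rfl⟩ : ∃ c, i = c + 1 := ⟨i - 1, by omega⟩
    rw [letterF_succ] at h2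
    split_ifs at h2
    simp only [Option.some.injEq] at h2
    omega

theorem raises_le {J : ℕ → Prop} {w v : List ℤ} {b : ℤ} (h : Raises X J w v) (hw : ∀ a ∈ w, a ≤ b) : ∀ a ∈ v, a ≤ b := by
  induction h with
  | refl => exact hw
  | tail _ h1 ih =>
    obtain ⟨i, hi, h2⟩ := h1
    obtain ⟨p, q, r, s, rfl, rfl, h3⟩ := wordF_change h2
    have h4 := letterF_lt h3
    intro a ha
    simp only [List.mem_append, List.mem_cons] at ha ih
    rcases ha with ha | rfl | ha
    · exact ih a (Or.inl ha)
    · have := ih s (Or.inr (Or.inl rfl)); omega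
    · exact ih a (Or.inr (Or.inr ha))

theorem raises_neg_not_mem {J : ℕ → Prop} {g : ℕ} (hJ : ∀ i, J i → g < i) {w v : List ℤ}
    (h : Raises X J w v) (hw : -(g : ℤ) ∉ w) : -(g : ℤ) ∉ v := by
  induction h with
  | refl => exact hw
  | tail _ h1 ih =>
    obtain ⟨i, hi, h2⟩ := h1
    obtain ⟨p, q, r, s, rfl, rfl, h3⟩ := wordF_change h2
    have := hJ i hi
    obtain ⟨c, rfl⟩ : ∃ c, i = c + 1 := ⟨i - 1, by omega⟩
    rw [letterF_succ] at h3
    split_ifs at h3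
    simp only [Option.some.injEq] at h3
    simp only [List.mem_append, List.mem_cons, not_or] at ih ⊢
    refine ⟨ih.1, by omega, ih.2.2⟩

theorem le_add_length_of_neg_mem {a n : ℕ} {w : List ℤ}
    (h : ∀ k : ℕ, a ≤ k → k ≤ n → -(k : ℤ) ∈ w) : n + 1 ≤ a + w.length := by
  have h1 : (Finset.Icc a n).image (fun k : ℕ => -(k : ℤ)) ⊆ w.toFinset := by
    intro y hy
    obtain ⟨k, hk, rfl⟩ := Finset.mem_image.mp hy
    rw [Finset.mem_Icc] at hk
    exact List.mem_toFinset.mpr (h k hk.1 hk.2)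
  have h2 := Finset.card_le_card h1
  rw [Finset.card_image_of_injective _ (fun a b h => by
    have h : -(a : ℤ) = -(b : ℤ) := h
    omega), Nat.card_Icc] at h2
  have := w.toFinset_card_le
  omega

/-- A bound for the letter pushed out of a column. -/
theorem Sim.head_le {w W : List ℤ} {z : ℤ} {b : ℕ} (h : Sim X M w (z :: W))
    (hw : ∀ a ∈ w, a ≤ (b : ℤ)) (hz : z ≤ M) : z ≤ (b : ℤ) + w.length + 1 := by
  by_contra hc
  -- There are more candidates `g` than letters in `w`. Colours above `g` raise `z` to `g + 1`,
  -- giving `ε_g > 0`; on the other side `w` keeps its letters at most `b` and never acquires `-g`,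
  -- so its `ε_g` vanishes.
  obtain ⟨g, hg1, hg2, hg3⟩ : ∃ g : ℕ, b + 1 ≤ g ∧ g ≤ b + w.length + 1 ∧ -(g : ℤ) ∉ w := by
    by_contra hg
    push Not at hg
    have := le_add_length_of_neg_mem (a := b + 1) (n := b + w.length + 1) hg
    omega
  obtain ⟨s, h1, h2⟩ := exists_raises X (J := fun i => g < i ∧ i < M) (fun i hi => hi.2) (z :: W)
  obtain ⟨w₀, h3, h4⟩ := h.symm.raises (fun i hi => hi.2) h1
  obtain ⟨t, W₀, rfl, h5, -⟩ := Raises.append (u := [z]) (v := W) h1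
  obtain ⟨z₀, rfl, h6⟩ := raises_singleton h5
  have hJ : ∀ i, (g < i ∧ i < M) → g < i := fun i hi => hi.1
  obtain ⟨h7, h8⟩ := letterRaises_ge hJ h6 (by omega)
  have h9 : z₀ = (g : ℤ) + 1 := by
    by_contra hne
    obtain ⟨c, rfl⟩ : ∃ c : ℕ, z₀ = (c : ℤ) + 2 := ⟨(z₀ - 2).toNat, by omega⟩
    have := h2 (c + 1) ⟨by omega, by omega⟩
    rw [List.singleton_append, eps_cons, letterEps_succ, if_pos (Or.inl rfl)] at this
    omega
  obtain ⟨c, rfl⟩ : ∃ c : ℕ, g = c + 1 := ⟨g - 1, by omega⟩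
  have h10 := h4.eps_eq (show c + 1 < M by omega)
  rw [List.singleton_append, eps_cons, letterEps_succ, if_pos (by push_cast at h9; omega),
    eps_eq_zero_of_forall (w := w₀)] at h10
  · omega
  · intro a ha
    have h11 := raises_le h3 hw a ha
    have h12 := raises_neg_not_mem hJ h3 hg3
    rw [letterEps_succ, if_neg]
    rintro (h13 | h13)
    · omega
    · push_cast at h12
      exact h12 (h13 ▸ ha)

/-- A bound for the last letter of a word. -/
theorem Sim.last_le (hX : ValidRank X M) {w P : List ℤ} {y : ℤ} {b : ℕ} (hb : 1 ≤ b)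
    (h : Sim X M w (P ++ [y])) (hw : ∀ a ∈ w, a ≤ (b : ℤ)) (hM : y + P.length + 1 ≤ M) :
    y ≤ b := by
  by_contra hc
  have hJ : ∀ i, (b < i ∧ i < M) → b < i := fun i hi => hi.1
  obtain ⟨s, h1, h2⟩ := exists_raises X (J := fun i => b < i ∧ i < M) (fun i hi => hi.2) (P ++ [y])
  obtain ⟨w₀, h3, h4⟩ := h.symm.raises (fun i hi => hi.2) h1
  obtain ⟨P₀, t, rfl, h5, h6⟩ := h1.append
  obtain ⟨y₀, rfl, h7⟩ := raises_singleton h6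
  obtain ⟨h8, h9⟩ := letterRaises_ge hJ h7 (by omega)
  obtain ⟨k₀, rfl⟩ : ∃ k : ℕ, y₀ = (k : ℤ) := ⟨y₀.toNat, by omega⟩
  have hlow := raises_le h3 hw
  -- The raised `w` has no letter `k₀ > b`, so its coordinate at `k₀` is nonnegative and the final
  -- letter `k₀` must be compensated inside `P₀`.
  have hwt : 1 ≤ weightCoord P₀ k₀ := by
    have h10 := h4.weightCoord_eq hX (by omega) (k := k₀) (by omega) (by omega)
    rw [weightCoord_append, weightCoord_singleton, if_neg (by omega), if_pos rfl] at h10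
    have h11 : 0 ≤ weightCoord w₀ k₀ := by
      rw [weightCoord, List.count_eq_zero_of_not_mem (a := (k₀ : ℤ))
        (fun hk => by have := hlow _ hk; omega)]
      omega
    omega
  -- Since `ε` of `P₀` vanishes for the colours above `b`, its coordinates are nondecreasing from
  -- `k₀` on. Hence `P₀` contains `-k₀, …, -M`, more letters than its length allows.
  have hall : ∀ k, k₀ ≤ k → k ≤ M → 1 ≤ weightCoord P₀ k := by
    intro k hk
    induction k, hk using Nat.le_induction with
    | base => intro _; exact hwt
    | succ k hk ih =>
      intro hkM
      obtain ⟨c, rfl⟩ : ∃ c, k = c + 1 := ⟨k - 1, by omega⟩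
      have h10 := phi_sub_eps_succ X c P₀
      have h11 := h2 (c + 1) ⟨by omega, by omega⟩
      rw [eps_append] at h11
      have := ih (by omega)
      simp only [Nat.add_assoc, Nat.reduceAdd] at *
      omega
  have h12 := le_add_length_of_neg_mem (a := k₀) (n := M) (w := P₀) (by
    intro k hk hkM
    have := hall k hk hkM
    rw [weightCoord] at this
    exact List.count_pos_iff.mp (by omega))
  rw [h5.length_eq] at h12
  omega

/-- A column does not get larger letters when it is traversed. -/
theorem Slide.le_of_mem' (hX : ValidRank X M) {D D' : List ℤ} {x z : ℤ} {b : ℕ} (hb : 1 ≤ b)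
    (h : Slide X M D x z D') (hD : ∀ a ∈ D, a ≤ (b : ℤ)) (hx : x ≤ b)
    (hM : ∀ a ∈ D', a + D.length + 2 ≤ M) : ∀ a ∈ D', a ≤ b := by
  rcases List.eq_nil_or_concat' D' with rfl | ⟨P, y, rfl⟩
  · simp
  have hl := h.length
  rw [List.length_append, List.length_singleton] at hl
  have h1 : y ≤ b := by
    refine Sim.last_le hX hb (w := D ++ [x]) (P := z :: P) h.sim ?_ ?_
    · intro a ha
      rcases List.mem_append.mp ha with ha | ha
      · exact hD a ha
      · rw [List.mem_singleton] at ha; rwa [ha]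
    · have := hM y (by simp)
      rw [List.length_cons]
      push_cast
      omega
  intro a ha
  have := h.column'.le_max_last a ha
  omega

theorem Slide.bumped_le (hX : ValidRank X M) (hM : 1 ≤ M) {D D' : List ℤ} {x z : ℤ} {b : ℕ}
    (h : Slide X M D x z D') (hD : ∀ a ∈ D, a ≤ (b : ℤ)) (hx : x ≤ b) :
    z ≤ (b : ℤ) + D.length + 2 := by
  have h1 := (h.full' hX hM).inAlphabet hX z (by simp)
  have h2 := _root_.abs_le.mp h1.abs_le
  have := h.sim.head_le (b := b) (by
    intro a ha
    rcases List.mem_append.mp ha with ha | ha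
    · exact hD a ha
    · rw [List.mem_singleton] at ha; rwa [ha]) h2.2
  rw [List.length_append, List.length_singleton] at this
  push_cast at this
  omega

end Bounds

end OrthogonalTableaux

/-! ### The letter pushed out is at least the inserted letter -/

namespace OrthogonalTableaux

section Order
variable {X : OType} {m M : ℕ}

/-! ### Comparison of the inserted letter and of the letter pushed out -/

/-- The number of letters `x` minus the number of letters `-x`. -/
def excess (x : ℤ) (w : List ℤ) : ℤ := (w.count x : ℤ) - (w.count (-x) : ℤ)

theorem excess_neg (k : ℕ) (w : List ℤ) : excess (-(k : ℤ)) w = weightCoord w k := by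
  simp [excess, weightCoord]

theorem excess_natCast (k : ℕ) (w : List ℤ) : excess (k : ℤ) w = -weightCoord w k := by
  simp [excess, weightCoord]

theorem Raises.weight {i : ℕ} {w v : List ℤ} (h : Raises X (· = i) w v) :
    ∃ n : ℕ, eps X i w = eps X i v + n ∧ phi X i v = phi X i w + n ∧
      ∀ k, 0 < k → weightCoord w k = weightCoord v k - n * rootCoord X i k := by
  induction h with
  | refl => exact ⟨0, by simp, by simp, by simp⟩
  | tail _ h1 ih =>
    obtain ⟨j, rfl, h2⟩ := h1
    obtain ⟨n, h3, h4, h5⟩ := ih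
    have h6 := wordF_spec h2
    refine ⟨n + 1, by omega, by omega, fun k hk => ?_⟩
    rw [h5 k hk, wordF_weight h2 hk]
    push_cast
    ring

theorem letterF_three {i : ℕ} {a b c : ℤ} (h1 : letterF X i a = some b)
    (h2 : letterF X i b = some c) : X = OType.B ∧ i = 0 ∧ a = -1 ∧ b = 0 ∧ c = 1 := by
  rcases i with _ | i
  · cases X
    · rw [letterF_B_zero] at h1 h2
      split_ifs at h1 h2 <;> simp only [Option.some.injEq, reduceCtorEq] at h1 h2 <;>
        exact ⟨rfl, rfl, by omega, by omega, by omega⟩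
    · rw [letterF_D_zero] at h1 h2
      split_ifs at h1 h2 <;> simp only [Option.some.injEq, reduceCtorEq] at h1 h2 <;> omega
  · rw [letterF_succ] at h1 h2
    split_ifs at h1 h2
    simp only [Option.some.injEq] at h1 h2
    omega

theorem letterRaises_cases {i : ℕ} {x y : ℤ} (h : LetterRaises X (· = i) x y) :
    x = y ∨ letterF X i y = some x ∨
      (X = OType.B ∧ i = 0 ∧ y = -1 ∧ x = 1) := by
  induction h with
  | refl => exact Or.inl rfl
  | tail _ h1 ih =>
    obtain ⟨j, rfl, h2⟩ := h1
    rcases ih with rfl | h3 | ⟨rfl, rfl, rfl, rfl⟩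
    · exact Or.inr (Or.inl h2)
    · have := letterF_three h2 h3
      exact Or.inr (Or.inr ⟨this.1, this.2.1, this.2.2.1, this.2.2.2.2⟩)
    · exfalso
      rw [letterF_B_zero] at h2
      split_ifs at h2 <;> simp only [Option.some.injEq, reduceCtorEq] at h2 <;> omega

/-- Raising an insertion in one column with one colour. -/
theorem Slide.raise {i : ℕ} (hi : i < M) {D D' u : List ℤ} {x z : ℤ}
    (h : Slide X M D x z D') (hu : wordF X i u = some (D ++ [x])) :
    ∃ D₀ x₀ z₀ D₀', u = D₀ ++ [x₀] ∧ Slide X M D₀ x₀ z₀ D₀' ∧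
      wordF X i (z₀ :: D₀') = some (z :: D') ∧
      ((phi X i D < letterEps X i x ∧ D₀ = D ∧ letterF X i x₀ = some x) ∨
        (letterEps X i x ≤ phi X i D ∧ wordF X i D₀ = some D ∧ x₀ = x)) ∧
      ((z₀ = z ∧ wordF X i D₀' = some D') ∨ (D₀' = D' ∧ letterF X i z₀ = some z)) := by
  obtain ⟨v, hv, hs⟩ := h.sim.raise hi hu
  have hc := columnWord_wordF hu
  have hc' := columnWord_wordF hv
  have hf : Full X M u := h.full.connected (.symm _ _ (.rel _ _ ⟨i, hi, hu⟩))
  have hz : ∃ z₀ D₀', v = z₀ :: D₀' ∧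
      ((z₀ = z ∧ wordF X i D₀' = some D') ∨ (D₀' = D' ∧ letterF X i z₀ = some z)) := by
    cases v with
    | nil => simp [wordF] at hv
    | cons z₀ D₀' =>
      refine ⟨z₀, D₀', rfl, ?_⟩
      rcases wordF_cons_some.mp hv with ⟨-, y, hy, h1⟩ | ⟨-, y, hy, h1⟩
      · simp only [List.cons.injEq] at h1
        obtain ⟨rfl, rfl⟩ := h1
        exact Or.inr ⟨rfl, hy⟩
      · simp only [List.cons.injEq] at h1
        obtain ⟨rfl, rfl⟩ := h1
        exact Or.inl ⟨rfl, hy⟩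
  obtain ⟨z₀, D₀', rfl, hz⟩ := hz
  have hcol' : ColumnWord X D₀' ∧ D₀'.length = D'.length := by
    rcases hz with ⟨-, hz⟩ | ⟨rfl, -⟩
    · exact ⟨(columnWord_wordF hz).mpr h.column', (wordF_length hz).symm⟩
    · exact ⟨h.column', rfl⟩
  rcases wordF_eq_append.mp hu with ⟨h1, D₀, h2, rfl⟩ | ⟨h1, t, h2, rfl⟩
  · rw [eps_singleton] at h1
    refine ⟨D₀, x, z₀, D₀', rfl, ⟨hf, hs, (columnWord_wordF h2).mpr h.column,
      by rw [hc]; exact h.not_column, hcol'.1, by rw [hc']; exact h.not_column', ?_⟩, hv,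
      Or.inr ⟨h1, h2, rfl⟩, hz⟩
    rw [hcol'.2, h.length, wordF_length h2]
  · rw [eps_singleton] at h1
    obtain ⟨x₀, rfl⟩ : ∃ y, t = [y] := List.length_eq_one_iff.mp (wordF_length h2).symm
    refine ⟨D, x₀, z₀, D₀', rfl, ⟨hf, hs, h.column,
      by rw [hc]; exact h.not_column, hcol'.1, by rw [hc']; exact h.not_column', ?_⟩, hv,
      Or.inl ⟨h1, rfl, ?_⟩, hz⟩
    · rw [hcol'.2, h.length]
    · rcases wordF_cons_some.mp h2 with ⟨-, y, hy, h3⟩ | ⟨-, y, hy, h3⟩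
      · simp only [List.cons.injEq, and_true] at h3
        rwa [h3]
      · simp [wordF] at hy

/-- Raising an insertion in one column as far as possible with one colour. -/
theorem Slide.exists_top {i : ℕ} (hi : i < M) {D D' : List ℤ} {x z : ℤ}
    (h : Slide X M D x z D') :
    ∃ D₀ x₀ z₀ D₀', Slide X M D₀ x₀ z₀ D₀' ∧ eps X i (D₀ ++ [x₀]) = 0 ∧
      Raises X (· = i) D D₀ ∧ LetterRaises X (· = i) x x₀ ∧ LetterRaises X (· = i) z z₀ ∧
      min (letterEps X i x) (phi X i D) = letterEps X i x₀ := by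
  obtain ⟨n, hn⟩ : ∃ n, n = eps X i (D ++ [x]) := ⟨_, rfl⟩
  induction n generalizing D x z D' with
  | zero =>
    refine ⟨D, x, z, D', h, hn.symm, .refl, .refl, .refl, ?_⟩
    rw [eps_append, eps_singleton] at hn
    omega
  | succ n ih =>
    obtain ⟨u, hu⟩ := exists_wordF_eq (X := X) (i := i) (v := D ++ [x]) (by omega)
    obtain ⟨D₁, x₁, z₁, D₁', rfl, h1, -, h2, h3⟩ := h.raise hi hu
    have h4 := wordF_spec hu
    obtain ⟨D₀, x₀, z₀, D₀', k1, k2, k3, k4, k5, k6⟩ := ih h1 (by omega)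
    have hz : LetterRaises X (· = i) z z₀ := by
      rcases h3 with ⟨rfl, -⟩ | ⟨-, h3⟩
      · exact k5
      · exact Relation.ReflTransGen.head ⟨i, rfl, h3⟩ k5
    rcases h2 with ⟨h5, rfl, h6⟩ | ⟨h5, h6, rfl⟩
    · have h7 := letterF_some X h6
      exact ⟨D₀, x₀, z₀, D₀', k1, k2, k3, Relation.ReflTransGen.head ⟨i, rfl, h6⟩ k4, hz,
        by omega⟩
    · have h7 := wordF_spec h6
      exact ⟨D₀, x₀, z₀, D₀', k1, k2, Relation.ReflTransGen.head ⟨i, rfl, h6⟩ k3, k4, hz,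
        by omega⟩

/-- Raising an insertion in one column to a source for some of the colours. -/
theorem Slide.exists_source {J : ℕ → Prop} (hJ : ∀ i, J i → i < M) {D D' : List ℤ} {x z : ℤ}
    (h : Slide X M D x z D') :
    ∃ D₀ x₀ z₀ D₀', Slide X M D₀ x₀ z₀ D₀' ∧ (∀ i, J i → eps X i (D₀ ++ [x₀]) = 0) ∧
      Raises X J D D₀ ∧ LetterRaises X J x x₀ ∧ LetterRaises X J z z₀ := by
  obtain ⟨s, h1, h2⟩ := exists_raises X hJ (D ++ [x])
  have key : ∀ s, Raises X J (D ++ [x]) s → ∃ D₀ x₀ z₀ D₀', s = D₀ ++ [x₀] ∧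
      Slide X M D₀ x₀ z₀ D₀' ∧ Raises X J D D₀ ∧ LetterRaises X J x x₀ ∧
      LetterRaises X J z z₀ := by
    intro s hs
    induction hs with
    | refl => exact ⟨D, x, z, D', rfl, h, .refl, .refl, .refl⟩
    | tail _ h3 ih =>
      obtain ⟨i, hi, h4⟩ := h3
      obtain ⟨D₀, x₀, z₀, D₀', rfl, k1, k2, k3, k4⟩ := ih
      obtain ⟨D₁, x₁, z₁, D₁', rfl, k5, -, k6, k7⟩ := k1.raise (hJ i hi) h4
      have hz : LetterRaises X J z z₁ := by
        rcases k7 with ⟨rfl, -⟩ | ⟨-, k7⟩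
        · exact k4
        · exact k4.tail ⟨i, hi, k7⟩
      rcases k6 with ⟨-, rfl, k6⟩ | ⟨-, k6, rfl⟩
      · exact ⟨_, _, _, _, rfl, k5, k2, k3.tail ⟨i, hi, k6⟩, hz⟩
      · exact ⟨_, _, _, _, rfl, k5, k2.tail ⟨i, hi, k6⟩, k3, hz⟩
  obtain ⟨D₀, x₀, z₀, D₀', rfl, k1, k2, k3, k4⟩ := key s h1
  exact ⟨D₀, x₀, z₀, D₀', k1, h2, k2, k3, k4⟩

theorem weightCoord_raises {J : ℕ → Prop} (hJ : ∀ i, J i → i + 1 < M) (hM : 3 ≤ M) {w v : List ℤ}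
    (h : Raises X J w v) : weightCoord w M = weightCoord v M := by
  induction h with
  | refl => rfl
  | tail _ h1 ih =>
    obtain ⟨i, hi, h2⟩ := h1
    have := hJ i hi
    rw [ih, wordF_weight h2 (by omega)]
    have : rootCoord X i M = 0 := by
      rcases i with _ | i
      · cases X <;> simp only [rootCoord] <;> rw [if_neg (by omega)]
      · rw [rootCoord_succ, if_neg (by omega), if_neg (by omega)]; rfl
    rw [this]
    ring

theorem letterF_ne_neg {i : ℕ} {x : ℤ} (hi : i < M) : letterF X i x ≠ some (-(M : ℤ)) := by
  intro h
  rcases i with _ | i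
  · cases X
    · rw [letterF_B_zero] at h
      split_ifs at h <;> simp only [Option.some.injEq, reduceCtorEq] at h <;> omega
    · rw [letterF_D_zero] at h
      split_ifs at h <;> simp only [Option.some.injEq, reduceCtorEq] at h <;> omega
  · rw [letterF_succ] at h
    split_ifs at h
    simp only [Option.some.injEq] at h
    omega

theorem letterF_neg_rank {i : ℕ} {y : ℤ} (hi : i + 1 < M) (hM : 3 ≤ M) :
    letterF X i (-(M : ℤ)) ≠ some y := by
  intro h
  have h2 := letterF_ge h
  rcases i with _ | i
  · omega
  · rw [letterF_succ] at h
    split_ifs at h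
    omega

/-- Base case of `Slide.le_and_excess`. Raising with all colours but `M - 1` leaves the letter `-M`
and the coordinate at `M` unchanged. The raised `D'` must begin with `-M`, as `-M` can stand above
any other letter. Two initial letters `-M` absorb the `ε_{M-1}` of the remaining column, at most
`2`, so the word is a source; its column part is the highest weight column, and its content leaves
`-M` for the inserted letter. -/
theorem Slide.of_bumped_min (hX : ValidRank X M) (hM : 3 ≤ M) {D D' : List ℤ} {x : ℤ}
    (h : Slide X M D x (-(M : ℤ)) D') : x = -(M : ℤ) ∧ weightCoord D M = 1 := by
  obtain ⟨D₀, x₀, z₀, D₀', h1, h2, h3, h4, h5⟩ :=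
    h.exists_source (J := fun i => i + 1 < M) (fun i hi => by omega)
  have hz : z₀ = -(M : ℤ) := by
    rcases Relation.ReflTransGen.cases_head h5 with h6 | ⟨y, ⟨i, hi, h6⟩, -⟩
    · exact h6.symm
    · exact absurd h6 (letterF_ne_neg (by omega))
  subst hz
  have hfull := h1.full' hX (by omega)
  have hne' : D₀' ≠ [] := by
    intro h0
    have := h1.length
    rw [h0, List.length_nil] at this
    exact h1.ne_nil (List.eq_nil_of_length_eq_zero this.symm)
  obtain ⟨E, rfl⟩ : ∃ E, D₀' = -(M : ℤ) :: E := by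
    obtain ⟨d, E, rfl⟩ := List.exists_cons_of_ne_nil hne'
    have h6 := h1.column'.head_of_not h1.not_column'
    have h7 := hfull.inAlphabet hX d (by simp)
    have : d = -(M : ℤ) := by
      have := (_root_.abs_le.mp h7.abs_le).1
      cases X <;> simp only [Desc, InAlphabet] at h6 h7 <;> omega
    exact ⟨E, by rw [this]⟩
  have hs : IsSource X M (D₀ ++ [x₀]) := by
    intro i hi
    by_cases hi' : i + 1 < M
    · exact h2 i hi'
    · obtain ⟨c, rfl⟩ : ∃ c, M = c + 3 := ⟨M - 3, by omega⟩
      obtain rfl : i = c + 2 := by omega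
      have h6 : eps X (c + 2) E ≤ 2 :=
        (eps_columnWord_succ (X := X) (i := c + 1) (by omega) h1.column'.tail).1
      rw [h1.sim.eps_eq hi, eps_cons, eps_cons, letterEps_succ, letterPhi_succ,
        if_neg (by push_cast; omega), if_pos (by push_cast; omega)]
      omega
  have hb : Barred M (D₀ ++ [x₀]) := h1.full.source .refl hs
  have hb' : Barred M (-(M : ℤ) :: -(M : ℤ) :: E) :=
    hb.of_weights (by simp [← h1.length]) fun k hk hk' =>
      h1.sim.weightCoord_eq hX (by omega) hk hk'
  have hp := hb.perm hb' fun k hk hk' => h1.sim.weightCoord_eq hX (by omega) hk hk'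
  have hD := columnWord_source hs.left (fun a ha => hb a (by simp [ha])) h1.column
  have hlen : 0 < D₀.length := List.length_pos_iff.mpr h1.ne_nil
  have hnd : D₀.Nodup := by
    rw [hD]
    unfold highColumn
    exact List.Nodup.map (fun a b h => by have h : (a : ℤ) - M = b - M := h; omega)
      List.nodup_range
  have hmem : -(M : ℤ) ∈ D₀ := by
    rw [hD, mem_highColumn]
    omega
  have hx₀ : x₀ = -(M : ℤ) := by
    by_contra hne
    have h6 := hp.count_eq (-(M : ℤ))
    rw [List.count_append, hnd.count, if_pos hmem,
      List.count_eq_zero_of_not_mem (l := [x₀]) (by simpa using fun h => hne h.symm),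
      List.count_cons_self, List.count_cons_self] at h6
    omega
  subst hx₀
  constructor
  · rcases Relation.ReflTransGen.cases_tail h4 with h6 | ⟨y, -, i, hi, h6⟩
    · exact h6.symm
    · exact absurd h6 (letterF_neg_rank hi hM)
  · rw [weightCoord_raises (J := fun i => i + 1 < M) (fun i hi => hi) hM h3, weightCoord,
      hnd.count, if_pos hmem, List.count_eq_zero_of_not_mem]
    · rfl
    · intro h6
      have := hb _ (List.mem_append_left _ h6)
      omega

theorem exists_letterEps_pos_of_ne {z : ℤ} (hz : InAlphabet X M z) (hz' : z ≠ -(M : ℤ)) :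
    ∃ i < M, 0 < letterEps X i z := by
  have h1 := _root_.abs_le.mp hz.abs_le
  rcases (show z = 0 ∨ z = 1 ∨ (∃ k : ℕ, z = k + 2) ∨ ∃ k : ℕ, z = -((k : ℤ) + 1) by
    by_cases h0 : z = 0
    · exact Or.inl h0
    by_cases h1 : z = 1
    · exact Or.inr (Or.inl h1)
    by_cases h2 : 0 < z
    · exact Or.inr (Or.inr (Or.inl ⟨(z - 2).toNat, by omega⟩))
    · exact Or.inr (Or.inr (Or.inr ⟨(-z - 1).toNat, by omega⟩))) with rfl | rfl | ⟨k, rfl⟩ | ⟨k, rfl⟩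
  · cases X
    · exact ⟨0, by omega, by simp [letterEps_B_zero]⟩
    · simp [InAlphabet] at hz
  · exact ⟨0, by omega, by cases X <;> simp [letterEps_B_zero, letterEps_D_zero]⟩
  · exact ⟨k + 1, by omega, by simp [letterEps_succ]⟩
  · exact ⟨k + 1, by omega, by simp [letterEps_succ]⟩

/-- The reflection of the weight of a word along a string, for a non-exceptional colour. -/
theorem excess_reflect {i : ℕ} {D D₀ : List ℤ} (h : Raises X (· = i) D D₀)
    (h0 : eps X i D₀ = 0) (hφ : phi X i D = 0) {a b : ℤ} (hab : letterF X i a = some b)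
    (hB : X = OType.B → i ≠ 0) : excess b D = excess a D₀ := by
  obtain ⟨n, h1, h2, h3⟩ := h.weight
  rcases i with _ | i
  · cases X with
    | B => exact absurd rfl (hB rfl)
    | D =>
      have h4 := phi_sub_eps_D_zero D₀
      have h5 := h3 1 one_pos
      have h6 := h3 2 two_pos
      simp only [rootCoord, true_or, or_true, if_true] at h5 h6
      rw [letterF_D_zero] at hab
      split_ifs at hab with h7 h7 <;> simp only [Option.some.injEq] at hab <;> subst h7 hab
      · have e1 := excess_natCast 1 D
        have e2 := excess_neg 2 D₀
        simp only [Nat.cast_one, Nat.cast_ofNat] at e1 e2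
        rw [e1, e2]
        omega
      · have e1 := excess_natCast 2 D
        have e2 := excess_neg 1 D₀
        simp only [Nat.cast_one, Nat.cast_ofNat] at e1 e2
        rw [e1, e2]
        omega
  · have h4 := phi_sub_eps_succ X i D₀
    have h5 := h3 (i + 1) (by omega)
    have h6 := h3 (i + 2) (by omega)
    rw [rootCoord_succ, if_neg (by omega), if_pos rfl] at h5
    rw [rootCoord_succ, if_pos rfl, if_neg (by omega)] at h6
    rw [letterF_succ] at hab
    split_ifs at hab with h7
    simp only [Option.some.injEq] at hab
    rcases h7 with rfl | rfl
    · have e1 := excess_neg (i + 1) D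
      have e2 := excess_neg (i + 2) D₀
      push_cast at e1 e2
      rw [← hab, show -((i : ℤ) + 2) + 1 = -((i : ℤ) + 1) by ring]
      rw [e1, e2]
      omega
    · have e1 := excess_natCast (i + 2) D
      have e2 := excess_natCast (i + 1) D₀
      push_cast at e1 e2
      rw [← hab, show (i : ℤ) + 1 + 1 = (i : ℤ) + 2 by ring]
      rw [e1, e2]
      omega

theorem weightCoord_one_reflect {D D₀ : List ℤ} (h : Raises OType.B (· = 0) D D₀)
    (h0 : eps OType.B 0 D₀ = 0) (hφ : phi OType.B 0 D = 0) :
    weightCoord D 1 = -weightCoord D₀ 1 ∧ (eps OType.B 0 D : ℤ) = 2 * weightCoord D₀ 1 := by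
  obtain ⟨n, h1, h2, h3⟩ := h.weight
  have h4 := phi_sub_eps_B_zero D₀
  have h5 := h3 1 one_pos
  simp only [rootCoord, if_true] at h5
  omega

/-- The letter pushed out of a column is at least the inserted letter; when they coincide, this
letter has excess one in the column. -/
theorem Slide.le_and_excess (hX : ValidRank X M) (hM : 3 ≤ M) {D D' : List ℤ} {x z : ℤ}
    (h : Slide X M D x z D') :
    x ≤ z ∧ (X = OType.D → x = -1 → z ≠ 1) ∧ (x = z → excess x D = 1) := by
  have hzA := (h.full' hX (by omega)).inAlphabet hX z (by simp)
  obtain ⟨n, hn⟩ : ∃ n : ℕ, n = (z + M).toNat := ⟨_, rfl⟩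
  induction n using Nat.strong_induction_on generalizing D x z D' with
  | _ n ih =>
    by_cases hz : z = -(M : ℤ)
    · subst hz
      obtain ⟨rfl, h1⟩ := h.of_bumped_min hX hM
      exact ⟨le_rfl, fun _ _ => by omega, fun _ => by rw [excess_neg, h1]⟩
    -- Raising to the top of an `i`-string with `ε_i z > 0` strictly decreases `z`, and the
    -- induction hypothesis applies to the raised slide.
    obtain ⟨i, hi, hpos⟩ := exists_letterEps_pos_of_ne hzA hz
    obtain ⟨D₀, x₀, z₀, D₀', h1, h2, h3, h4, h5, h6⟩ := h.exists_top hi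
    have hz₀A := (h1.full' hX (by omega)).inAlphabet hX z₀ (by simp)
    have hz₀M := (_root_.abs_le.mp hz₀A.abs_le).1
    have hD₀ : eps X i D₀ = 0 := by rw [eps_append] at h2; omega
    have hz₀ : letterEps X i z₀ = 0 := by
      have := h1.sim.eps_eq hi
      rw [h2, eps_cons] at this
      omega
    -- If the inserted letter moves and ends with `ε_i x₀ = 0`, then `min (ε_i x) (φ_i D) = 0` with
    -- `ε_i x > 0`: the column `D` is the lower end of its `i`-string and its weight is the
    -- reflection of that of `D₀`.
    have hreflect : x ≠ x₀ → phi X i D = 0 ∨ (X = OType.B ∧ i = 0 ∧ x = 1 ∧ x₀ = 0) := by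
      intro hne
      rcases letterRaises_cases h4 with h7 | h7 | ⟨rfl, rfl, rfl, rfl⟩
      · exact absurd h7 hne
      · have h8 := letterF_some X h7
        rcases Nat.eq_zero_or_pos (phi X i D) with h9 | h9
        · exact Or.inl h9
        · have h10 : 0 < letterEps X i x₀ := by omega
          obtain ⟨y, hy⟩ := exists_letterF_eq X h10
          obtain ⟨e1, e2, -, e3, e4⟩ := letterF_three hy h7
          exact Or.inr ⟨e1, e2, e4, e3⟩
      · left
        rw [letterEps_B_zero, letterEps_B_zero] at h6
        simp only [if_true] at h6
        norm_num at h6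
        omega
    have hlt : z₀ < z ∧ (letterF X i z₀ = some z ∨ (X = OType.B ∧ i = 0 ∧ z₀ = -1 ∧ z = 1)) := by
      rcases letterRaises_cases h5 with rfl | h7 | ⟨rfl, rfl, rfl, rfl⟩
      · omega
      · exact ⟨letterF_lt h7, Or.inl h7⟩
      · exact ⟨by omega, Or.inr ⟨rfl, rfl, rfl, rfl⟩⟩
    obtain ⟨i1, i2, i3⟩ := ih _ (by omega) h1 hz₀A rfl
    by_cases hex : X = OType.B ∧ i = 0
    · obtain ⟨rfl, rfl⟩ := hex
      have hz₀' : z₀ = -1 ∧ (z = 0 ∨ z = 1) := by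
        rcases hlt.2 with h7 | ⟨-, -, rfl, rfl⟩
        · rw [letterF_B_zero] at h7
          rw [letterEps_B_zero] at hz₀
          split_ifs at h7 hz₀ <;> simp only [Option.some.injEq, reduceCtorEq] at h7 <;> omega
        · exact ⟨rfl, Or.inr rfl⟩
      obtain ⟨rfl, hz01⟩ := hz₀'
      have hxc : x = x₀ ∨ (x₀ = -1 ∧ (x = 0 ∨ x = 1)) := by
        rcases letterRaises_cases h4 with h7 | h7 | ⟨-, -, rfl, rfl⟩
        · exact Or.inl h7
        · rw [letterF_B_zero] at h7
          split_ifs at h7 <;> simp only [Option.some.injEq, reduceCtorEq] at h7 <;> omega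
        · exact Or.inr ⟨rfl, Or.inr rfl⟩
      rcases hxc with rfl | ⟨rfl, hx01⟩
      · exact ⟨by omega, by simp, fun _ => by omega⟩
      · have hφ : phi OType.B 0 D = 0 := by
          rcases hreflect (by omega) with h7 | ⟨-, -, -, h7⟩
          · exact h7
          · omega
        obtain ⟨r1, r2⟩ := weightCoord_one_reflect h3 hD₀ hφ
        have h7 := i3 rfl
        have e1 := excess_neg 1 D₀
        have e2 := excess_natCast 1 D
        simp only [Nat.cast_one] at e1 e2
        have h8 := h.sim.eps_eq hi
        have h9 := (eps_columnWord_B h.column').1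
        rw [eps_append, eps_singleton, eps_cons, letterEps_B_zero, letterEps_B_zero,
          letterPhi_B_zero] at h8
        -- The induction hypothesis gives `ε_0 D = 2`, so `ε_0` of `D ++ [x]` is at least `3`,
        -- whereas `ε_0` of `0 :: D'` is at most `2` for a column `D'`. This excludes `z = 0`.
        rcases hz01 with rfl | rfl
        · exfalso
          rcases hx01 with rfl | rfl <;> norm_num at h8 <;> omega
        · refine ⟨by omega, by simp, ?_⟩
          rintro rfl
          rw [e2, r1, ← e1, h7]
          norm_num
    · have hzF : letterF X i z₀ = some z := by
        rcases hlt.2 with h7 | ⟨h7, h8, -, -⟩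
        · exact h7
        · exact absurd ⟨h7, h8⟩ hex
      have hxc : x = x₀ ∨ letterF X i x₀ = some x := by
        rcases letterRaises_cases h4 with h7 | h7 | ⟨h7, h8, -, -⟩
        · exact Or.inl h7
        · exact Or.inr h7
        · exact absurd ⟨h7, h8⟩ hex
      rcases hxc with rfl | hxF
      · refine ⟨by omega, ?_, fun _ => by omega⟩
        rintro rfl hx1 hz1
        subst hx1 hz1
        rcases i with _ | i
        · rw [letterF_D_zero] at hzF
          split_ifs at hzF <;> simp only [Option.some.injEq, reduceCtorEq] at hzF <;> omega
        · rw [letterF_succ] at hzF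
          split_ifs at hzF
          simp only [Option.some.injEq] at hzF
          omega
      · have hφ : phi X i D = 0 := by
          rcases hreflect (letterF_lt hxF).ne' with h7 | ⟨h7, h8, -, -⟩
          · exact h7
          · exact absurd ⟨h7, h8⟩ hex
        have hB : X = OType.B → i ≠ 0 := fun h7 h8 => hex ⟨h7, h8⟩
        refine ⟨?_, ?_, ?_⟩
        · rcases i with _ | i
          · cases X
            · exact absurd rfl (hB rfl)
            · rw [letterF_D_zero] at hzF hxF
              split_ifs at hzF hxF <;> simp only [Option.some.injEq, reduceCtorEq] at hzF hxF <;>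
                omega
          · rw [letterF_succ] at hzF hxF
            split_ifs at hzF hxF
            simp only [Option.some.injEq] at hzF hxF
            omega
        · rintro rfl rfl rfl
          rcases i with _ | i
          · rw [letterF_D_zero] at hxF
            split_ifs at hxF <;> simp only [Option.some.injEq, reduceCtorEq] at hxF <;> omega
          · rw [letterF_succ] at hzF hxF
            split_ifs at hzF hxF
            simp only [Option.some.injEq] at hzF hxF
            omega
        · rintro rfl
          have h7 : x₀ = z₀ := by
            have h8 := letterF_neg X hzF
            have h9 := letterF_neg X hxF
            have := h8.symm.trans h9
            simp only [Option.some.injEq] at this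
            omega
          subst h7
          rw [excess_reflect h3 hD₀ hφ hxF hB, i3 rfl]

end Order

end OrthogonalTableaux

/-! ### Finiteness of the cocyclage sequence -/

namespace OrthogonalTableaux

section Termination
variable {X : OType} {m M n : ℕ}

/-! ### The cocyclage of a tableau of weight zero -/

theorem Ins.length {T F : Filling} {x : ℤ} (h : Ins X M T x F) :
    (reading F).length = (reading T).length + 1 := by
  induction h with
  | new x => simp [reading]
  | app D T x h => simp only [reading_cons, List.length_append, List.length_singleton]; omega
  | pass D D' T T' x z h _ ih =>
    simp only [reading_cons, List.length_append, h.length, ih]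
    omega

/-- `F` is the symbol of the word obtained from the reading of `T` by moving its first letter to
the end. -/
def Turns (X : OType) (T F : Filling) : Prop :=
  ∃ (x : ℤ) (u : List ℤ), reading T = x :: u ∧ IsPSymbol X (u ++ [x]) F

theorem IsTableau.exists_ins {T : Filling} (hT : IsTableau X T) {x : ℤ} {u : List ℤ}
    (hx : reading T = x :: u) : ∃ m₀, ∀ M ≥ m₀, 3 ≤ M ∧ ValidRank X M ∧ PlusTableau X M T ∧
      ∃ F, Ins X M (pop T) x F ∧ IsPSymbol X (u ++ [x]) F := by
  obtain ⟨m, hm⟩ := hT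
  have hX := hm.1
  have h1 := hm.succ
  have h2 := h1.full.inAlphabet hX.succ
  refine ⟨(m + 1) + (u ++ [x]).length + 2, fun M hM => ?_⟩
  have hXM : ValidRank X M := hX.mono (by omega)
  have h3 : PlusTableau X M T := hm.plusTableau (by omega)
  have h4 : ∀ y ∈ u ++ [x], InAlphabet X (m + 1) y := by
    intro y hy
    refine h2 y ?_
    rw [hx]
    simp only [List.mem_append, List.mem_singleton, List.mem_cons] at hy ⊢
    tauto
  have e : reading (pop T) = u := by rw [reading_pop h3.1.1, hx, List.tail_cons]
  obtain ⟨F, h5, h6⟩ := h3.pop.exists_ins hXM (x := x) (by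
    rw [e]
    exact full_of_inAlphabet hXM h4 hM)
  have h7 := h5.sim
  have h8 := h5.length
  rw [e] at h7 h8
  exact ⟨by omega, hXM, h3, F, h5, M, fun y hy => (h4 y hy).mono (by omega),
    h6.isTableauOfRank hXM, h7.equivalent, by simpa using h8⟩

theorem Turns.ins {T F : Filling} (hT : IsTableau X T) (h : Turns X T F) :
    ∃ x u, reading T = x :: u ∧ ∃ m₀, ∀ M ≥ m₀, 3 ≤ M ∧ ValidRank X M ∧ PlusTableau X M T ∧
      Ins X M (pop T) x F := by
  obtain ⟨x, u, h1, h2⟩ := h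
  obtain ⟨m₀, h3⟩ := hT.exists_ins h1
  refine ⟨x, u, h1, m₀, fun M hM => ?_⟩
  obtain ⟨h4, h5, h6, F', h7, h8⟩ := h3 M hM
  rw [h2.unique (by simp) h8]
  exact ⟨h4, h5, h6, h7⟩

theorem Turns.unique {T F F' : Filling} (h : Turns X T F) (h' : Turns X T F') : F = F' := by
  obtain ⟨x, u, h1, h2⟩ := h
  obtain ⟨y, v, h3, h4⟩ := h'
  rw [h1, List.cons.injEq] at h3
  obtain ⟨rfl, rfl⟩ := h3
  exact h2.unique (by simp) h4

theorem mem_tableauxOfWeight_zero {T : Filling} :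
    T ∈ tableauxOfWeight X (0 : Fin n → ℕ) ↔
      IsTableau X T ∧ ∀ k, 0 < k → weightCoord (reading T) k = 0 := by
  constructor
  · rintro ⟨h1, h2, h3⟩
    refine ⟨h1, fun k hk => ?_⟩
    rcases le_or_gt k n with hkn | hkn
    · have := h2 ⟨k - 1, by omega⟩
      simpa [Nat.sub_add_cancel hk] using this
    · exact h3 k hkn
  · rintro ⟨h1, h2⟩
    exact ⟨h1, fun j => by simpa using h2 (j + 1) (by omega), fun i hi => h2 i (by omega)⟩

theorem Turns.weight {T F : Filling} (h : Turns X T F)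
    (hw : ∀ k, 0 < k → weightCoord (reading T) k = 0) :
    IsTableau X F ∧ (∀ k, 0 < k → weightCoord (reading F) k = 0) ∧
      (reading F).length = (reading T).length := by
  obtain ⟨x, u, h1, h2⟩ := h
  have h3 := h2.spec (by simp)
  obtain ⟨m, -, h4, -, hl⟩ := h2
  refine ⟨⟨m, h4⟩, fun k hk => ?_, by rw [hl, h1]; simp⟩
  obtain ⟨m₀, h5⟩ := h3
  obtain ⟨hX, -, h6, -⟩ := h5 (max m₀ k) (by omega)
  have := hw k hk
  rw [← h6.weightCoord_eq hX (by omega) hk (by omega), weightCoord_append]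
  rwa [h1, weightCoord_cons] at this

/-- If all columns contained `-n` and none contained `n`, the coordinate at `n` would be positive;
for `n = 0` these two conditions contradict each other. In weight zero the authorization is thus
automatic. -/
theorem authorized_of_weight_zero {T : Filling} (hT : T ≠ [])
    (hw : ∀ k, 0 < k → weightCoord (reading T) k = 0) : Authorized n T := by
  by_contra hc
  simp only [Authorized, not_exists, not_and, not_or, not_not] at hc
  obtain ⟨C, hC⟩ := List.exists_mem_of_ne_nil _ hT
  have hmem : ∀ a : ℤ, a ∈ reading T ↔ ∃ C ∈ T, a ∈ C := by
    intro a; simp [reading]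
  rcases Nat.eq_zero_or_pos n with rfl | hn
  · have := hc C hC
    simp at this
  · have h1 := hw n hn
    rw [weightCoord, List.count_eq_zero_of_not_mem (a := (n : ℤ))] at h1
    · have : 0 < (reading T).count (-(n : ℤ)) :=
        List.count_pos_iff.mpr ((hmem _).mpr ⟨C, hC, (hc C hC).2⟩)
      omega
    · rw [hmem]
      rintro ⟨D, hD, h2⟩
      exact (hc D hD).1 h2

theorem isCocyclage_iff {T F : Filling} (hT : IsTableau X T) (hne : T ≠ [])
    (hw : ∀ k, 0 < k → weightCoord (reading T) k = 0) :
    IsCocyclage X n T F ↔ 1 < T.length ∧ Turns X T F :=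
  ⟨fun h => ⟨h.2.1, h.2.2.2⟩, fun h => ⟨hT, h.1, authorized_of_weight_zero hne hw, h.2⟩⟩

theorem IsTableau.columns_ne_nil {T : Filling} (hT : IsTableau X T) : ∀ C ∈ T, C ≠ [] := by
  obtain ⟨m, hm⟩ := hT
  exact hm.2.1.1

theorem IsTableau.exists_turns {T : Filling} (hT : IsTableau X T) (hne : T ≠ []) :
    ∃ F, Turns X T F := by
  have : reading T ≠ [] := by
    cases T with
    | nil => exact absurd rfl hne
    | cons C T =>
      rw [reading_cons]
      have := hT.columns_ne_nil C (by simp)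
      simp [this]
  obtain ⟨x, u, hx⟩ := List.exists_cons_of_ne_nil this
  obtain ⟨m₀, h⟩ := hT.exists_ins hx
  obtain ⟨-, -, -, F, -, h1⟩ := h m₀ le_rfl
  exact ⟨F, x, u, hx, h1⟩

/-! ### Bounds along the sequence of cocyclages -/

theorem exists_eventually_const (f : ℕ → ℤ) {K : ℕ} {C : ℤ} (hf : ∀ k ≥ K, f k ≤ f (k + 1))
    (hC : ∀ k ≥ K, f k ≤ C) : ∃ K' ≥ K, ∀ k ≥ K', f (k + 1) = f k := by
  obtain ⟨K', hK', hmax⟩ : ∃ K' ≥ K, ∀ k ≥ K, f k ≤ f K' := by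
    have hne : (f '' Set.Ici K).Nonempty := ⟨f K, K, Set.self_mem_Ici, rfl⟩
    have hbd : BddAbove (f '' Set.Ici K) := ⟨C, by
      rintro _ ⟨k, hk, rfl⟩
      exact hC k hk⟩
    obtain ⟨K', hK', h⟩ := Int.csSup_mem hne hbd
    exact ⟨K', hK', fun k hk => h ▸ le_csSup hbd ⟨k, hk, rfl⟩⟩
  have hge : ∀ k ≥ K', f K' ≤ f k := by
    intro k hk
    induction k, hk using Nat.le_induction with
    | base => exact le_rfl
    | succ k hk ih => exact ih.trans (hf k (by omega))
  refine ⟨K', hK', fun k hk => ?_⟩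
  have h1 := hge k hk
  have h2 := hge (k + 1) (by omega)
  have h3 := hmax k (by omega)
  have h4 := hmax (k + 1) (by omega)
  omega

/-- The letters of the `j`-th column are at most `b + j * c`. -/
def ColumnBound (c : ℕ) : ℕ → Filling → Prop
  | _, [] => True
  | b, C :: T => (∀ a ∈ C, a ≤ (b : ℤ)) ∧ ColumnBound c (b + c) T

theorem columnBound_of_forall {c b : ℕ} {T : Filling} (h : ∀ a ∈ reading T, a ≤ (b : ℤ)) :
    ColumnBound c b T := by
  induction T generalizing b with
  | nil => trivial
  | cons C T ih =>
    rw [reading_cons] at h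
    refine ⟨fun a ha => h a (by simp [ha]), ih fun a ha => ?_⟩
    have := h a (by simp [ha])
    push_cast
    omega

theorem ColumnBound.forall {c b : ℕ} {T : Filling} (h : ColumnBound c b T) :
    ∀ a ∈ reading T, a ≤ (b : ℤ) + T.length * c := by
  induction T generalizing b with
  | nil => simp
  | cons C T ih =>
    intro a ha
    rw [reading_cons, List.mem_append] at ha
    rw [List.length_cons]
    push_cast
    rcases ha with ha | ha
    · have := ih h.2 a ha
      push_cast at this
      linarith
    · have h1 := h.1 a ha
      have h2 : (0 : ℤ) ≤ ((T.length : ℤ) + 1) * c := by positivity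
      linarith

theorem ColumnBound.pop {c b : ℕ} {T : Filling} (h : ColumnBound c b T) :
    ColumnBound c b (pop T) := by
  induction T generalizing b with
  | nil => trivial
  | cons C T ih =>
    cases T with
    | nil =>
      unfold OrthogonalTableaux.pop
      split_ifs
      · trivial
      · exact ⟨fun a ha => h.1 a (List.mem_of_mem_tail ha), trivial⟩
    | cons D T => exact ⟨h.1, ih h.2⟩

/-- A letter pushed out of a column of height `h` bounded by `b` is at most `b + h + 2 ≤ b + c`, the
bound allowed in the next column, while the column itself keeps its bound when `M` is large. The
bounds are therefore preserved by each insertion, with no growth in time. -/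
theorem Ins.columnBound (hX : ValidRank X M) {T F : Filling} {x : ℤ} (h : Ins X M T x F)
    {c b : ℕ} (hb : 1 ≤ b) (hx : x ≤ b) (hT : ColumnBound c b T)
    (hc : ∀ C ∈ T, C.length + 2 ≤ c) (hM : ∀ a ∈ reading F, a + c ≤ M) (hM1 : 1 ≤ M) :
    ColumnBound c b F := by
  induction h generalizing b with
  | new x => exact ⟨by simpa using hx, trivial⟩
  | app D T x h =>
    refine ⟨fun a ha => ?_, hT.2⟩
    rcases List.mem_append.mp ha with ha | ha
    · exact hT.1 a ha
    · rw [List.mem_singleton] at ha; rwa [ha]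
  | pass D D' T T' x z h _ ih =>
    have h1 := hc D (by simp)
    rw [reading_cons] at hM
    refine ⟨h.le_of_mem' hX hb hT.1 hx fun a ha => ?_, ih (by omega) ?_ hT.2
      (fun C hC => hc C (by simp [hC])) fun a ha => hM a (by simp [ha])⟩
    · have := hM a (by simp [ha]); omega
    · have := h.bumped_le hX hM1 hT.1 hx
      push_cast
      omega

theorem Ins.head {D : List ℤ} {T F : Filling} {x : ℤ} (h : Ins X M (D :: T) x F) :
    D.length ≤ (F.headD []).length ∧ ((F.headD []).length = D.length →
      ∃ z D' T', Slide X M D x z D' ∧ Ins X M T z T') := by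
  cases h with
  | app D T x h => simp
  | pass D D' T T' x z h h' => exact ⟨h.length.ge, fun _ => ⟨z, D', T', h, h'⟩⟩

/-- A quantity that grows under insertions. -/
def potential (W : ℤ) (n : ℕ) (T : Filling) : ℤ :=
  ((T.take n).map (fun C => W * C.length - C.sum)).sum

/-- A slide keeps the height and lowers the sum of the column by `z - x ≥ 0`; an appended letter
contributes `W - x > 0`. Equality therefore means that the letter crosses all the columns considered
unchanged, and the equality case of `Slide.le_and_excess` applies to each. -/
theorem Ins.potential (hX : ValidRank X M) (hM : 3 ≤ M) {T F : Filling} {x : ℤ}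
    (h : Ins X M T x F) {W : ℤ} (hW : ∀ a ∈ reading F, a < W) {k : ℕ} (hk : k ≤ T.length) :
    potential W k T ≤ potential W k F ∧
      (potential W k F = potential W k T → ∀ C ∈ T.take k, excess x C = 1) := by
  induction h generalizing k with
  | new x =>
    obtain rfl : k = 0 := by simpa using hk
    simp [OrthogonalTableaux.potential]
  | app D T x h =>
    cases k with
    | zero => simp [OrthogonalTableaux.potential]
    | succ k =>
      have h1 := hW x (by simp [reading_cons])
      simp only [OrthogonalTableaux.potential, List.take_succ_cons, List.map_cons, List.sum_cons,
        List.length_append, List.length_singleton, List.sum_append, List.sum_nil]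
      push_cast
      have e : W * ((D.length : ℤ) + 1) = W * D.length + W := by ring
      rw [e]
      exact ⟨by omega, fun h2 => by omega⟩
  | pass D D' T T' x z h h' ih =>
    cases k with
    | zero => simp [OrthogonalTableaux.potential]
    | succ k =>
      obtain ⟨h1, h2⟩ := ih (fun a ha => hW a (by simp [reading_cons, ha]))
        (k := k) (by simpa using hk)
      obtain ⟨h3, -, h4⟩ := h.le_and_excess hX hM
      have h5 := h.sum_eq hX (by omega)
      simp only [OrthogonalTableaux.potential, List.take_succ_cons, List.map_cons, List.sum_cons,
        h.length] at h1 h2 ⊢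
      refine ⟨by omega, fun h6 => ?_⟩
      have h7 : x = z := by omega
      subst h7
      intro C hC
      rcases List.mem_cons.mp hC with rfl | hC
      · exact h4 rfl
      · exact h2 (by omega) C hC

theorem potential_le {W B : ℤ} (hWB : 0 ≤ W + B) {T : Filling} (hT : ∀ a ∈ reading T, -B ≤ a)
    (k : ℕ) : potential W k T ≤ (W + B) * (reading T).length := by
  have hcol : ∀ C : List ℤ, (∀ a ∈ C, -B ≤ a) → -B * C.length ≤ C.sum := by
    intro C hC
    induction C with
    | nil => simp
    | cons a C ih =>
      have := ih fun b hb => hC b (by simp [hb])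
      have := hC a (by simp)
      simp only [List.length_cons, List.sum_cons]
      push_cast
      linarith
  induction T generalizing k with
  | nil => simp [potential]
  | cons C T ih =>
    rw [reading_cons] at hT ⊢
    have h1 := ih fun a ha => hT a (by simp [ha])
    have h2 := hcol C fun a ha => hT a (by simp [ha])
    rw [List.length_append]
    push_cast
    cases k with
    | zero =>
      simp only [potential, List.take_zero, List.map_nil, List.sum_nil]
      positivity
    | succ k =>
      have h3 := h1 k
      simp only [potential, List.take_succ_cons, List.map_cons, List.sum_cons] at h3 ⊢
      linarith

theorem take_pop {T : Filling} {k : ℕ} (hk : k < T.length) : (pop T).take k = T.take k := by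
  induction T generalizing k with
  | nil => simp at hk
  | cons C T ih =>
    cases T with
    | nil =>
      obtain rfl : k = 0 := by simpa using hk
      simp
    | cons D T =>
      cases k with
      | zero => simp
      | succ k =>
        rw [pop, List.take_succ_cons, List.take_succ_cons, ih (by simpa using hk)]

theorem length_pop (T : Filling) : T.length ≤ (pop T).length + 1 := by
  induction T with
  | nil => simp
  | cons C T ih =>
    cases T with
    | nil => simp
    | cons D T =>
      have e : (pop (C :: D :: T)).length = (pop (D :: T)).length + 1 := rfl
      have e' : (C :: D :: T).length = (D :: T).length + 1 := rfl
      omega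

theorem columnWord_of_raises {T : Filling} (hT : ∀ C ∈ T, C.length ≤ M)
    (h : Raises X (· < M) (reading T) (reading (highestFilling M T))) :
    ∀ C ∈ T, ColumnWord X C := by
  induction T with
  | nil => simp
  | cons C T ih =>
    rw [reading_cons, reading_highestFilling_cons] at h
    obtain ⟨u, v, h1, h2, h3⟩ := h.append
    obtain ⟨rfl, rfl⟩ := List.append_inj h1
      (by rw [h2.length_eq, length_reading_highestFilling])
    intro D hD
    rcases List.mem_cons.mp hD with rfl | hD
    · exact (columnWord_connected (h3.connected fun _ h => h)).mpr
        (columnWord_highColumn M (hT _ (by simp)))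
    · exact ih (fun E hE => hT E (by simp [hE])) h2 D hD

theorem PlusTableau.columnWord {T : Filling} (hT : PlusTableau X M T) :
    ∀ C ∈ T, ColumnWord X C :=
  columnWord_of_raises hT.2.1 (raises_of_connected hT.2.2.symm
    (reading_highestFilling_spec (X := X) hT.2.1).2)

theorem excess_append (x : ℤ) (u v : List ℤ) : excess x (u ++ v) = excess x u + excess x v := by
  simp only [excess, List.count_append]
  push_cast
  ring

theorem excess_reading_eq {T : Filling} {x : ℤ} (h : ∀ C ∈ T, excess x C = 1) :
    excess x (reading T) = T.length := by
  induction T with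
  | nil => simp [excess]
  | cons C T ih =>
    rw [reading_cons, excess_append, ih fun D hD => h D (by simp [hD]), h C (by simp)]
    simp

theorem excess_eq_zero_of_weight {w : List ℤ} (hw : ∀ k, 0 < k → weightCoord w k = 0) (x : ℤ) :
    excess x w = 0 := by
  obtain ⟨k, rfl | rfl⟩ : ∃ k : ℕ, x = k ∨ x = -(k : ℤ) := ⟨x.natAbs, by omega⟩
  · rcases Nat.eq_zero_or_pos k with rfl | hk
    · simp [excess]
    · rw [excess_natCast, hw k hk, neg_zero]
  · rcases Nat.eq_zero_or_pos k with rfl | hk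
    · simp [excess]
    · rw [excess_neg, hw k hk]

theorem length_le_of_columns {T : Filling} (hT : ∀ C ∈ T, C ≠ []) :
    T.length ≤ (reading T).length ∧ ∀ C ∈ T, C.length ≤ (reading T).length := by
  induction T with
  | nil => simp
  | cons C T ih =>
    obtain ⟨h1, h2⟩ := ih fun D hD => hT D (by simp [hD])
    have h3 := List.length_pos_iff.mpr (hT C (by simp))
    rw [reading_cons, List.length_append, List.length_cons]
    refine ⟨by omega, fun D hD => ?_⟩
    rcases List.mem_cons.mp hD with rfl | hD
    · omega
    · have := h2 D hD; omega

/-- In a tableau of weight zero, the first letter of the reading cannot have excess one in all the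
columns but the last. -/
theorem PlusTableau.exists_excess_ne (hM : PlusTableau X M T)
    (hw : ∀ k, 0 < k → weightCoord (reading T) k = 0) {x : ℤ} {u : List ℤ}
    (hx : reading T = x :: u) {s : ℕ} (hs : T.length = s + 1) (hs1 : 1 ≤ s)
    (h : ∀ C ∈ T.take s, excess x C = 1) : False := by
  obtain ⟨P, C, rfl⟩ := (List.eq_nil_or_concat' T).resolve_left (by rintro rfl; simp at hs)
  have hP : P.length = s := by simpa using hs
  rw [List.take_left' hP] at h
  have e : reading (P ++ [C]) = C ++ reading P := by simp [reading]
  have h1 := excess_eq_zero_of_weight hw x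
  rw [e, excess_append, excess_reading_eq h, hP] at h1
  obtain ⟨c, C, rfl⟩ := List.exists_cons_of_ne_nil (hM.1.1 C (by simp))
  rw [e, List.cons_append, List.cons.injEq] at hx
  obtain ⟨rfl, -⟩ := hx
  -- The letter `0` is its own opposite and has excess `0` in every column; as `1 ≤ s`, there is a
  -- column where the excess is one.
  have hx0 : c ≠ 0 := by
    rintro rfl
    obtain ⟨D, P, rfl⟩ := List.exists_cons_of_ne_nil (l := P) (by rintro rfl; simp at hP; omega)
    have := h D (by simp)
    simp [excess] at this
  have h2 := ((hM.columnWord (c :: C) (by simp)).count_neg_le hx0).2 (by simp)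
  have h3 : 0 ≤ excess c (c :: C) := by rw [excess]; omega
  omega

theorem exists_liminf (f : ℕ → ℕ) {C : ℕ} (hf : ∀ k, f k ≤ C) :
    ∃ s, (∃ K, ∀ k ≥ K, s ≤ f k) ∧ ∀ K, ∃ k ≥ K, f k = s := by
  classical
  have hex : ∃ s, ∀ K, ∃ k ≥ K, f k ≤ s := ⟨C, fun K => ⟨K, le_rfl, hf K⟩⟩
  have h1 := Nat.find_spec hex
  have h2 : ∃ K, ∀ k ≥ K, Nat.find hex ≤ f k := by
    rcases Nat.eq_zero_or_pos (Nat.find hex) with h0 | h0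
    · exact ⟨0, fun k _ => by omega⟩
    · have := Nat.find_min hex (m := Nat.find hex - 1) (by omega)
      push Not at this
      obtain ⟨K, hK⟩ := this
      exact ⟨K, fun k hk => by have := hK k hk; omega⟩
  refine ⟨_, h2, fun K => ?_⟩
  obtain ⟨K', hK'⟩ := h2
  obtain ⟨k, hk, hk'⟩ := h1 (max K K')
  exact ⟨k, by omega, le_antisymm hk' (hK' k (by omega))⟩

/-- A sequence of cocyclages of tableaux of weight zero reaches a column. -/
theorem exists_column (T : ℕ → Filling) (hT : ∀ k, IsTableau X (T k))
    (hw : ∀ k i, 0 < i → weightCoord (reading (T k)) i = 0)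
    (hstep : ∀ k, Turns X (T k) (T (k + 1))) : ∃ k, (T k).length ≤ 1 := by
  by_contra hc
  push Not at hc
  obtain ⟨L, hL⟩ : ∃ L, ∀ k, (reading (T k)).length = L := by
    refine ⟨(reading (T 0)).length, fun k => ?_⟩
    induction k with
    | zero => rfl
    | succ k ih => rw [((hstep k).weight (hw k)).2.2, ih]
  have hlen : ∀ k, (T k).length ≤ L ∧ ∀ C ∈ T k, C.length ≤ L := by
    intro k
    have := length_le_of_columns (hT k).columns_ne_nil
    rwa [hL k] at this
  choose x u hx m₀ hm using fun k => (hstep k).ins (hT k)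
  have hpop : ∀ k, ∃ D P, pop (T k) = D :: P ∧ D = (T k).headD [] ∧ D ∈ T k := by
    intro k
    have h1 := hc k
    match h : T k with
    | [] => rw [h] at h1; simp at h1
    | [C] => rw [h] at h1; simp at h1
    | C :: D :: S => exact ⟨C, _, rfl, rfl, by simp⟩
  -- The height of the first column stabilizes.
  obtain ⟨K₀, -, hK₀⟩ := exists_eventually_const (fun k => (((T k).headD []).length : ℤ))
    (K := 0) (C := L) (fun k _ => by
      obtain ⟨D, P, h1, rfl, -⟩ := hpop k
      obtain ⟨-, -, -, h2⟩ := hm k _ le_rfl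
      rw [h1] at h2
      exact_mod_cast h2.head.1) (fun k _ => by
      obtain ⟨D, P, -, rfl, h1⟩ := hpop k
      exact_mod_cast (hlen k).2 _ h1)
  -- From then on, the letters are bounded.
  obtain ⟨b, hb1, hb⟩ : ∃ b : ℕ, 1 ≤ b ∧ ∀ a ∈ reading (T K₀), a ≤ (b : ℤ) := by
    generalize reading (T K₀) = w
    induction w with
    | nil => exact ⟨1, le_rfl, by simp⟩
    | cons a w ih =>
      obtain ⟨b, h1, h2⟩ := ih
      refine ⟨b + a.natAbs, by omega, fun y hy => ?_⟩
      rcases List.mem_cons.mp hy with rfl | hy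
      · omega
      · have := h2 y hy; omega
  have hbound : ∀ k ≥ K₀, ColumnBound (L + 2) b (T k) := by
    intro k hk
    induction k, hk using Nat.le_induction with
    | base => exact columnBound_of_forall hb
    | succ k hk ih =>
      obtain ⟨N, hN⟩ : ∃ N : ℕ, ∀ a ∈ reading (T (k + 1)), a ≤ (N : ℤ) := by
        obtain ⟨m, hm⟩ := hT (k + 1)
        exact ⟨m + 1, fun a ha =>
          (abs_le.mp (hm.succ.full.inAlphabet hm.1.succ a ha).abs_le).2⟩
      obtain ⟨D, P, h1, h2, h3⟩ := hpop k
      obtain ⟨h4, h5, -, h6⟩ := hm k (max (m₀ k) (N + (L + 2))) (by omega)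
      refine h6.columnBound h5 hb1 ?_ ih.pop (fun C hC => ?_) (fun a ha => ?_) (by omega)
      -- The first column has kept its height, so the letter was not appended to it but slid through
      -- it, and is bounded by its letters.
      · rw [h1] at h6
        obtain ⟨z, D', P', h7, -⟩ := h6.head.2 (by rw [h2]; exact_mod_cast hK₀ k hk)
        have h8 := ih.pop
        rw [h1] at h8
        exact h7.le_of_mem h5 h8.1 (by exact_mod_cast hb1)
      · have := length_le_of_mem_pop (hlen k).2 C hC
        omega
      · have := hN a ha
        push_cast
        omega
  obtain ⟨B, hB⟩ : ∃ B : ℤ, ∀ k ≥ K₀, ∀ a ∈ reading (T k), -B ≤ a ∧ a ≤ B := by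
    have hup : ∀ k ≥ K₀, ∀ a ∈ reading (T k), a ≤ (b : ℤ) + L * (L + 2) := by
      intro k hk a ha
      have h1 := (hbound k hk).forall a ha
      have h2 : ((T k).length : ℤ) ≤ L := by exact_mod_cast (hlen k).1
      push_cast at h1
      nlinarith
    refine ⟨(b : ℤ) + L * (L + 2), fun k hk a ha => ⟨?_, hup k hk a ha⟩⟩
    -- In weight zero the opposite of each letter also occurs, so the upper bound gives the lower
    -- one.
    have h1 := excess_eq_zero_of_weight (hw k) a
    have h2 : 0 < (reading (T k)).count a := List.count_pos_iff.mpr ha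
    rw [excess] at h1
    have := hup k hk (-a) (List.count_pos_iff.mp (by omega))
    linarith
  -- The first columns stabilize.
  obtain ⟨s, ⟨K₁, hK₁⟩, hs⟩ := exists_liminf (fun k => (T k).length) fun k => (hlen k).1
  have hs2 : 2 ≤ s := by
    obtain ⟨k, -, hk⟩ := hs 0
    rw [← hk]
    exact hc k
  -- There are at least `s` columns at these times, so the removal of the first letter, which
  -- touches only the last column, leaves the first `s - 1` intact. The constant `W = B + 1` exceeds
  -- all letters.
  have hins : ∀ k ≥ max K₀ K₁, potential (B + 1) (s - 1) (T k) ≤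
      potential (B + 1) (s - 1) (T (k + 1)) ∧
      (potential (B + 1) (s - 1) (T (k + 1)) = potential (B + 1) (s - 1) (T k) →
        ∀ C ∈ (T k).take (s - 1), excess (x k) C = 1) := by
    intro k hk
    obtain ⟨h1, h2, -, h3⟩ := hm k _ le_rfl
    have h4 := hK₁ k (by omega)
    have h5 := length_pop (T k)
    have h6 := h3.potential h2 h1 (W := B + 1) (fun a ha => by
      have := hB (k + 1) (by omega) a ha
      omega) (k := s - 1) (by omega)
    have e : (pop (T k)).take (s - 1) = (T k).take (s - 1) := take_pop (by omega)
    rwa [potential, e] at h6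
  obtain ⟨K₂, hK₂, hconst⟩ := exists_eventually_const
    (fun k => potential (B + 1) (s - 1) (T k)) (K := max K₀ K₁) (C := (B + 1 + B) * L)
    (fun k hk => (hins k hk).1) (fun k hk => by
      rw [← hL k]
      refine potential_le ?_ (fun a ha => (hB k (by omega) a ha).1) _
      have := hB k (by omega) (x k) (by rw [hx k]; simp)
      omega)
  -- At a late time with exactly `s` columns, the first `s - 1` columns are all the columns but the
  -- last.
  obtain ⟨k, hk, hks⟩ := hs K₂
  obtain ⟨-, -, h1, -⟩ := hm k _ le_rfl
  exact h1.exists_excess_ne (hw k) (hx k) (s := s - 1) (by omega) (by omega)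
    ((hins k (by omega)).2 (hconst k hk))

end Termination

end OrthogonalTableaux

/-- Starting from a nonempty tableau `T₀` of weight `0` (seen as a weight with `n` zero parts), the
sequence `T_{k+1} = U(T_k)` is well defined up to some index `e` at which it stops; its terms
`T_0, …, T_e` are pairwise distinct tableaux of weight `0`, and the last one is a column. -/
theorem proposition4p5 (X : OrthogonalTableaux.OType) (n : ℕ)
    (T₀ : OrthogonalTableaux.tableauxOfWeight X (0 : Fin n → ℕ)) (hT₀ : T₀.1 ≠ []) :
    ∃ (e : ℕ) (T : ℕ → OrthogonalTableaux.tableauxOfWeight X (0 : Fin n → ℕ)),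
      T 0 = T₀ ∧
      (∀ k < e, (OrthogonalTableaux.cyclageGraph X (0 : Fin n → ℕ)).Adj (T k) (T (k + 1)) ∧
        ∀ S : OrthogonalTableaux.Filling,
          OrthogonalTableaux.IsCocyclage X n (T k).1 S → S = (T (k + 1)).1) ∧
      (∀ S : OrthogonalTableaux.Filling, ¬ OrthogonalTableaux.IsCocyclage X n (T e).1 S) ∧
      Set.InjOn T (Set.Iic e) ∧
      OrthogonalTableaux.IsColumn (T e).1 := by
  classical
  -- `Turns` does not ask for several columns, so the sequence can be continued indefinitely; `e`
  -- will be the first index at which a column is reached. Nonemptiness is preserved because the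
  -- number of boxes is.
  open OrthogonalTableaux in
  have hnext : ∀ T : {T : tableauxOfWeight X (0 : Fin n → ℕ) // T.1 ≠ []},
      ∃ F : {T : tableauxOfWeight X (0 : Fin n → ℕ) // T.1 ≠ []}, Turns X T.1.1 F.1.1 := by
    rintro ⟨⟨T, hT⟩, hne⟩
    obtain ⟨h1, h2⟩ := mem_tableauxOfWeight_zero.mp hT
    obtain ⟨F, hF⟩ := h1.exists_turns hne
    obtain ⟨h3, h4, h5⟩ := hF.weight h2
    refine ⟨⟨⟨F, mem_tableauxOfWeight_zero.mpr ⟨h3, h4⟩⟩, ?_⟩, hF⟩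
    rintro rfl
    obtain ⟨x, u, hx, -⟩ := hF
    rw [hx] at h5
    simp at h5
  choose next hnext using hnext
  obtain ⟨T, hT0, hT⟩ : ∃ T : ℕ → {T : OrthogonalTableaux.tableauxOfWeight X (0 : Fin n → ℕ) //
      T.1 ≠ []}, T 0 = ⟨T₀, hT₀⟩ ∧ ∀ k, T (k + 1) = next (T k) :=
    ⟨fun k => next^[k] ⟨T₀, hT₀⟩, rfl, fun k => Function.iterate_succ_apply' _ _ _⟩
  have hturn : ∀ k, OrthogonalTableaux.Turns X (T k).1.1 (T (k + 1)).1.1 := fun k => by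
    rw [hT]; exact hnext _
  have hspec := fun k => OrthogonalTableaux.mem_tableauxOfWeight_zero.mp (T k).1.2
  have hex := OrthogonalTableaux.exists_column (fun k => (T k).1.1) (fun k => (hspec k).1)
    (fun k => (hspec k).2) hturn
  have hiff := fun k F => OrthogonalTableaux.isCocyclage_iff (n := n) (F := F) (hspec k).1 (T k).2
    (hspec k).2
  have hlong : ∀ k < Nat.find hex, 1 < (T k).1.1.length := fun k hk => by
    have := Nat.find_min hex hk
    omega
  have hlast : (T (Nat.find hex)).1.1.length = 1 :=
    le_antisymm (Nat.find_spec hex) (List.length_pos_iff.mpr (T _).2)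
  refine ⟨Nat.find hex, fun k => (T k).1, by simp only [hT0], fun k hk => ⟨?_, fun S hS => ?_⟩,
    fun S hS => ?_, ?_, hlast⟩
  · exact (hiff k _).mpr ⟨hlong k hk, hturn k⟩
  · exact ((hiff k S).mp hS).2.unique (hturn k)
  · have := ((hiff _ S).mp hS).1
    omega
  -- With `e` the first index of a column, a coincidence `T a = T b` propagates to `T (a + (e - b))
  -- = T e`, a column at an index smaller than `e`.
  · have key : ∀ a b, a < b → b ≤ Nat.find hex → T a ≠ T b := by
      intro a b hab hb h
      have hper : ∀ j, T (a + j) = T (b + j) := by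
        intro j
        induction j with
        | zero => exact h
        | succ j ih => rw [← Nat.add_assoc, ← Nat.add_assoc, hT, hT, ih]
      have h1 := hper (Nat.find hex - b)
      rw [Nat.add_sub_cancel' hb] at h1
      have := hlong (a + (Nat.find hex - b)) (by omega)
      rw [h1] at this
      omega
    intro a ha b hb hab
    have hab : T a = T b := Subtype.ext hab
    rcases lt_trichotomy a b with h | h | h
    · exact absurd hab (key a b h hb)
    · exact h
    · exact absurd hab.symm (key b a h ha)
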